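/- Model. Programs run on a random access machine whose memory consists of natural-number variables and two-dimensional arrays of natural numbers; one step performs one assignment of a constant, addition, truncated subtraction, array read or write, fair coin flip, request of a fresh sample, or one unit of control flow (sequencing, test of a variable for zero in a conditional or a loop). For a graph $G$ on the vertex set $[n]$ let $\mathrm{Aut}(G)\le S_n$ be its automorphism group, and let $d_{\mathrm{TV}}$ be total variation distance. A *random-walk sampler* is a list $(s_1,\dots,s_m)$ of permutations of $[n]$ together with a number $T$ of steps: it starts at the identity and, $T$ times, picks a uniformly random index $i\in[m]$ and multiplies the current permutation by $s_i$; it outputs the permutation reached. (For $m=0$ the walk stays at the identity.) Its running time counts the choice of an index and the multiplication of two permutations as one unit each. Theorem. (1) (Inverse generation is easy.) There are one program $A$, a constant $C$, and functions $k(n,\delta)$, $T(n,\varepsilon)$ with values in $\mathbb N$ such that for every $n$, every graph $G$ on $[n]$ and all rational $\varepsilon,\delta\in(0,1]$ the following holds. $A$ is given $n,\varepsilon,\delta$ (each of $\varepsilon,\delta$ as numerator and denominator) and access to independent uniform random samples from $\mathrm{Aut}(G)$ in one-line notation, but not $G$ itself. Then, for all outcomes of the random choices, $A$ halts within $C\,(n+\log(1/\varepsilon)+\log(1/\delta)+1)^{C}$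 steps, having drawn exactly $k=k(n,\delta)\le C\,(n\log n+\log(1/\delta)+1)$ samples $g_1,\dots,g_k$, and it outputs the random-walk sampler with generators $g_1,\dots,g_k,g_1^{-1},\dots,g_k^{-1}$ and $T(n,\varepsilon)$ steps (that is, a random walk from the identity on the Cayley graph, with multiplicities, generated by the samples and their inverses), whose running time is at most $C\,(n\log n+\log(1/\varepsilon)+1)$. With probability at least $1-\delta$ the output distribution $D$ of this sampler satisfies $d_{\mathrm{TV}}(D,\mathcal U_{\mathrm{Aut}(G)})\le\varepsilon$. (2) (Forward generation is as hard as graph isomorphism.) There are constants $c\ge 1$ and $C$ such that for every $t:\mathbb N\to\mathbb N$: if there is a randomized program which, given the adjacency matrix of any graph $G$ on $[n]$ (for any $n$), halts within $t(n)$ steps and outputs a permutation whose distribution is within total variation distance $1/2$ of the uniform distribution on $\mathrm{Aut}(G)$ (an output that is not a permutation being allowed and counted as an extra outcome), then there is a randomized program which, given the adjacency matrices of any two graphs on $[n]$, halts within $C\,(t(n^{c})+1)^{C}$ steps and decides with probability at least $2/3$ whether the two graphs are isomorphic. -/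

import Mathlib

noncomputable section

namespace InvGen

open Equiv

/-! ### Randomized array programs with a step count -/

/-- Programs for a random access machine. The memory consists of natural-number variables
`var x` and two-dimensional arrays `arr a`, all addressed by natural numbers. The names of
variables and arrays are fixed in the program text; array indices are computed at run time.
The arithmetic is addition and truncated subtraction, one operation per step, so that a number
gains at most one bit per step. -/
inductive Prog : Type
  /-- do nothing -/
  | skip : Prog
  /-- `var x := c` -/
  | const (x c : ℕ) : Prog
  /-- `var x := var y + var z` -/
  | add (x y z : ℕ) : Prog
  /-- `var x := var y - var z`, truncated at `0` -/
  | sub (x y z : ℕ) : Prog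
  /-- `var x := arr a [var i] [var j]` -/
  | load (x a i j : ℕ) : Prog
  /-- `arr a [var i] [var j] := var x` -/
  | store (a i j x : ℕ) : Prog
  /-- `var x :=` a fair random bit -/
  | flip (x : ℕ) : Prog
  /-- request a fresh sample from the sample source and write it to row `var i` of `arr a` -/
  | draw (a i : ℕ) : Prog
  /-- `p` and then `q` -/
  | seq (p q : Prog) : Prog
  /-- `if var x ≠ 0 then p else q` -/
  | ite (x : ℕ) (p q : Prog) : Prog
  /-- `while var x ≠ 0 do p` -/
  | loop (x : ℕ) (p : Prog) : Prog

/-- The program contains no instruction that requests a sample. -/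
def Prog.DrawFree : Prog → Prop
  | .draw _ _ => False
  | .seq p q => p.DrawFree ∧ q.DrawFree
  | .ite _ p q => p.DrawFree ∧ q.DrawFree
  | .loop _ p => p.DrawFree
  | _ => True

/-- A source of independent samples: their law, and the row of numbers by which a sample is
presented to the program. -/
structure Source (Ω : Type) where
  law : PMF Ω
  row : Ω → ℕ → ℕ

/-- The memory. The field `samples` records the samples received so far, oldest first; no
instruction can read it. -/
structure State (Ω : Type) where
  var : ℕ → ℕ
  arr : ℕ → ℕ → ℕ → ℕ
  samples : List Ω

variable {Ω : Type}

def State.setVar (s : State Ω) (x v : ℕ) : State Ω :=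
  { s with var := Function.update s.var x v }

def State.setRow (s : State Ω) (a i : ℕ) (r : ℕ → ℕ) : State Ω :=
  { s with arr := Function.update s.arr a (Function.update (s.arr a) i r) }

def State.setArr (s : State Ω) (a i j v : ℕ) : State Ω :=
  s.setRow a i (Function.update (s.arr a i) j v)

/-- The initial memory: the given variables and arrays, no sample received yet. -/
def State.init (var : ℕ → ℕ) (arr : ℕ → ℕ → ℕ → ℕ) : State Ω := ⟨var, arr, []⟩

/-- A configuration: the stack of programs still to be executed, and the memory. -/
structure Config (Ω : Type) where
  todo : List Prog
  state : State Ω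

/-- The machine has halted. -/
def Config.Halted (c : Config Ω) : Prop := c.todo = []

/-- One step of the machine. A halted configuration stays as it is. -/
def step (src : Source Ω) : Config Ω → PMF (Config Ω)
  | ⟨[], s⟩ => PMF.pure ⟨[], s⟩
  | ⟨.skip :: k, s⟩ => PMF.pure ⟨k, s⟩
  | ⟨.const x c :: k, s⟩ => PMF.pure ⟨k, s.setVar x c⟩
  | ⟨.add x y z :: k, s⟩ => PMF.pure ⟨k, s.setVar x (s.var y + s.var z)⟩
  | ⟨.sub x y z :: k, s⟩ => PMF.pure ⟨k, s.setVar x (s.var y - s.var z)⟩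
  | ⟨.load x a i j :: k, s⟩ => PMF.pure ⟨k, s.setVar x (s.arr a (s.var i) (s.var j))⟩
  | ⟨.store a i j x :: k, s⟩ => PMF.pure ⟨k, s.setArr a (s.var i) (s.var j) (s.var x)⟩
  | ⟨.flip x :: k, s⟩ =>
      (PMF.uniformOfFintype Bool).map fun b => ⟨k, s.setVar x b.toNat⟩
  | ⟨.draw a i :: k, s⟩ =>
      src.law.map fun ω =>
        ⟨k, { s.setRow a (s.var i) (src.row ω) with samples := s.samples ++ [ω] }⟩
  | ⟨.seq p q :: k, s⟩ => PMF.pure ⟨p :: q :: k, s⟩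
  | ⟨.ite x p q :: k, s⟩ => PMF.pure ⟨(if s.var x ≠ 0 then p else q) :: k, s⟩
  | ⟨.loop x p :: k, s⟩ =>
      PMF.pure ⟨if s.var x ≠ 0 then p :: .loop x p :: k else k, s⟩

/-- The law of the configuration after `t` steps. -/
def runFrom (src : Source Ω) : ℕ → Config Ω → PMF (Config Ω)
  | 0, c => PMF.pure c
  | t + 1, c => (step src c).bind (runFrom src t)

/-- The law of the configuration reached by the program `p`, started in the memory `s`, after
`t` steps. -/
def run (src : Source Ω) (p : Prog) (s : State Ω) (t : ℕ) : PMF (Config Ω) :=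
  runFrom src t ⟨[p], s⟩

/-- The trivial source, for programs that request no samples. -/
def noSource : Source Unit := ⟨PMF.pure (), fun _ _ => 0⟩

/-- The probability of an event. -/
def prob {α : Type} (μ : PMF α) (E : Set α) : ℝ := (μ.toOuterMeasure E).toReal

/-- Total variation distance of two distributions on a finite set. -/
def tvDist {α : Type} [Fintype α] (μ ν : PMF α) : ℝ :=
  (1 / 2) * ∑ a, |(μ a).toReal - (ν a).toReal|

/-! ### Graphs, automorphisms and their encodings -/

/-- The automorphism group of a graph on `n` vertices, as a subgroup of the symmetric group. -/
def Aut {n : ℕ} (G : SimpleGraph (Fin n)) : Subgroup (Perm (Fin n)) where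
  carrier := {σ | ∀ x y, G.Adj x y ↔ G.Adj (σ x) (σ y)}
  one_mem' := fun _ _ => Iff.rfl
  mul_mem' := fun {σ τ} hσ hτ x y => (hτ x y).trans (hσ (τ x) (τ y))
  inv_mem' := fun {σ} hσ x y => by
    have h := hσ (σ⁻¹ x) (σ⁻¹ y)
    rw [← Perm.mul_apply, ← Perm.mul_apply, mul_inv_cancel] at h
    exact h.symm

/-- The uniform distribution over the automorphism group. -/
def uniformAut {n : ℕ} (G : SimpleGraph (Fin n)) : PMF (Perm (Fin n)) :=
  haveI : Fintype (Aut G) := Fintype.ofFinite _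
  (PMF.uniformOfFintype (Aut G)).map Subtype.val

/-- One-line notation of a permutation, followed by zeros. -/
def oneLine {n : ℕ} (σ : Perm (Fin n)) (v : ℕ) : ℕ :=
  if h : v < n then (σ ⟨v, h⟩ : ℕ) else 0

/-- The source of uniform random automorphisms of `G`, presented in one-line notation. -/
def autSource {n : ℕ} (G : SimpleGraph (Fin n)) : Source (Perm (Fin n)) :=
  ⟨uniformAut G, oneLine⟩

open Classical in
/-- The permutation whose one-line notation stands in the first `n` entries of the row, if
there is one. -/
def readPerm (n : ℕ) (r : ℕ → ℕ) : Option (Perm (Fin n)) :=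
  if h : ∃ σ : Perm (Fin n), ∀ v : Fin n, r v = (σ v : ℕ) then some h.choose else none

open Classical in
/-- The adjacency matrix of a graph, padded with zeros. -/
def adjArray {n : ℕ} (G : SimpleGraph (Fin n)) (u v : ℕ) : ℕ :=
  if ∃ (hu : u < n) (hv : v < n), G.Adj ⟨u, hu⟩ ⟨v, hv⟩ then 1 else 0

/-! ### Random walks on Cayley graphs as samplers -/

/-- A sampler that performs a random walk on a Cayley graph of permutations: a list of
generators (with multiplicity) and a number of steps. -/
structure CayleySampler (n : ℕ) where
  gens : List (Perm (Fin n))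
  steps : ℕ

/-- The walk of the given number of steps along the list `S`, started from the permutation `x`
with the clock at `t`: in every step a uniformly random position of the list is chosen and the
current permutation is multiplied by the generator there; choosing a position and
multiplying two permutations are charged one unit of time each. -/
def walk {n : ℕ} (S : List (Perm (Fin n))) : ℕ → Perm (Fin n) × ℕ → PMF (Perm (Fin n) × ℕ)
  | 0, z => PMF.pure z
  | m + 1, (x, t) =>
      if h : 0 < S.length then
        haveI : Nonempty (Fin S.length) := ⟨⟨0, h⟩⟩
        (PMF.uniformOfFintype (Fin S.length)).bind fun i => walk S m (x * S.get i, t + 2)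
      else walk S m (x, t + 2)

/-- The joint law of the output and the running time of the sampler, started at the identity. -/
def CayleySampler.exec {n : ℕ} (W : CayleySampler n) : PMF (Perm (Fin n) × ℕ) :=
  walk W.gens W.steps (1, 0)

/-- The output distribution of the sampler. -/
def CayleySampler.law {n : ℕ} (W : CayleySampler n) : PMF (Perm (Fin n)) :=
  W.exec.map Prod.fst

/-- The running time of the sampler is at most `b` for all outcomes of its random choices. -/
def CayleySampler.TimeAtMost {n : ℕ} (W : CayleySampler n) (b : ℝ) : Prop :=
  ∀ z ∈ W.exec.support, (z.2 : ℝ) ≤ b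

/-- The memory holds the description of the sampler `W`: the number of generators in `var 0`,
the number of steps in `var 1`, and the generators in one-line notation in the rows of
`arr 0`. -/
def Describes {n : ℕ} {Ω : Type} (s : State Ω) (W : CayleySampler n) : Prop :=
  s.var 0 = W.gens.length ∧ s.var 1 = W.steps ∧
    ∀ (i : Fin W.gens.length) (v : Fin n), s.arr 0 i v = (W.gens.get i v : ℕ)

/-- The input of the inverse generation problem: the number `n` and the rational numbers `ε`
and `δ`, each as numerator and denominator. -/
def inverseInput {Ω : Type} (n : ℕ) (ε δ : ℚ) : State Ω :=
  State.init
    (fun x => match x with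
      | 0 => n
      | 1 => ε.num.toNat
      | 2 => ε.den
      | 3 => δ.num.toNat
      | 4 => δ.den
      | _ => 0)
    (fun _ _ _ => 0)

/-! ### Forward generation and graph isomorphism -/

/-- The input of forward generation: the number of vertices in `var 0`, the graph in `arr 0`. -/
def graphInput {n : ℕ} (G : SimpleGraph (Fin n)) : State Unit :=
  State.init (fun x => if x = 0 then n else 0) (fun a => if a = 0 then adjArray G else 0)

/-- The randomized program `p`, given a graph with `n` vertices, halts within `t n` steps and
leaves in row `0` of `arr 1` a permutation whose distribution is within total variation
distance `η` of uniform over the automorphism group. (`none` stands for an output that is not a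
permutation.) -/
def GeneratesAut (p : Prog) (t : ℕ → ℕ) (η : ℝ) : Prop :=
  p.DrawFree ∧ ∀ (n : ℕ) (G : SimpleGraph (Fin n)),
    (∀ c ∈ (run noSource p (graphInput G) (t n)).support, c.Halted) ∧
    tvDist
      ((run noSource p (graphInput G) (t n)).map fun c => readPerm n (c.state.arr 1 0))
      ((uniformAut G).map some) ≤ η

/-- The input of graph isomorphism: the number of vertices in `var 0`, the graphs in `arr 0`
and `arr 1`. -/
def graphPairInput {n : ℕ} (G₁ G₂ : SimpleGraph (Fin n)) : State Unit :=
  State.init (fun x => if x = 0 then n else 0)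
    (fun a => if a = 0 then adjArray G₁ else if a = 1 then adjArray G₂ else 0)

/-- The randomized program `p`, given two graphs with `n` vertices, halts within `t n` steps
and decides with probability at least `2/3` whether they are isomorphic. The answer is `1` (yes)
or `0` (no) in `var 0`. -/
def DecidesGraphIso (p : Prog) (t : ℕ → ℕ) : Prop :=
  p.DrawFree ∧ ∀ (n : ℕ) (G₁ G₂ : SimpleGraph (Fin n)),
    (∀ c ∈ (run noSource p (graphPairInput G₁ G₂) (t n)).support, c.Halted) ∧
    (Nonempty (G₁ ≃g G₂) →
      2 / 3 ≤ prob (run noSource p (graphPairInput G₁ G₂) (t n)) {c | c.state.var 0 = 1}) ∧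
    (IsEmpty (G₁ ≃g G₂) →
      2 / 3 ≤ prob (run noSource p (graphPairInput G₁ G₂) (t n)) {c | c.state.var 0 = 0})

end InvGen

end

/-! Inverse generation. Let H = Aut(G), so |H| ≤ n!, let W be the transition matrix of the walk
along k uniform samples and their inverses, and J the averaging matrix. W is symmetric and J absorbs
it on both sides, so the squared Frobenius norm of (W - J)^m is tr W^(2m) - 1, and tr W^(2m) is |H|
times the fraction of words of length 2m with value 1. Average this over the samples. A word in
which some index occurs exactly once is trivial with probability at most 1/|H|, because the other
generators leave at most one choice for that one (`card_wordVal_eq_one_mul_le`); these words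
contribute at most 1 and are paid for by the -1. All other words use at most m indices, and for k ≥
24m they make up a fraction of at most 8^(-m) (`repetitive_fraction_le`). So the mean is at most
|H|/8^m, and by Markov's inequality ‖W - J‖ > 1/2 has probability at most |H|/2^m
(`card_not_expander_le`). Otherwise T steps of the walk bring the L1 distance from uniform below
√|H|/2^T (`sum_abs_walkMat_pow_sub_le`). Taking m and T slightly larger than log(n!/δ) and log(n!/ε)
suffices (`prob_iid_good`).

Forward generation. Put an apex over each graph, so that it becomes connected, and form the disjoint
union of one cone over G₁ and twelve cones over G₂, padded by isolated vertices to n^6 vertices. If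
the graphs are isomorphic, the first cone can be exchanged with any other, so a uniform automorphism
keeps its apex in place with probability at most 1/13 (`card_fixing_le`). An automorphism moving the
apex out of the first cone embeds that cone into another one. Conversely any row of numbers that
passes this test, automorphism or not, yields an isomorphism (`nonempty_iso_of_embedsFirst`), so the
error is one-sided. A generator within distance 1/2 of uniform passes with probability at least
12/13 - 1/2 = 11/26, and two independent runs both fail with probability at most (15/26)^2 < 1/3.
The polynomial overhead is covered by t(n^6), since even writing down a permutation of n^6 points
takes about n^6 steps (`le_time_of_generatesAut`).

Both reductions are explicit programs. `Exec` describes the law of the memory after a piece of code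
within a step budget, and `Reaches` is its deterministic case, used with loop invariants.
`exec_rename` runs the given generator as a subroutine on its own part of the memory. -/

namespace InvGen

variable {Ω : Type} {src : Source Ω}

/-! ### Compositional reasoning about programs -/

/-- Executing the programs in `l` from the memory `s` takes at most `t` steps and leaves a memory
with law `μ`, whatever remains to be executed afterwards. -/
def Exec (src : Source Ω) (l : List Prog) (s : State Ω) (t : ℕ) (μ : PMF (State Ω)) : Prop :=
  -- The second component of `ν` is the unused part of the budget `t`. It depends on the random
  -- outcome and is handed to the continuation `K`; this makes upper bounds on running times compose
  -- although the machine is run for an exact number of steps.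
  ∃ ν : PMF (State Ω × ℕ), ν.map Prod.fst = μ ∧ ∀ (K : List Prog) (u : ℕ),
    runFrom src (t + u) ⟨l ++ K, s⟩ = ν.bind fun z => runFrom src (z.2 + u) ⟨K, z.1⟩

theorem runFrom_nil (t : ℕ) (s : State Ω) :
    runFrom src t ⟨[], s⟩ = PMF.pure ⟨[], s⟩ := by
  induction t with
  | zero => rfl
  | succ t ih => simp [runFrom, step, ih]

theorem Exec.mono {l : List Prog} {s : State Ω} {t t' : ℕ} {μ : PMF (State Ω)}
    (h : Exec src l s t μ) (ht : t ≤ t') : Exec src l s t' μ := by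
  obtain ⟨ν, hν, h⟩ := h
  refine ⟨ν.map fun z => (z.1, z.2 + (t' - t)), ?_, fun K u => ?_⟩
  · rw [PMF.map_comp]; exact hν
  · rw [show t' + u = t + ((t' - t) + u) by omega, h, PMF.bind_map]
    simp only [Function.comp_def, add_assoc]

theorem Exec.runFrom_eq {l : List Prog} {s : State Ω} {t : ℕ} {μ : PMF (State Ω)}
    (h : Exec src l s t μ) : runFrom src t ⟨l, s⟩ = μ.map fun s' => ⟨[], s'⟩ := by
  obtain ⟨ν, rfl, h⟩ := h
  have := h [] 0
  simp only [List.append_nil, add_zero, runFrom_nil] at this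
  rw [this, PMF.map_comp, ← PMF.bind_pure_comp]
  rfl

theorem Exec.run_eq {p : Prog} {s : State Ω} {t : ℕ} {μ : PMF (State Ω)}
    (h : Exec src [p] s t μ) : run src p s t = μ.map fun s' => ⟨[], s'⟩ :=
  h.runFrom_eq

theorem exec_nil (s : State Ω) : Exec src [] s 0 (PMF.pure s) :=
  ⟨PMF.pure (s, 0), by rw [PMF.pure_map], fun K u => by simp⟩

theorem bind_congr_support {α β : Type} {μ : PMF α} {f g : α → PMF β}
    (h : ∀ a ∈ μ.support, f a = g a) : μ.bind f = μ.bind g := by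
  ext b
  simp only [PMF.bind_apply]
  refine tsum_congr fun a => ?_
  by_cases ha : a ∈ μ.support
  · rw [h a ha]
  · rw [PMF.mem_support_iff, not_not] at ha
    simp [ha]

/-- The steps that `l` leaves unused are added to those that `l'` leaves unused. The second
execution is known only on the support of `μ`, so a joint law is chosen there and set arbitrarily
elsewhere. -/
theorem Exec.append {l l' : List Prog} {s : State Ω} {t t' : ℕ} {μ : PMF (State Ω)}
    {κ : State Ω → PMF (State Ω)} (h : Exec src l s t μ)
    (h' : ∀ s' ∈ μ.support, Exec src l' s' t' (κ s')) :
    Exec src (l ++ l') s (t + t') (μ.bind κ) := by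
  classical
  obtain ⟨ν, rfl, h⟩ := h
  have hex : ∀ s', ∃ ξ : PMF (State Ω × ℕ), s' ∈ (ν.map Prod.fst).support →
      ξ.map Prod.fst = κ s' ∧ ∀ (K : List Prog) (u : ℕ),
        runFrom src (t' + u) ⟨l' ++ K, s'⟩ =
          ξ.bind fun z => runFrom src (z.2 + u) ⟨K, z.1⟩ := fun s' => by
    by_cases hs : s' ∈ (ν.map Prod.fst).support
    · obtain ⟨ξ, h1, h2⟩ := h' s' hs
      exact ⟨ξ, fun _ => ⟨h1, h2⟩⟩
    · exact ⟨PMF.pure (s', 0), fun hc => absurd hc hs⟩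
  choose ξ hξ using hex
  have hmem : ∀ z ∈ ν.support, z.1 ∈ (ν.map Prod.fst).support := fun z hz => by
    rw [PMF.support_map]; exact ⟨z, hz, rfl⟩
  refine ⟨ν.bind fun z => (ξ z.1).map fun y => (y.1, y.2 + z.2), ?_, fun K u => ?_⟩
  · rw [PMF.map_bind, PMF.bind_map]
    refine bind_congr_support fun z hz => ?_
    rw [PMF.map_comp, Function.comp_apply, ← (hξ z.1 (hmem z hz)).1]
    rfl
  · rw [List.append_assoc, add_assoc, h, PMF.bind_bind]
    refine bind_congr_support fun z hz => ?_
    rw [show z.2 + (t' + u) = t' + (z.2 + u) by omega, (hξ z.1 (hmem z hz)).2, PMF.bind_map]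
    simp only [Function.comp_def, add_assoc]

/-- A first step followed by the execution of what it leaves. -/
theorem exec_step {p : Prog} {l : List Prog} {s : State Ω} {t : ℕ} {μ : PMF (State Ω)}
    (hs : ∀ K, step src ⟨p :: K, s⟩ = PMF.pure ⟨l ++ K, s⟩) (h : Exec src l s t μ) :
    Exec src [p] s (t + 1) μ := by
  obtain ⟨ν, hν, h⟩ := h
  refine ⟨ν, hν, fun K u => ?_⟩
  rw [show t + 1 + u = t + u + 1 by omega]
  simp only [List.singleton_append, runFrom, hs, PMF.pure_bind, h]

theorem exec_basic {p : Prog} {s s' : State Ω}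
    (hs : ∀ K, step src ⟨p :: K, s⟩ = PMF.pure ⟨K, s'⟩) :
    Exec src [p] s 1 (PMF.pure s') := by
  refine ⟨PMF.pure (s', 0), by rw [PMF.pure_map], fun K u => ?_⟩
  rw [add_comm]
  simp only [List.singleton_append, runFrom, hs, PMF.pure_bind, zero_add]

theorem exec_seq {p q : Prog} {s : State Ω} {t t' : ℕ} {μ : PMF (State Ω)}
    {κ : State Ω → PMF (State Ω)} (h : Exec src [p] s t μ)
    (h' : ∀ s' ∈ μ.support, Exec src [q] s' t' (κ s')) :
    Exec src [.seq p q] s (t + t' + 1) (μ.bind κ) :=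
  exec_step (fun _ => rfl) (h.append h')

theorem exec_ite {x : ℕ} {p q : Prog} {s : State Ω} {t : ℕ} {μ : PMF (State Ω)}
    (h : Exec src [if s.var x ≠ 0 then p else q] s t μ) :
    Exec src [.ite x p q] s (t + 1) μ :=
  exec_step (fun _ => rfl) h

theorem exec_loop_zero {x : ℕ} {p : Prog} {s : State Ω} (h : s.var x = 0) :
    Exec src [.loop x p] s 1 (PMF.pure s) :=
  exec_basic fun K => by simp [step, h]

theorem exec_loop_succ {x : ℕ} {p : Prog} {s : State Ω} {t t' : ℕ} {μ : PMF (State Ω)}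
    {κ : State Ω → PMF (State Ω)} (hx : s.var x ≠ 0) (h : Exec src [p] s t μ)
    (h' : ∀ s' ∈ μ.support, Exec src [.loop x p] s' t' (κ s')) :
    Exec src [.loop x p] s (t + t' + 1) (μ.bind κ) :=
  exec_step (fun K => by simp [step, hx]) (h.append h')

/-- The memory after a sample has been received. -/
def State.recv (src : Source Ω) (s : State Ω) (a i : ℕ) (ω : Ω) : State Ω :=
  { s.setRow a (s.var i) (src.row ω) with samples := s.samples ++ [ω] }

/-- The draw is fused with its continuation so that the law after it can be indexed by the sample
itself instead of by the memory holding it. -/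
theorem exec_draw_seq {a i : ℕ} {q : Prog} {s : State Ω} {t : ℕ} {κ : Ω → PMF (State Ω)}
    (h : ∀ ω, Exec src [q] (s.recv src a i ω) t (κ ω)) :
    Exec src [.seq (.draw a i) q] s (t + 2) (src.law.bind κ) := by
  choose ξ hξ h using h
  refine ⟨src.law.bind ξ, by rw [PMF.map_bind]; simp only [hξ], fun K u => ?_⟩
  rw [show t + 2 + u = t + u + 1 + 1 by omega, PMF.bind_bind]
  simp only [List.singleton_append, runFrom, step, PMF.pure_bind, PMF.bind_map,
    Function.comp_def]
  refine congrArg _ (funext fun ω => ?_)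
  exact h ω K u

/-- Programs that halt within `t` steps can be used as subroutines. -/
theorem exec_of_halts : ∀ (t : ℕ) (l : List Prog) (s : State Ω),
    (∀ c ∈ (runFrom src t ⟨l, s⟩).support, c.Halted) → ∃ μ, Exec src l s t μ := by
  classical
  intro t
  induction t with
  | zero =>
    intro l s h
    have : l = [] := h ⟨l, s⟩ (by simp [runFrom])
    subst this
    exact ⟨_, exec_nil s⟩
  | succ t ih =>
    intro l s h
    cases l with
    | nil => exact ⟨_, (exec_nil s).mono (Nat.zero_le _)⟩
    | cons p l =>
      have hex : ∀ c, ∃ ξ : PMF (State Ω × ℕ), c ∈ (step src ⟨p :: l, s⟩).support →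
          ∀ (K : List Prog) (u : ℕ), runFrom src (t + u) ⟨c.todo ++ K, c.state⟩ =
            ξ.bind fun z => runFrom src (z.2 + u) ⟨K, z.1⟩ := fun c => by
        by_cases hc : c ∈ (step src ⟨p :: l, s⟩).support
        · obtain ⟨μ, ξ, -, hξ⟩ := ih c.todo c.state fun c' hc' => h c' (by
            rw [runFrom, PMF.mem_support_bind_iff]
            exact ⟨c, hc, hc'⟩)
          exact ⟨ξ, fun _ => hξ⟩
        · exact ⟨PMF.pure (s, 0), fun h => absurd h hc⟩
      choose ξ hξ using hex
      -- A step inspects only the top of a nonempty stack, so programs placed underneath do not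
      -- affect it.
      have happ : ∀ K, step src ⟨p :: l ++ K, s⟩ =
          (step src ⟨p :: l, s⟩).map fun c => ⟨c.todo ++ K, c.state⟩ := fun K => by
        cases p <;> simp [step, PMF.pure_map, PMF.map_comp, Function.comp_def]
        all_goals split_ifs <;> simp
      refine ⟨_, (step src ⟨p :: l, s⟩).bind ξ, rfl, fun K u => ?_⟩
      rw [show t + 1 + u = t + u + 1 by omega, runFrom, happ, PMF.bind_map, PMF.bind_bind]
      exact bind_congr_support fun c hc => hξ c hc K u

/-! ### Deterministic programs -/

/-- From the memory `s` the program `p` runs deterministically, for at most `t` steps, into a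
memory that satisfies `Q`. -/
def Reaches (src : Source Ω) (s : State Ω) (p : Prog) (t : ℕ) (Q : State Ω → Prop) : Prop :=
  ∃ s', Exec src [p] s t (PMF.pure s') ∧ Q s'

theorem Reaches.mono {s : State Ω} {p : Prog} {t t' : ℕ} {Q Q' : State Ω → Prop}
    (h : Reaches src s p t Q) (ht : t ≤ t') (hQ : ∀ s', Q s' → Q' s') :
    Reaches src s p t' Q' := by
  obtain ⟨s', h, hs⟩ := h
  exact ⟨s', h.mono ht, hQ _ hs⟩

theorem Reaches.seq {s : State Ω} {p q : Prog} {t t' : ℕ} {Q R : State Ω → Prop}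
    (h : Reaches src s p t Q) (h' : ∀ s', Q s' → Reaches src s' q t' R) :
    Reaches src s (.seq p q) (t + t' + 1) R := by
  obtain ⟨s', h, hs⟩ := h
  obtain ⟨s'', h'', hr⟩ := h' s' hs
  refine ⟨s'', ?_, hr⟩
  have := exec_seq (κ := fun _ => PMF.pure s'') h fun s₁ hs₁ => by
    rw [PMF.mem_support_pure_iff] at hs₁
    exact hs₁ ▸ h''
  rwa [PMF.pure_bind] at this

theorem Reaches.ite {s : State Ω} {x : ℕ} {p q : Prog} {t : ℕ} {Q : State Ω → Prop}
    (h₁ : s.var x ≠ 0 → Reaches src s p t Q) (h₂ : s.var x = 0 → Reaches src s q t Q) :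
    Reaches src s (.ite x p q) (t + 1) Q := by
  by_cases hx : s.var x = 0
  · obtain ⟨s', h, hq⟩ := h₂ hx
    exact ⟨s', exec_ite (by simpa [hx] using h), hq⟩
  · obtain ⟨s', h, hq⟩ := h₁ hx
    exact ⟨s', exec_ite (by simpa [hx] using h), hq⟩

/-- The rule for loops: `I m` is the invariant when `m` rounds remain. -/
theorem Reaches.loop {x : ℕ} {p : Prog} {t : ℕ} (I : ℕ → State Ω → Prop)
    (h0 : ∀ s, I 0 s → s.var x = 0)
    (h1 : ∀ m s, I (m + 1) s → s.var x ≠ 0 ∧ Reaches src s p t (I m)) :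
    ∀ (m : ℕ) (s : State Ω), I m s →
      Reaches src s (.loop x p) (m * (t + 1) + 1) (I 0) := by
  intro m
  induction m with
  | zero => exact fun s hs => ⟨s, (exec_loop_zero (h0 s hs)).mono (by omega), hs⟩
  | succ m ih =>
    intro s hs
    obtain ⟨hx, s', h, hs'⟩ := h1 m s hs
    obtain ⟨s'', h'', hr⟩ := ih s' hs'
    refine ⟨s'', ?_, hr⟩
    have := exec_loop_succ (κ := fun _ => PMF.pure s'') hx h fun s₁ hs₁ => by
      rw [PMF.mem_support_pure_iff] at hs₁
      exact hs₁ ▸ h''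
    rw [PMF.pure_bind] at this
    exact this.mono (by ring_nf; omega)

/-- Straight-line instructions. -/
def Prog.IsBasic : Prog → Prop
  | .skip | .const _ _ | .add _ _ _ | .sub _ _ _ | .load _ _ _ _ | .store _ _ _ _ => True
  | _ => False

/-- The effect of a straight-line instruction. -/
def State.effect (s : State Ω) : Prog → State Ω
  | .const x c => s.setVar x c
  | .add x y z => s.setVar x (s.var y + s.var z)
  | .sub x y z => s.setVar x (s.var y - s.var z)
  | .load x a i j => s.setVar x (s.arr a (s.var i) (s.var j))
  | .store a i j x => s.setArr a (s.var i) (s.var j) (s.var x)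
  | _ => s

/-- A block of straight-line code. -/
def block : List Prog → Prog
  | [] => .skip
  | p :: l => .seq p (block l)

/-- Each instruction costs two steps, one for itself and one for its `seq`; the last step is the
final `skip`. -/
theorem reaches_block {l : List Prog} (hl : ∀ p ∈ l, p.IsBasic) {s : State Ω}
    {Q : State Ω → Prop} (h : Q (l.foldl State.effect s)) :
    Reaches src s (block l) (2 * l.length + 1) Q := by
  induction l generalizing s with
  | nil => exact ⟨s, exec_basic fun _ => rfl, h⟩
  | cons p l ih =>
    have hp : Reaches src s p 1 fun s' => s' = s.effect p := by
      refine ⟨_, exec_basic fun K => ?_, rfl⟩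
      have := hl p (by simp)
      cases p <;> first | rfl | exact this.elim
    refine (hp.seq (t' := 2 * l.length + 1) (R := Q) ?_).mono
      (by simp only [List.length_cons]; omega) fun _ h => h
    rintro _ rfl
    exact ih (fun q hq => hl q (by simp [hq])) h

/-! ### Reading the memory after an update -/

@[simp] theorem State.setVar_var (s : State Ω) (x v y : ℕ) :
    (s.setVar x v).var y = if y = x then v else s.var y := by
  simp [State.setVar, Function.update_apply]

@[simp] theorem State.setVar_arr (s : State Ω) (x v : ℕ) : (s.setVar x v).arr = s.arr := rfl

@[simp] theorem State.setVar_samples (s : State Ω) (x v : ℕ) :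
    (s.setVar x v).samples = s.samples := rfl

@[simp] theorem State.setArr_var (s : State Ω) (a i j v : ℕ) :
    (s.setArr a i j v).var = s.var := rfl

@[simp] theorem State.setArr_samples (s : State Ω) (a i j v : ℕ) :
    (s.setArr a i j v).samples = s.samples := rfl

@[simp] theorem State.setArr_arr (s : State Ω) (a i j v a' i' j' : ℕ) :
    (s.setArr a i j v).arr a' i' j' =
      if a' = a ∧ i' = i ∧ j' = j then v else s.arr a' i' j' := by
  by_cases ha : a' = a
  · subst ha
    by_cases hi : i' = i
    · subst hi
      simp [State.setArr, State.setRow, Function.update_apply]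
    · simp [State.setArr, State.setRow, hi]
  · simp [State.setArr, State.setRow, ha]

@[simp] theorem State.recv_var (s : State Ω) (a i : ℕ) (ω : Ω) :
    (s.recv src a i ω).var = s.var := rfl

@[simp] theorem State.recv_samples (s : State Ω) (a i : ℕ) (ω : Ω) :
    (s.recv src a i ω).samples = s.samples ++ [ω] := rfl

@[simp] theorem State.recv_arr (s : State Ω) (a i : ℕ) (ω : Ω) (a' i' j' : ℕ) :
    (s.recv src a i ω).arr a' i' j' =
      if a' = a ∧ i' = s.var i then src.row ω j' else s.arr a' i' j' := by
  by_cases ha : a' = a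
  · subst ha
    by_cases hi : i' = s.var i
    · subst hi
      simp [State.recv, State.setRow]
    · simp [State.recv, State.setRow, hi]
  · simp [State.recv, State.setRow, ha]

end InvGen

set_option linter.unusedSectionVars false

namespace InvGen

open scoped Matrix.Norms.L2Operator

/-! ### Random Cayley graphs are expanders -/

section Expander

variable {H : Type} [Group H] [Fintype H] [DecidableEq H]

/-- The matrix of the right multiplication by `s`. -/
def mulMat (s : H) : Matrix H H ℝ := Matrix.of fun x y => if x * s = y then 1 else 0

theorem mulMat_mul (s t : H) : mulMat s * mulMat t = mulMat (s * t) := by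
  ext x y
  simp only [mulMat, Matrix.mul_apply, Matrix.of_apply, ite_mul, one_mul, zero_mul,
    Finset.sum_ite_eq, Finset.mem_univ, if_true, mul_assoc]

theorem mulMat_one : mulMat (1 : H) = 1 := by
  ext x y
  simp [mulMat, Matrix.one_apply]

theorem mulMat_transpose (s : H) : (mulMat s).transpose = mulMat s⁻¹ := by
  ext x y
  simp only [mulMat, Matrix.transpose_apply, Matrix.of_apply]
  congr 1
  rw [eq_iff_iff, eq_comm, mul_inv_eq_iff_eq_mul]

/-- Right multiplication by a nontrivial element has no fixed point. This is what turns the trace of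
a power of the walk into a count of words with value 1. -/
theorem trace_mulMat (s : H) :
    (mulMat s).trace = if s = 1 then (Fintype.card H : ℝ) else 0 := by
  simp only [Matrix.trace, Matrix.diag, mulMat, Matrix.of_apply, mul_eq_left]
  split_ifs <;> simp

/-! ### Words in the generators -/

/-- A generator or its inverse. -/
def letter {ι : Type} (g : ι → H) (a : ι × Bool) : H := if a.2 then g a.1 else (g a.1)⁻¹

/-- The value of a word in the generators and their inverses. -/
def wordVal {ι : Type} {q : ℕ} (g : ι → H) (w : Fin q → ι × Bool) : H :=
  (List.ofFn fun p => letter g (w p)).prod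

theorem wordVal_cons {ι : Type} {q : ℕ} (g : ι → H) (a : ι × Bool) (w : Fin q → ι × Bool) :
    wordVal g (Fin.cons a w : Fin (q + 1) → ι × Bool) = letter g a * wordVal g w := by
  simp [wordVal, List.ofFn_succ]

theorem sum_mulMat_pow {ι : Type} [Fintype ι] (g : ι → H) (q : ℕ) :
    (∑ a : ι × Bool, mulMat (letter g a)) ^ q =
      ∑ w : Fin q → ι × Bool, mulMat (wordVal g w) := by
  induction q with
  | zero => simp [wordVal, mulMat_one]
  | succ q ih =>
    rw [pow_succ', ih, Finset.sum_mul_sum, ← Finset.sum_product', Finset.univ_product_univ,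
      ← Equiv.sum_comp (Fin.consEquiv fun _ : Fin (q + 1) => ι × Bool)
        (fun w => mulMat (wordVal g w))]
    refine Finset.sum_congr rfl fun z _ => ?_
    rw [mulMat_mul, ← wordVal_cons]
    rfl

/-- If the letter at the place `p` occurs nowhere else, then the generator there is determined by
the other generators and the value of the word. -/
theorem eq_of_wordVal_eq {ι : Type} {g g' : ι → H} {q : ℕ} {w : Fin q → ι × Bool} {p : Fin q}
    (hp : ∀ p' ≠ p, (w p').1 ≠ (w p).1) (hg : ∀ i ≠ (w p).1, g i = g' i)
    (hw : wordVal g w = wordVal g' w) : g (w p).1 = g' (w p).1 := by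
  induction q with
  | zero => exact p.elim0
  | succ q ih =>
    have hcons : w = Fin.cons (w 0) (Fin.tail w) := (Fin.cons_self_tail w).symm
    rw [hcons, wordVal_cons, wordVal_cons] at hw
    -- If the special letter comes first, the rest of the word has the same value on both sides and
    -- cancels. Otherwise the first letter is common to both sides and is cancelled, and the
    -- induction goes on with the tail.
    rcases Fin.eq_zero_or_eq_succ p with rfl | ⟨p, rfl⟩
    · have htail : wordVal g (Fin.tail w) = wordVal g' (Fin.tail w) := by
        unfold wordVal
        congr 1
        refine List.ofFn_inj.2 (funext fun p' => ?_)
        simp only [letter, Fin.tail]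
        rw [hg _ (hp p'.succ (Fin.succ_ne_zero _))]
      rw [htail, mul_left_inj] at hw
      unfold letter at hw
      split_ifs at hw
      · exact hw
      · exact inv_injective hw
    · have h0 : letter g (w 0) = letter g' (w 0) := by
        simp only [letter, hg _ (hp 0 (Fin.succ_ne_zero _).symm)]
      rw [h0, mul_right_inj] at hw
      exact ih (w := Fin.tail w) (p := p)
        (fun p' hne => hp p'.succ fun h => hne (Fin.succ_injective _ h)) hg hw

/-- At most one value of the generator at `p` is compatible with the others and the value 1. Hence
overwriting this generator by an arbitrary element of `H` is injective on pairs of a solution and an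
element, and the solutions have density at most 1/|H|. -/
theorem card_wordVal_eq_one_mul_le {ι : Type} [Fintype ι] [DecidableEq ι] {q : ℕ}
    {w : Fin q → ι × Bool} {p : Fin q} (hp : ∀ p' ≠ p, (w p').1 ≠ (w p).1) :
    (Finset.univ.filter fun g : ι → H => wordVal g w = 1).card * Fintype.card H ≤
      Fintype.card H ^ Fintype.card ι := by
  rw [← Finset.card_univ, ← Finset.card_product, Finset.card_univ, ← Fintype.card_fun,
    ← Finset.card_univ]
  refine Finset.card_le_card_of_injOn (fun z => Function.update z.1 (w p).1 z.2)
    (fun _ _ => Finset.mem_univ _) ?_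
  rintro ⟨g, x⟩ hg ⟨g', x'⟩ hg' h
  simp only [Finset.coe_product, Set.mem_prod, Finset.mem_coe, Finset.mem_filter,
    Finset.mem_univ, true_and, and_true] at hg hg'
  have hx : x = x' := by simpa using congrFun h (w p).1
  have hne : ∀ i ≠ (w p).1, g i = g' i := fun i hi => by simpa [hi] using congrFun h i
  have := eq_of_wordVal_eq hp hne (hg.trans hg'.symm)
  refine Prod.ext (funext fun i => ?_) hx
  by_cases hi : i = (w p).1
  · rw [hi]; exact this
  · exact hne i hi

/-! ### Counting the words in which no index occurs only once -/

/-- Every letter of the word occurs at least twice. -/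
def Repetitive {ι : Type} {q : ℕ} (w : Fin q → ι × Bool) : Prop :=
  ∀ p, ∃ p' ≠ p, (w p').1 = (w p).1

open Classical in
-- With every index repeated, 2m places carry at most m different indices. Enlarge their set to
-- exactly m elements, which needs `hm`, then choose an index from it and a sign at each place.
theorem card_repetitive_le {k m : ℕ} (hm : m ≤ k) :
    (Finset.univ.filter fun w : Fin (2 * m) → Fin k × Bool => Repetitive w).card ≤
      k.choose m * m ^ (2 * m) * 2 ^ (2 * m) := by
  have hsub : (Finset.univ.filter fun w : Fin (2 * m) → Fin k × Bool => Repetitive w) ⊆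
      (Finset.powersetCard m (Finset.univ : Finset (Fin k))).biUnion fun S =>
        Fintype.piFinset fun _ => S ×ˢ (Finset.univ : Finset Bool) := by
    intro w hw
    rw [Finset.mem_filter] at hw
    have hcard : 2 * (Finset.univ.image fun p => (w p).1).card ≤ 2 * m := by
      refine (Finset.mul_card_image_le_card _ _ ?_).trans_eq (by simp)
      intro b hb
      obtain ⟨p, -, rfl⟩ := Finset.mem_image.1 hb
      obtain ⟨p', hne, hp'⟩ := hw.2 p
      exact Finset.one_lt_card.2 ⟨p', by simp [hp'], p, by simp, hne⟩
    obtain ⟨S, hS, hSm⟩ := Finset.exists_superset_card_eq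
      (s := Finset.univ.image fun p => (w p).1) (n := m) (by omega) (by simpa using hm)
    rw [Finset.mem_biUnion]
    refine ⟨S, by simp [Finset.mem_powersetCard, hSm], ?_⟩
    rw [Fintype.mem_piFinset]
    exact fun p => by simpa using hS (Finset.mem_image_of_mem _ (Finset.mem_univ p))
  refine (Finset.card_le_card hsub).trans (Finset.card_biUnion_le.trans ?_)
  rw [Finset.sum_congr rfl (g := fun _ => m ^ (2 * m) * 2 ^ (2 * m))]
  · simp [mul_assoc]
  · intro S hS
    rw [Fintype.card_piFinset]
    simp [(Finset.mem_powersetCard.1 hS).2, mul_pow]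

/-- The term m^m/m! of the exponential series is at most e^m, and e < 3. -/
theorem pow_self_le_three_pow_mul_factorial (m : ℕ) :
    (m : ℝ) ^ m ≤ 3 ^ m * (m.factorial : ℝ) := by
  have h := Real.pow_div_factorial_le_exp (m : ℝ) (Nat.cast_nonneg m) m
  have hpos : (0 : ℝ) < (m.factorial : ℝ) := by exact_mod_cast m.factorial_pos
  rw [div_le_iff₀ hpos] at h
  refine h.trans (mul_le_mul_of_nonneg_right ?_ hpos.le)
  rw [show (m : ℝ) = m * 1 by ring, Real.exp_nat_mul]
  exact pow_le_pow_left₀ (Real.exp_pos 1).le Real.exp_one_lt_three.le m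

open Classical in
-- Dividing the count by (2k)^(2m) leaves at most (3m/k)^m, after the factorial in the binomial
-- coefficient is traded for 3^m/m^m. The factor 24 = 3·8 turns this into 8^(-m).
theorem repetitive_fraction_le {k m : ℕ} (hm : 0 < m) (hk : 24 * m ≤ k) :
    ((Finset.univ.filter fun w : Fin (2 * m) → Fin k × Bool => Repetitive w).card : ℝ) ≤
      (2 * k) ^ (2 * m) / 8 ^ m := by
  have h1 : ((Finset.univ.filter fun w : Fin (2 * m) → Fin k × Bool => Repetitive w).card : ℝ) ≤
      (k.choose m : ℝ) * m ^ (2 * m) * 2 ^ (2 * m) := by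
    exact_mod_cast card_repetitive_le (by omega)
  have h2 : (k.choose m : ℝ) ≤ (k : ℝ) ^ m / (m.factorial : ℝ) := Nat.choose_le_pow_div m k
  have hpos : (0 : ℝ) < (m.factorial : ℝ) := by exact_mod_cast m.factorial_pos
  have h3 := pow_self_le_three_pow_mul_factorial m
  have h4 : (k.choose m : ℝ) * m ^ m ≤ (k : ℝ) ^ m * 3 ^ m :=
    calc (k.choose m : ℝ) * m ^ m ≤ (k : ℝ) ^ m / (m.factorial : ℝ) * (3 ^ m * m.factorial) := by
          gcongr
      _ = (k : ℝ) ^ m * 3 ^ m := by field_simp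
  have h5 : (24 * (m : ℝ)) ^ m ≤ (k : ℝ) ^ m := by
    have : (24 * (m : ℝ)) ≤ k := by exact_mod_cast hk
    gcongr
  rw [le_div_iff₀ (by positivity)]
  refine (mul_le_mul_of_nonneg_right h1 (by positivity)).trans ?_
  calc (k.choose m : ℝ) * m ^ (2 * m) * 2 ^ (2 * m) * 8 ^ m
      = ((k.choose m : ℝ) * m ^ m) * (m ^ m * 8 ^ m) * 2 ^ (2 * m) := by
        rw [two_mul, pow_add (m : ℝ)]; ring
    _ ≤ ((k : ℝ) ^ m * 3 ^ m) * (m ^ m * 8 ^ m) * 2 ^ (2 * m) := by gcongr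
    _ = (k : ℝ) ^ m * (24 * (m : ℝ)) ^ m * 2 ^ (2 * m) := by
        rw [show (24 * (m : ℝ)) = 3 * (m * 8) by ring, mul_pow 3, mul_pow (m : ℝ) 8]; ring
    _ ≤ (k : ℝ) ^ m * (k : ℝ) ^ m * 2 ^ (2 * m) := by gcongr
    _ = (2 * k) ^ (2 * m) := by rw [mul_pow, two_mul m, pow_add (k : ℝ)]; ring

/-! ### The transition matrix and the moments of its trace -/

/-- The transition matrix of the random walk along the elements `g i` and their inverses. -/
noncomputable def walkMat {k : ℕ} (g : Fin k → H) : Matrix H H ℝ :=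
  (2 * k : ℝ)⁻¹ • ∑ a : Fin k × Bool, mulMat (letter g a)

/-- The matrix with constant entries and row sums `1`. -/
noncomputable def avgMat (H : Type) [Fintype H] : Matrix H H ℝ :=
  Matrix.of fun _ _ => (Fintype.card H : ℝ)⁻¹

theorem card_pos_real : (0 : ℝ) < Fintype.card H := by exact_mod_cast Fintype.card_pos

theorem mulMat_mul_avgMat (s : H) : mulMat s * avgMat H = avgMat H := by
  ext x y
  simp [mulMat, avgMat, Matrix.mul_apply]

theorem avgMat_mul_mulMat (s : H) : avgMat H * mulMat s = avgMat H := by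
  ext x y
  simp only [mulMat, avgMat, Matrix.mul_apply, Matrix.of_apply, ← eq_mul_inv_iff_mul_eq]
  simp

theorem avgMat_mul_avgMat : avgMat H * avgMat H = avgMat H := by
  have := (card_pos_real (H := H)).ne'
  ext x y
  simp [avgMat, Matrix.mul_apply, this]

theorem trace_avgMat : (avgMat H).trace = 1 := by
  have := (card_pos_real (H := H)).ne'
  simp [avgMat, Matrix.trace, this]

theorem walkMat_mul_avgMat {k : ℕ} (hk : 0 < k) (g : Fin k → H) :
    walkMat g * avgMat H = avgMat H := by
  have : (k : ℝ) ≠ 0 := by positivity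
  rw [walkMat, Matrix.smul_mul, Finset.sum_mul]
  simp only [mulMat_mul_avgMat, Finset.sum_const, ← Nat.cast_smul_eq_nsmul ℝ, smul_smul]
  rw [show (2 * (k : ℝ))⁻¹ * (Finset.univ : Finset (Fin k × Bool)).card = 1 by
    simp only [Finset.card_univ, Fintype.card_prod, Fintype.card_fin, Fintype.card_bool]
    push_cast
    field_simp, one_smul]

theorem avgMat_mul_walkMat {k : ℕ} (hk : 0 < k) (g : Fin k → H) :
    avgMat H * walkMat g = avgMat H := by
  have : (k : ℝ) ≠ 0 := by positivity
  rw [walkMat, Matrix.mul_smul, Finset.mul_sum]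
  simp only [avgMat_mul_mulMat, Finset.sum_const, ← Nat.cast_smul_eq_nsmul ℝ, smul_smul]
  rw [show (2 * (k : ℝ))⁻¹ * (Finset.univ : Finset (Fin k × Bool)).card = 1 by
    simp only [Finset.card_univ, Fintype.card_prod, Fintype.card_fin, Fintype.card_bool]
    push_cast
    field_simp, one_smul]

/-- The averaging matrix is idempotent and absorbs the walk from both sides, so all mixed terms
collapse. The exponent must be positive: the zeroth powers do not satisfy the identity. -/
theorem walkMat_sub_pow {k : ℕ} (hk : 0 < k) (g : Fin k → H) (q : ℕ) :
    (walkMat g - avgMat H) ^ (q + 1) = walkMat g ^ (q + 1) - avgMat H := by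
  have hpow : ∀ q, avgMat H * walkMat g ^ q = avgMat H := fun q => by
    induction q with
    | zero => simp
    | succ q ih => rw [pow_succ, ← mul_assoc, ih, avgMat_mul_walkMat hk]
  induction q with
  | zero => simp
  | succ q ih =>
    rw [pow_succ', ih, sub_mul, mul_sub, mul_sub, walkMat_mul_avgMat hk, avgMat_mul_avgMat, hpow,
      ← pow_succ']
    abel

theorem walkMat_isSymm {k : ℕ} (g : Fin k → H) : (walkMat g).transpose = walkMat g := by
  rw [walkMat, Matrix.transpose_smul, Matrix.transpose_sum]
  congr 1
  simp only [mulMat_transpose, Fintype.sum_prod_type]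
  refine Finset.sum_congr rfl fun i _ => ?_
  simp [letter, add_comm]

theorem walkMat_sub_isSymm {k : ℕ} (g : Fin k → H) :
    (walkMat g - avgMat H).transpose = walkMat g - avgMat H := by
  rw [Matrix.transpose_sub, walkMat_isSymm]
  rfl

/-- For symmetric A the squared Frobenius norm of A^m is tr A^(2m); subtracting the averaging matrix
removes exactly its trace 1. -/
theorem sum_sq_walkMat_sub_pow {k m : ℕ} (hk : 0 < k) (hm : 0 < m) (g : Fin k → H) :
    ∑ x, ∑ y, ((walkMat g - avgMat H) ^ m) x y ^ 2 = (walkMat g ^ (2 * m)).trace - 1 := by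
  have h1 : ((walkMat g - avgMat H) ^ m).transpose = (walkMat g - avgMat H) ^ m := by
    rw [Matrix.transpose_pow, walkMat_sub_isSymm]
  have h2 : ((walkMat g - avgMat H) ^ (2 * m)).trace = (walkMat g ^ (2 * m)).trace - 1 := by
    obtain ⟨q, hq⟩ : ∃ q, 2 * m = q + 1 := ⟨2 * m - 1, by omega⟩
    rw [hq, walkMat_sub_pow hk, Matrix.trace_sub, trace_avgMat]
  rw [← h2, two_mul, pow_add]
  generalize (walkMat g - avgMat H) ^ m = A at h1
  nth_rewrite 3 [← h1]
  simp [Matrix.trace, Matrix.mul_apply, sq]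

/-- The trace is |H| times the return probability of the walk, expanded over words. -/
theorem trace_walkMat_pow {k : ℕ} (g : Fin k → H) (q : ℕ) :
    (walkMat g ^ q).trace = (2 * k : ℝ)⁻¹ ^ q *
      ∑ w : Fin q → Fin k × Bool, if wordVal g w = 1 then (Fintype.card H : ℝ) else 0 := by
  rw [walkMat, smul_pow, sum_mulMat_pow, Matrix.trace_smul, Matrix.trace_sum]
  simp only [trace_mulMat, smul_eq_mul]

/-- The second moment of the Frobenius norm. -/
theorem sum_trace_walkMat_pow_le {k m : ℕ} (hm : 0 < m) (hk : 24 * m ≤ k) :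
    ∑ g : Fin k → H, ((walkMat g ^ (2 * m)).trace - 1) ≤
      (Fintype.card H : ℝ) ^ k * Fintype.card H / 8 ^ m := by
  classical
  have hN := card_pos_real (H := H)
  have hk0 : (0 : ℝ) < k := by exact_mod_cast (by omega : 0 < k)
  -- For a word with an unrepeated index, the density bound 1/|H| cancels the factor |H| from the
  -- trace; summed over all words the first term accounts for the -1 in the claim. For a repetitive
  -- word the trivial bound is used.
  have hword : ∀ w : Fin (2 * m) → Fin k × Bool,
      (∑ g : Fin k → H, if wordVal g w = 1 then (Fintype.card H : ℝ) else 0) ≤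
        (Fintype.card H : ℝ) ^ k +
          if Repetitive w then (Fintype.card H : ℝ) ^ k * Fintype.card H else 0 := by
    intro w
    rw [← Finset.sum_filter, Finset.sum_const, nsmul_eq_mul]
    by_cases hw : Repetitive w
    · rw [if_pos hw]
      have : ((Finset.univ.filter fun g : Fin k → H => wordVal g w = 1).card : ℝ) ≤
          (Fintype.card H : ℝ) ^ k := by
        have := Finset.card_le_univ (Finset.univ.filter fun g : Fin k → H => wordVal g w = 1)
        rw [Fintype.card_fun, Fintype.card_fin] at this
        exact_mod_cast this
      have := mul_le_mul_of_nonneg_right this hN.le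
      have : (0 : ℝ) ≤ (Fintype.card H : ℝ) ^ k := by positivity
      linarith
    · rw [if_neg hw, add_zero]
      unfold Repetitive at hw
      push Not at hw
      obtain ⟨p, hp⟩ := hw
      have := card_wordVal_eq_one_mul_le (H := H) hp
      rw [Fintype.card_fin] at this
      exact_mod_cast this
  have hrep := repetitive_fraction_le hm hk
  simp only [trace_walkMat_pow]
  rw [Finset.sum_sub_distrib, ← Finset.mul_sum, Finset.sum_comm]
  have hsum := Finset.sum_le_sum fun w (_ : w ∈ (Finset.univ : Finset (Fin (2 * m) → Fin k × Bool)))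
    => hword w
  rw [Finset.sum_add_distrib, ← Finset.sum_filter, Finset.sum_const, Finset.sum_const,
    nsmul_eq_mul, nsmul_eq_mul, Finset.card_univ, Fintype.card_fun] at hsum
  simp only [Fintype.card_prod, Fintype.card_fin, Fintype.card_bool, Finset.sum_const,
    Finset.card_univ, Fintype.card_fun, nsmul_eq_mul, mul_one] at hsum ⊢
  push_cast at hsum ⊢
  rw [inv_pow]
  have h2 : (2 * (k : ℝ)) ^ (2 * m) ≠ 0 := by positivity
  set Z : ℝ := (2 * (k : ℝ)) ^ (2 * m) with hZ
  have hZpos : 0 < Z := by positivity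
  rw [mul_comm (k : ℝ) 2, ← hZ] at hsum
  rw [← div_eq_inv_mul, sub_le_iff_le_add, div_le_iff₀ hZpos]
  refine hsum.trans ?_
  have hA : (0 : ℝ) ≤ (Fintype.card H : ℝ) ^ k * Fintype.card H := by positivity
  have := mul_le_mul_of_nonneg_right hrep hA
  calc _ ≤ Z * (Fintype.card H : ℝ) ^ k +
        Z / 8 ^ m * ((Fintype.card H : ℝ) ^ k * Fintype.card H) := by linarith
    _ = _ := by ring

/-- The operator norm is at most the Frobenius norm, by the Cauchy–Schwarz inequality in every row.
-/
theorem l2_opNorm_sq_le (A : Matrix H H ℝ) : ‖A‖ ^ 2 ≤ ∑ x, ∑ y, A x y ^ 2 := by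
  have hnn : 0 ≤ ∑ x, ∑ y, A x y ^ 2 :=
    Finset.sum_nonneg fun _ _ => Finset.sum_nonneg fun _ _ => sq_nonneg _
  refine (Real.le_sqrt (norm_nonneg _) hnn).1 ?_
  rw [Matrix.cstar_norm_def]
  refine ContinuousLinearMap.opNorm_le_bound _ (Real.sqrt_nonneg _) fun v => ?_
  refine (sq_le_sq₀ (norm_nonneg _) (by positivity)).1 ?_
  rw [mul_pow, Real.sq_sqrt hnn, EuclideanSpace.norm_sq_eq, EuclideanSpace.norm_sq_eq,
    Finset.sum_mul]
  refine Finset.sum_le_sum fun x _ => ?_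
  simp only [Real.norm_eq_abs, sq_abs]
  exact Finset.sum_mul_sq_le_sq_mul_sq _ _ _

/-- All but a small fraction of the `k`-tuples generate an expander. -/
theorem card_not_expander_le {k m e : ℕ} (hm : m = 2 ^ e) (hk : 24 * m ≤ k) :
    ((Finset.univ.filter fun g : Fin k → H => ¬ ‖walkMat g - avgMat H‖ ≤ 1 / 2).card : ℝ) ≤
      (Fintype.card H : ℝ) ^ k * Fintype.card H / 2 ^ m := by
  have hm0 : 0 < m := by rw [hm]; positivity
  have hk0 : 0 < k := by omega
  have hbad : ∀ g ∈ (Finset.univ.filter fun g : Fin k → H => ¬ ‖walkMat g - avgMat H‖ ≤ 1 / 2),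
      (1 / 4 : ℝ) ^ m ≤ (walkMat g ^ (2 * m)).trace - 1 := by
    intro g hg
    have hg : 1 / 2 < ‖walkMat g - avgMat H‖ := not_le.1 (Finset.mem_filter.1 hg).2
    have hsa : IsSelfAdjoint (walkMat g - avgMat H) := by
      rw [IsSelfAdjoint, Matrix.star_eq_conjTranspose, Matrix.conjTranspose_eq_transpose_of_trivial,
        walkMat_sub_isSymm]
    -- For a self-adjoint element the norm of a 2^e-th power is the power of the norm, by iterating
    -- ‖a²‖ = ‖a‖². This is why `m` is a power of two.
    have hpow : ‖(walkMat g - avgMat H) ^ m‖ = ‖walkMat g - avgMat H‖ ^ m := by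
      rw [hm]
      exact congrArg NNReal.toReal (hsa.nnnorm_pow_two_pow e)
    have := l2_opNorm_sq_le ((walkMat g - avgMat H) ^ m)
    rw [sum_sq_walkMat_sub_pow hk0 hm0, hpow] at this
    refine le_trans ?_ this
    rw [← pow_mul, mul_comm, pow_mul]
    refine pow_le_pow_left₀ (by norm_num) ?_ m
    nlinarith
  have hnn : ∀ g : Fin k → H, 0 ≤ (walkMat g ^ (2 * m)).trace - 1 := fun g => by
    rw [← sum_sq_walkMat_sub_pow hk0 hm0]
    exact Finset.sum_nonneg fun _ _ => Finset.sum_nonneg fun _ _ => sq_nonneg _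
  -- Markov's inequality: the threshold 4^(-m) against the mean |H|/8^m leaves |H|/2^m.
  have h1 := Finset.card_nsmul_le_sum _ _ _ hbad
  have h2 := (h1.trans (Finset.sum_le_sum_of_subset_of_nonneg (Finset.filter_subset _ _)
    fun g _ _ => hnn g)).trans (sum_trace_walkMat_pow_le hm0 hk)
  rw [nsmul_eq_mul, one_div_pow, one_div (4 ^ m), ← div_eq_mul_inv, div_le_iff₀ (by positivity)] at h2
  refine h2.trans_eq ?_
  rw [show (8 : ℝ) = 2 * 4 by norm_num, mul_pow]
  field_simp

/-- The walk on an expander mixes rapidly. -/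
theorem sum_abs_walkMat_pow_sub_le {k T : ℕ} (hk : 0 < k) (hT : 0 < T) {g : Fin k → H}
    (hg : ‖walkMat g - avgMat H‖ ≤ 1 / 2) :
    ∑ x, |(walkMat g ^ T) 1 x - (Fintype.card H : ℝ)⁻¹| ≤
      Real.sqrt (Fintype.card H) / 2 ^ T := by
  obtain ⟨q, rfl⟩ : ∃ q, T = q + 1 := ⟨T - 1, by omega⟩
  have hsymm : ((walkMat g - avgMat H) ^ (q + 1)).transpose =
      (walkMat g - avgMat H) ^ (q + 1) := by
    rw [Matrix.transpose_pow, walkMat_sub_isSymm]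
  have hentry : ∀ x, (walkMat g ^ (q + 1)) 1 x - (Fintype.card H : ℝ)⁻¹ =
      ((walkMat g - avgMat H) ^ (q + 1)) x 1 := fun x => by
    rw [← hsymm, Matrix.transpose_apply, walkMat_sub_pow hk]
    rfl
  have hnorm : ‖(walkMat g - avgMat H) ^ (q + 1)‖ ≤ (1 / 2) ^ (q + 1) :=
    (norm_pow_le' _ (Nat.succ_pos q)).trans (pow_le_pow_left₀ (norm_nonneg _) hg _)
  -- Applied to the basis vector at the identity, the matrix yields its column there, which by
  -- symmetry is the row describing the walk from the identity.
  have hvec := Matrix.l2_opNorm_mulVec ((walkMat g - avgMat H) ^ (q + 1))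
    (EuclideanSpace.single (1 : H) (1 : ℝ))
  rw [PiLp.norm_single, norm_one, mul_one] at hvec
  have hvec2 := pow_le_pow_left₀ (norm_nonneg _) (hvec.trans hnorm) 2
  rw [EuclideanSpace.norm_sq_eq] at hvec2
  have hcol : ∑ x, ((walkMat g - avgMat H) ^ (q + 1)) x 1 ^ 2 ≤ ((1 / 2 : ℝ) ^ (q + 1)) ^ 2 := by
    refine le_trans (le_of_eq ?_) hvec2
    refine Finset.sum_congr rfl fun x _ => ?_
    rw [Real.norm_eq_abs, sq_abs]
    congr 1
    simp
  simp only [hentry]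
  refine (sq_le_sq₀ (by positivity) (by positivity)).1 ?_
  rw [div_pow, Real.sq_sqrt (Nat.cast_nonneg _)]
  -- Passing from the Euclidean norm to the sum of absolute values costs the factor √|H|.
  refine sq_sum_le_card_mul_sum_sq.trans ?_
  simp only [sq_abs, Finset.card_univ]
  rw [div_eq_mul_inv]
  refine mul_le_mul_of_nonneg_left (hcol.trans_eq ?_) (Nat.cast_nonneg _)
  simp

end Expander

end InvGen

set_option linter.unusedSectionVars false

namespace InvGen

open Equiv
open scoped Matrix.Norms.L2Operator

/-! ### Probabilities -/

theorem toOuterMeasure_ne_top {α : Type} (μ : PMF α) (E : Set α) : μ.toOuterMeasure E ≠ ⊤ := by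
  refine ne_top_of_le_ne_top ENNReal.one_ne_top ?_
  rw [← (PMF.toOuterMeasure_apply_eq_one_iff μ (s := Set.univ)).2 (Set.subset_univ _)]
  exact μ.toOuterMeasure.mono (Set.subset_univ _)

theorem prob_map {α β : Type} (μ : PMF α) (f : α → β) (E : Set β) :
    prob (μ.map f) E = prob μ (f ⁻¹' E) := by
  rw [prob, PMF.toOuterMeasure_map_apply]
  rfl

theorem prob_mono_support {α : Type} {μ : PMF α} {E F : Set α}
    (h : ∀ a ∈ μ.support, a ∈ E → a ∈ F) : prob μ E ≤ prob μ F :=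
  ENNReal.toReal_mono (toOuterMeasure_ne_top μ F)
    (PMF.toOuterMeasure_mono μ fun a ha => h a ha.2 ha.1)

theorem prob_eq_sum {α : Type} [Fintype α] (μ : PMF α) (E : Set α) [DecidablePred (· ∈ E)] :
    prob μ E = ∑ a, if a ∈ E then (μ a).toReal else 0 := by
  rw [prob, PMF.toOuterMeasure_apply_fintype, ENNReal.toReal_sum]
  · refine Finset.sum_congr rfl fun a _ => ?_
    by_cases ha : a ∈ E <;> simp [ha]
  · intro a _
    by_cases ha : a ∈ E <;> simp [ha, PMF.apply_ne_top]

theorem sum_toReal_eq_one {α : Type} [Fintype α] (μ : PMF α) : ∑ a, (μ a).toReal = 1 := by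
  rw [← ENNReal.toReal_sum fun a _ => PMF.apply_ne_top μ a, ← tsum_fintype (L := .unconditional _),
    PMF.tsum_coe, ENNReal.toReal_one]

theorem prob_uniformOfFintype {α : Type} [Fintype α] [Nonempty α] (E : Set α)
    [DecidablePred (· ∈ E)] :
    prob (PMF.uniformOfFintype α) E =
      ((Finset.univ.filter fun a => a ∈ E).card : ℝ) / Fintype.card α := by
  rw [prob_eq_sum]
  simp [← Finset.sum_filter, div_eq_mul_inv]

theorem map_uniformOfFintype_equiv {α β : Type} [Fintype α] [Nonempty α] [Fintype β] [Nonempty β]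
    (e : α ≃ β) : (PMF.uniformOfFintype α).map e = PMF.uniformOfFintype β := by
  classical
  ext b
  simp only [PMF.map_apply, PMF.uniformOfFintype_apply, tsum_fintype, ← e.symm_apply_eq,
    Finset.sum_ite_eq, Finset.mem_univ, if_true, Fintype.card_congr e]

theorem uniformOfFintype_prod {α β : Type} [Fintype α] [Nonempty α] [Fintype β] [Nonempty β] :
    (PMF.uniformOfFintype α).bind (fun a => (PMF.uniformOfFintype β).map (Prod.mk a)) =
      PMF.uniformOfFintype (α × β) := by
  classical
  ext ⟨a, b⟩
  simp only [PMF.bind_apply, PMF.map_apply, PMF.uniformOfFintype_apply, tsum_fintype,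
    Prod.mk.injEq, Fintype.card_prod, Nat.cast_mul, ite_and]
  rw [Finset.sum_eq_single a (fun a' _ h => by simp [h.symm]) (by simp)]
  rw [ENNReal.mul_inv (by simp) (by simp)]
  simp

/-- The law of `k` independent samples. -/
noncomputable def iid {Ω : Type} (law : PMF Ω) : ℕ → PMF (List Ω)
  | 0 => PMF.pure []
  | k + 1 => law.bind fun ω => (iid law k).map (List.cons ω)

/-- This transfers counting statements about k-tuples of group elements to the law of k samples. -/
theorem iid_map_uniformOfFintype {α β : Type} [Fintype α] [Nonempty α] (f : α → β) (k : ℕ) :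
    iid ((PMF.uniformOfFintype α).map f) k =
      (PMF.uniformOfFintype (Fin k → α)).map fun g => List.ofFn fun i => f (g i) := by
  induction k with
  | zero =>
    simp only [iid, List.ofFn_zero]
    exact (PMF.map_const _ _).symm
  | succ k ih =>
    rw [iid, ih, ← map_uniformOfFintype_equiv (Fin.consEquiv fun _ : Fin (k + 1) => α),
      ← uniformOfFintype_prod, PMF.map_comp, PMF.map_bind, PMF.bind_map]
    refine congrArg _ (funext fun a => ?_)
    rw [Function.comp_apply, PMF.map_comp, PMF.map_comp]
    congr 1
    funext g
    simp [Fin.consEquiv, List.ofFn_succ]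

/-! ### Walks and their transition matrices -/

/-- The generators of a sampler: the samples and their inverses. -/
def withInverses {n : ℕ} (l : List (Perm (Fin n))) : List (Perm (Fin n)) :=
  l ++ l.map (fun g => g⁻¹)

section Walk

variable {n : ℕ} {H : Subgroup (Perm (Fin n))} [Fintype H]

open Classical in
-- The sampler multiplies on the right, as `mulMat` does, so a first step of the walk is a left
-- factor of the matrix power. The starting point and the clock are arbitrary for the sake of the
-- induction.
theorem walk_apply {k : ℕ} (hk : 0 < k) (g : Fin k → H) (T : ℕ) (y : H) (t : ℕ)
    (z : Perm (Fin n)) :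
    (((walk (withInverses (List.ofFn fun i => (g i : Perm (Fin n)))) T (↑y, t)).map
      Prod.fst) z).toReal = if h : z ∈ H then (walkMat g ^ T) y ⟨z, h⟩ else 0 := by
  set S := withInverses (List.ofFn fun i => (g i : Perm (Fin n))) with hS
  have hlen : S.length = 2 * k := by simp [hS, withInverses, two_mul]
  have hpos : 0 < S.length := by omega
  induction T generalizing y t with
  | zero =>
    rw [walk, PMF.pure_map, PMF.pure_apply, pow_zero]
    by_cases hz : z ∈ H
    · by_cases hy : y = ⟨z, hz⟩
      · rw [dif_pos hz, hy, Matrix.one_apply_eq]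
        simp
      · have : z ≠ y := fun h => hy (Subtype.ext h.symm)
        simp [hy, hz, this]
    · have : z ≠ y := fun h => hz (h ▸ y.2)
      simp [hz, this]
  | succ T ih =>
    have : Nonempty (Fin S.length) := ⟨⟨0, hpos⟩⟩
    rw [walk, dif_pos hpos, PMF.map_bind, PMF.bind_apply, tsum_fintype, ENNReal.toReal_sum
      (fun i _ => ENNReal.mul_ne_top (PMF.apply_ne_top _ _) (PMF.apply_ne_top _ _))]
    simp only [ENNReal.toReal_mul, PMF.uniformOfFintype_apply, ← Finset.mul_sum]
    -- Positions in the list correspond to letters: the first half to the samples, the second to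
    -- their inverses.
    have hsum : ∀ F : Perm (Fin n) → ℝ, ∑ i : Fin S.length, F (S.get i) =
        ∑ a : Fin k × Bool, F (letter g a : H) := fun F => by
      rw [show (fun i : Fin S.length => F (S.get i)) = fun i : Fin S.length => F S[i.1] from rfl,
        Fin.sum_univ_fun_getElem, hS, withInverses, List.map_append, List.sum_append]
      simp only [List.map_ofFn, List.sum_ofFn, Function.comp_apply,
        Fintype.sum_prod_type, Fintype.sum_bool, letter, if_true, Finset.sum_add_distrib]
      simp
    rw [hsum fun s => (((walk S T (↑y * s, t + 2)).map Prod.fst) z).toReal]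
    simp only [← Subgroup.coe_mul, ih]
    rw [Fintype.card_fin, hlen]
    by_cases hz : z ∈ H
    · simp only [hz, dif_pos]
      rw [pow_succ', Matrix.mul_apply, walkMat]
      simp only [Matrix.smul_apply, smul_eq_mul, Matrix.sum_apply, mulMat, Matrix.of_apply]
      simp only [mul_assoc, ← Finset.mul_sum, Finset.sum_mul, ite_mul, one_mul, zero_mul]
      rw [Finset.sum_comm]
      simp
    · simp [hz]

end Walk

/-! ### Walks generated by random automorphisms -/

section Aut

variable {n : ℕ} (G : SimpleGraph (Fin n))

open Classical in
theorem uniformAut_apply [Fintype (Aut G)] (z : Perm (Fin n)) :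
    (uniformAut G z).toReal = if z ∈ Aut G then (Fintype.card (Aut G) : ℝ)⁻¹ else 0 := by
  have huni : uniformAut G = (PMF.uniformOfFintype (Aut G)).map Subtype.val := by
    unfold uniformAut
    congr!
  rw [huni, PMF.map_apply, tsum_fintype]
  simp only [PMF.uniformOfFintype_apply]
  by_cases hz : z ∈ Aut G
  · rw [Finset.sum_eq_single ⟨z, hz⟩ (fun b _ hb => if_neg fun h => hb (Subtype.ext h.symm))
      (by simp)]
    simp [hz]
  · rw [Finset.sum_eq_zero fun (b : Aut G) _ => if_neg fun h : z = b => hz (h ▸ b.2)]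
    simp [hz]

open Classical in
-- Both laws vanish outside the automorphism group, so the sum over all permutations reduces to one
-- over the subgroup. The factor 1/2 of the distance is given away.
theorem tvDist_law_le [Fintype (Aut G)] {k T : ℕ} (hk : 0 < k) {g : Fin k → Aut G}
    {b : ℝ} (hg : ∑ x, |(walkMat g ^ T) 1 x - (Fintype.card (Aut G) : ℝ)⁻¹| ≤ b) :
    tvDist (CayleySampler.law
      ⟨withInverses (List.ofFn fun i => (g i : Perm (Fin n))), T⟩) (uniformAut G) ≤ b := by
  have hnn : 0 ≤ ∑ x, |(walkMat g ^ T) 1 x - (Fintype.card (Aut G) : ℝ)⁻¹| :=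
    Finset.sum_nonneg fun _ _ => abs_nonneg _
  have hsum : ∑ z, |(CayleySampler.law ⟨withInverses (List.ofFn fun i => (g i : Perm (Fin n))), T⟩
      z).toReal - (uniformAut G z).toReal| =
      ∑ x, |(walkMat g ^ T) 1 x - (Fintype.card (Aut G) : ℝ)⁻¹| := by
    rw [← Finset.sum_subset (Finset.subset_univ (Finset.univ.filter fun z => z ∈ Aut G)) ?_,
      ← Finset.sum_subtype_of_mem _ (p := fun z => z ∈ Aut G) (by simp)]
    · refine Finset.sum_congr (by ext; simp) fun x _ => ?_
      have := walk_apply hk g T 1 0 x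
      rw [Subgroup.coe_one] at this
      rw [CayleySampler.law, CayleySampler.exec, this, uniformAut_apply, dif_pos x.2, if_pos x.2]
    · intro z _ hz
      have hz : z ∉ Aut G := by simpa using hz
      have := walk_apply hk g T 1 0 z
      rw [Subgroup.coe_one] at this
      rw [CayleySampler.law, CayleySampler.exec, this, uniformAut_apply, dif_neg hz, if_neg hz]
      simp
  rw [tvDist, hsum]
  linarith

open Classical in
/-- With high probability the samples define a good sampler. -/
theorem prob_iid_good {k T e : ℕ} {ε δ : ℝ} (hk : 24 * 2 ^ e ≤ k) (hT : 0 < T)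
    (hδ : (n.factorial : ℝ) ≤ δ * 2 ^ (2 ^ e)) (hT' : (n.factorial : ℝ) ≤ ε * 2 ^ T) :
    1 - δ ≤ prob (iid (uniformAut G) k)
      {l | tvDist (CayleySampler.law ⟨withInverses l, T⟩) (uniformAut G) ≤ ε} := by
  have : Fintype (Aut G) := Fintype.ofFinite _
  have hk0 : 0 < k := lt_of_lt_of_le (by positivity) hk
  have huni : uniformAut G = (PMF.uniformOfFintype (Aut G)).map Subtype.val := by
    unfold uniformAut
    congr!
  have hcard : (Fintype.card (Aut G) : ℝ) ≤ n.factorial := by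
    have := Fintype.card_subtype_le (fun z : Perm (Fin n) => z ∈ Aut G)
    rw [Fintype.card_perm, Fintype.card_fin] at this
    exact_mod_cast (Fintype.card_congr (Equiv.refl _)).trans_le this
  have hN := card_pos_real (H := Aut G)
  have hN1 : (1 : ℝ) ≤ Fintype.card (Aut G) := by exact_mod_cast Fintype.card_pos
  have hgood : ∀ g : Fin k → Aut G, ‖walkMat g - avgMat (Aut G)‖ ≤ 1 / 2 →
      tvDist (CayleySampler.law ⟨withInverses (List.ofFn fun i => (g i : Perm (Fin n))), T⟩)
        (uniformAut G) ≤ ε := fun g hg => by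
    refine tvDist_law_le G hk0 ((sum_abs_walkMat_pow_sub_le hk0 hT hg).trans ?_)
    rw [div_le_iff₀ (by positivity)]
    -- The crude estimate √|Aut G| ≤ |Aut G| ≤ n! is enough here.
    refine le_trans ?_ (hcard.trans hT')
    rw [Real.sqrt_le_left hN.le]
    nlinarith
  have hbad := card_not_expander_le (H := Aut G) (k := k) rfl hk
  have hiid : iid (uniformAut G) k = (PMF.uniformOfFintype (Fin k → Aut G)).map
      fun g => List.ofFn fun i => (g i : Perm (Fin n)) := by
    rw [huni, iid_map_uniformOfFintype]
  rw [hiid, prob_map]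
  refine le_trans ?_ (prob_mono_support
    (E := {g : Fin k → Aut G | ‖walkMat g - avgMat (Aut G)‖ ≤ 1 / 2})
    (fun g _ hg => hgood g hg))
  rw [prob_uniformOfFintype, le_div_iff₀ (by positivity)]
  simp only [Set.mem_ofPred_eq]
  have hsplit := Finset.card_filter_add_card_filter_not (s := Finset.univ)
    (fun g : Fin k → Aut G => ‖walkMat g - avgMat (Aut G)‖ ≤ 1 / 2)
  have hsplit' : ((Finset.univ.filter fun g : Fin k → Aut G =>
      ‖walkMat g - avgMat (Aut G)‖ ≤ 1 / 2).card : ℝ) + ((Finset.univ.filter fun g : Fin k → Aut G =>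
      ¬ ‖walkMat g - avgMat (Aut G)‖ ≤ 1 / 2).card : ℝ) = Fintype.card (Fin k → Aut G) := by
    exact_mod_cast hsplit
  -- The exceptional tuples have density at most |Aut G|/2^m with m = 2^e, which `hδ` bounds by δ.
  have hfrac : (Fintype.card (Aut G) : ℝ) ^ k * Fintype.card (Aut G) / 2 ^ (2 ^ e) ≤
      δ * Fintype.card (Fin k → Aut G) := by
    rw [Fintype.card_fun, Fintype.card_fin, div_le_iff₀ (by positivity)]
    push_cast
    calc _ ≤ (Fintype.card (Aut G) : ℝ) ^ k * (δ * 2 ^ (2 ^ e)) := by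
          gcongr; exact hcard.trans hδ
      _ = _ := by ring
  linarith

end Aut

theorem walk_support_snd {n : ℕ} (S : List (Perm (Fin n))) (m : ℕ) (x : Perm (Fin n)) (t : ℕ) :
    ∀ z ∈ (walk S m (x, t)).support, z.2 = t + 2 * m := by
  induction m generalizing x t with
  | zero => simp [walk]
  | succ m ih =>
    intro z hz
    rw [walk] at hz
    split_ifs at hz with h
    · rw [PMF.mem_support_bind_iff] at hz
      obtain ⟨i, -, hz⟩ := hz
      rw [ih _ _ z hz]; ring
    · rw [ih _ _ z hz]; ring

end InvGen

namespace InvGen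

open Equiv

variable {Ω : Type} {src : Source Ω}

/-! ### The learning program -/

/-- The number of times `a` has to be doubled in order to reach `b`. -/
noncomputable def doublings (a b : ℕ) : ℕ := sInf {j | b ≤ 2 ^ j * a}

theorem le_doublings {a b : ℕ} (ha : 0 < a) : b ≤ 2 ^ doublings a b * a :=
  Nat.sInf_mem (s := {j | b ≤ 2 ^ j * a})
    ⟨b, b.lt_two_pow_self.le.trans (Nat.le_mul_of_pos_right _ ha)⟩

theorem lt_of_lt_doublings {a b j : ℕ} (h : j < doublings a b) : 2 ^ j * a < b :=
  not_le.1 (Nat.notMem_of_lt_sInf (s := {j | b ≤ 2 ^ j * a}) h)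

/-- The memories agree except at the variables in `X`. -/
def SameExcept (X : List ℕ) (s s' : State Ω) : Prop :=
  s'.arr = s.arr ∧ s'.samples = s.samples ∧ ∀ x, x ∉ X → s'.var x = s.var x

/-- Count in `var j` the doublings of `var a` needed to reach `var b`; `var 5` holds `1`. -/
def countDoublings (a b j d : ℕ) : Prog :=
  .seq (block [.const j 0, .sub d b a]) (.loop d (block [.add a a a, .add j j 5, .sub d b a]))

/-- After `i` rounds `var a` has been doubled `i` times, and the truncated difference in `var d`,
which controls the loop, vanishes as soon as `b` is reached. This computes a rounded logarithm using
additions and subtractions only. -/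
theorem reaches_countDoublings {a b j d : ℕ} {s : State Ω}
    (hnd : [a, b, j, d, 5].Nodup) (h1 : s.var 5 = 1) (ha : 0 < s.var a) :
    Reaches src s (countDoublings a b j d) (8 * doublings (s.var a) (s.var b) + 7)
      fun s' => s'.var j = doublings (s.var a) (s.var b) ∧ SameExcept [a, j, d] s s' := by
  simp only [List.nodup_cons, List.mem_cons, List.not_mem_nil, not_or, or_false, not_false_eq_true,
    List.nodup_nil, and_true] at hnd
  obtain ⟨⟨hab, haj, had, ha5⟩, ⟨hbj, hbd, hb5⟩, ⟨hjd, hj5⟩, hd5⟩ := hnd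
  set D := doublings (s.var a) (s.var b) with hD
  let I : ℕ → State Ω → Prop := fun m s' => ∃ i, i + m = D ∧ s'.var a = 2 ^ i * s.var a ∧
    s'.var j = i ∧ s'.var d = s.var b - 2 ^ i * s.var a ∧ SameExcept [a, j, d] s s'
  have hloop : ∀ s', I D s' → Reaches src s' (.loop d (block [.add a a a, .add j j 5, .sub d b a]))
      (D * (7 + 1) + 1) (I 0) := by
    refine Reaches.loop I ?_ ?_ D
    · rintro s' ⟨i, hi, -, -, hd, -⟩
      rw [hd, show i = D by omega]
      exact Nat.sub_eq_zero_of_le (le_doublings ha)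
    · rintro m s' ⟨i, hi, hsa, hsj, hsd, harr, hsam, hvar⟩
      have h5 : s'.var 5 = 1 := by
        rw [hvar 5 (by simp [Ne.symm ha5, Ne.symm hj5, Ne.symm hd5]), h1]
      have hb : s'.var b = s.var b := hvar b (by simp [Ne.symm hab, hbj, hbd])
      refine ⟨?_, reaches_block (by simp [Prog.IsBasic]) ?_⟩
      · have := lt_of_lt_doublings (a := s.var a) (b := s.var b) (j := i) (by omega)
        omega
      · refine ⟨i + 1, by omega, ?_, ?_, ?_, ?_, ?_, ?_⟩
        · simp [State.effect, haj, had, hsa, pow_succ]; ring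
        · simp [State.effect, hjd, hsj, h5, Ne.symm haj, Ne.symm ha5]
        · simp [State.effect, haj, hbj, Ne.symm hab, hsa, hb, pow_succ]; congr 1; ring
        · simp [State.effect, harr]
        · simp [State.effect, hsam]
        · intro x hx
          have := hvar x hx
          simp only [List.mem_cons, List.not_mem_nil, or_false, not_or] at hx
          simp [State.effect, hx, this]
  refine ((reaches_block (Q := I D) (by simp [Prog.IsBasic]) ?_).seq hloop).mono ?_ ?_
  · refine ⟨0, by omega, ?_, ?_, ?_, ?_, ?_, ?_⟩
    · simp [State.effect, haj, had]
    · simp [State.effect, hjd]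
    · simp [State.effect, haj, hbj]
    · simp [State.effect]
    · simp [State.effect]
    · intro x hx
      simp only [List.mem_cons, List.not_mem_nil, or_false, not_or] at hx
      simp [State.effect, hx]
  · simp only [List.length_cons, List.length_nil]; omega
  · rintro s' ⟨i, hi, -, hj, -, hf⟩
    exact ⟨by omega, hf⟩

/-- `var 12 := var 0 * var 8`; `var 5` holds `1`. -/
def mulLoop : Prog := .seq (.const 12 0) (.loop 8 (block [.sub 8 8 5, .add 12 12 0]))

theorem reaches_mulLoop {s : State Ω} (h1 : s.var 5 = 1) :
    Reaches src s mulLoop (6 * s.var 8 + 3)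
      fun s' => s'.var 12 = s.var 0 * s.var 8 ∧ SameExcept [8, 12] s s' := by
  let I : ℕ → State Ω → Prop := fun m s' => s'.var 8 = m ∧ m ≤ s.var 8 ∧
    s'.var 12 = s.var 0 * (s.var 8 - m) ∧ SameExcept [8, 12] s s'
  have hloop : ∀ s', I (s.var 8) s' → Reaches src s' (.loop 8 (block [.sub 8 8 5, .add 12 12 0]))
      (s.var 8 * (5 + 1) + 1) (I 0) := by
    refine Reaches.loop I (fun s' h => h.1) ?_ _
    rintro m s' ⟨h8, hm, h12, harr, hsam, hvar⟩
    refine ⟨by omega, reaches_block (by simp [Prog.IsBasic]) ⟨?_, by omega, ?_, ?_, ?_, ?_⟩⟩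
    · simp [State.effect, h8, hvar 5 (by simp), h1]
    · simp only [State.effect, List.foldl, State.setVar_var, h12, hvar 0 (by simp), if_true,
        if_false, Nat.reduceEqDiff, OfNat.zero_ne_ofNat]
      rw [show s.var 8 - m = s.var 8 - (m + 1) + 1 by omega, Nat.mul_succ]
    · simp [State.effect, harr]
    · simp [State.effect, hsam]
    · intro x hx
      have := hvar x hx
      simp only [List.mem_cons, List.not_mem_nil, or_false, not_or] at hx
      simp [State.effect, hx, this]
  have h0 : Reaches src s (.const 12 0) 1 (I (s.var 8)) := by
    refine ⟨_, exec_basic fun _ => rfl, by simp, le_rfl, by simp, by simp, by simp, ?_⟩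
    intro x hx
    simp only [List.mem_cons, List.not_mem_nil, or_false, not_or] at hx
    simp [hx]
  refine (h0.seq hloop).mono (by omega) ?_
  rintro s' ⟨-, -, h, hf⟩
  exact ⟨by simpa using h, hf⟩

/-- The numbers of generators and of steps. -/
noncomputable def numSamples (n : ℕ) (δ : ℚ) : ℕ :=
  -- A factor 24 comes from the expansion theorem, and rounding m up to a power of two may double
  -- it; 64 ≥ 48 is reached by six doublings.
  64 * (n * doublings 1 n + doublings δ.num.toNat δ.den + 1)

/-- The first summand bounds the binary logarithm of n!, the second that of 1/ε; the last keeps the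
number of steps positive. -/
noncomputable def numSteps (n : ℕ) (ε : ℚ) : ℕ :=
  n * doublings 1 n + doublings ε.num.toNat ε.den + 1

/-- Compute the number of steps in `var 1` and the number of samples in `var 13`. -/
def setup : Prog :=
  .seq (block [.const 5 1, .const 7 1])
    (.seq (countDoublings 7 0 8 9)
      (.seq (countDoublings 1 2 10 9)
        (.seq (countDoublings 3 4 11 9)
          (.seq mulLoop
            (block [.add 1 12 10, .add 1 1 5, .add 13 12 11, .add 13 13 5, .add 13 13 13,
              .add 13 13 13, .add 13 13 13, .add 13 13 13, .add 13 13 13, .add 13 13 13,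
              .add 14 13 6])))))

theorem reaches_setup {n : ℕ} {ε δ : ℚ} (hε : 0 < ε) (hδ : 0 < δ) :
    Reaches src (inverseInput n ε δ) setup (14 * doublings 1 n +
        8 * doublings ε.num.toNat ε.den + 8 * doublings δ.num.toNat δ.den + 57)
      fun s => s.var 0 = n ∧ s.var 1 = numSteps n ε ∧ s.var 5 = 1 ∧ s.var 6 = 0 ∧
        s.var 13 = numSamples n δ ∧ s.var 14 = numSamples n δ ∧ s.var 15 = 0 ∧
        s.samples = [] := by
  set Dn := doublings 1 n with hDn
  set Dε := doublings ε.num.toNat ε.den with hDε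
  set Dδ := doublings δ.num.toNat δ.den with hDδ
  have hεn : 0 < ε.num.toNat := by have := Rat.num_pos.2 hε; omega
  have hδn : 0 < δ.num.toNat := by have := Rat.num_pos.2 hδ; omega
  let P : State Ω → Prop := fun s => s.var 0 = n ∧ s.var 1 = ε.num.toNat ∧ s.var 2 = ε.den ∧
    s.var 3 = δ.num.toNat ∧ s.var 4 = δ.den ∧ s.var 5 = 1 ∧ s.var 6 = 0 ∧ s.var 15 = 0 ∧
    s.samples = []
  have hstart : Reaches src (inverseInput n ε δ) (block [.const 5 1, .const 7 1]) 5
      fun s => P s ∧ s.var 7 = 1 := by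
    refine reaches_block (by simp [Prog.IsBasic]) ?_
    simp [P, State.effect, inverseInput, State.init]
  refine (hstart.seq (t' := 14 * Dn + 8 * Dε + 8 * Dδ + 51)
    fun s ⟨⟨h0, h1, h2, h3, h4, h5, h6, h15, hs⟩, h7⟩ => ?_).mono (by omega) fun _ h => h
  refine ((reaches_countDoublings (by decide) h5 (by omega)).seq
    (t' := 6 * Dn + 8 * Dε + 8 * Dδ + 43) fun s₁ ⟨hj₁, _, hs₁, hv₁⟩ => ?_).mono
    (by rw [h7, h0]; omega) fun _ h => h
  rw [h7, h0, ← hDn] at hj₁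
  refine ((reaches_countDoublings (by decide) ((hv₁ 5 (by decide)).trans h5)
    (by rw [hv₁ 1 (by decide), h1]; exact hεn)).seq
    (t' := 6 * Dn + 8 * Dδ + 35) fun s₂ ⟨hj₂, _, hs₂, hv₂⟩ => ?_).mono
    (by rw [hv₁ 1 (by decide), hv₁ 2 (by decide), h1, h2]; omega) fun _ h => h
  rw [hv₁ 1 (by decide), hv₁ 2 (by decide), h1, h2, ← hDε] at hj₂
  have e3 : s₂.var 3 = δ.num.toNat := by rw [hv₂ 3 (by decide), hv₁ 3 (by decide), h3]
  have e4 : s₂.var 4 = δ.den := by rw [hv₂ 4 (by decide), hv₁ 4 (by decide), h4]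
  refine ((reaches_countDoublings (by decide)
    (by rw [hv₂ 5 (by decide), hv₁ 5 (by decide), h5]) (by rw [e3]; exact hδn)).seq
    (t' := 6 * Dn + 27) fun s₃ ⟨hj₃, _, hs₃, hv₃⟩ => ?_).mono
    (by rw [e3, e4]; omega) fun _ h => h
  rw [e3, e4, ← hDδ] at hj₃
  have e5 : s₃.var 5 = 1 := by
    rw [hv₃ 5 (by decide), hv₂ 5 (by decide), hv₁ 5 (by decide), h5]
  have e8 : s₃.var 8 = Dn := by rw [hv₃ 8 (by decide), hv₂ 8 (by decide), hj₁]
  have e0 : s₃.var 0 = n := by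
    rw [hv₃ 0 (by decide), hv₂ 0 (by decide), hv₁ 0 (by decide), h0]
  refine ((reaches_mulLoop e5).seq (t' := 23) fun s₄ ⟨hj₄, _, hs₄, hv₄⟩ => ?_).mono
    (by omega) fun _ h => h
  rw [e0, e8] at hj₄
  have f0 : s₄.var 0 = n := by rw [hv₄ 0 (by decide), e0]
  have f5 : s₄.var 5 = 1 := by rw [hv₄ 5 (by decide), e5]
  have f6 : s₄.var 6 = 0 := by
    rw [hv₄ 6 (by decide), hv₃ 6 (by decide), hv₂ 6 (by decide), hv₁ 6 (by decide), h6]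
  have f15 : s₄.var 15 = 0 := by
    rw [hv₄ 15 (by decide), hv₃ 15 (by decide), hv₂ 15 (by decide), hv₁ 15 (by decide), h15]
  have f10 : s₄.var 10 = Dε := by rw [hv₄ 10 (by decide), hv₃ 10 (by decide), hj₂]
  have f11 : s₄.var 11 = Dδ := by rw [hv₄ 11 (by decide), hj₃]
  have fs : s₄.samples = [] := by rw [hs₄, hs₃, hs₂, hs₁, hs]
  refine reaches_block (by simp [Prog.IsBasic]) ?_
  simp [State.effect, hj₄, f0, f5, f6, f15, f10, f11, fs, numSamples, numSteps, ← hDn, ← hDε, ← hDδ]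
  omega

/-! ### Collecting the samples and their inverses -/

/-- Write the inverse of row `var 15` into row `var 16`, of arrays of length `var 0`. -/
def invertRow : Prog :=
  .seq (block [.add 16 13 15, .add 17 0 6])
    (.seq (.loop 17 (block [.sub 17 17 5, .load 18 0 15 17, .store 0 16 18 17]))
      (block [.sub 14 14 5, .add 15 15 5]))

/-- Draw the samples and store their inverses. -/
def collect : Prog := .loop 14 (.seq (.draw 0 15) invertRow)

/-- The state of affairs after `i` samples. -/
structure Collected {n : ℕ} (k T i : ℕ) (s : State (Perm (Fin n))) : Prop where
  v0 : s.var 0 = n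
  v1 : s.var 1 = T
  v5 : s.var 5 = 1
  v6 : s.var 6 = 0
  v13 : s.var 13 = k
  v14 : s.var 14 = k - i
  v15 : s.var 15 = i
  len : s.samples.length = i
  le : i ≤ k
  rows : ∀ (p : ℕ) (hp : p < s.samples.length) (v : Fin n),
    s.arr 0 p v = (s.samples[p] v : ℕ) ∧ s.arr 0 (k + p) v = ((s.samples[p])⁻¹ v : Fin n)

theorem reaches_invertRow {n k T i : ℕ} {src : Source (Perm (Fin n))} (hrow : src.row = oneLine)
    {s : State (Perm (Fin n))} (hs : Collected k T i s) (hi : i < k) (ω : Perm (Fin n)) :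
    Reaches src (s.recv src 0 15 ω) invertRow (8 * n + 13) fun s' =>
      Collected k T (i + 1) s' ∧ s'.samples = s.samples ++ [ω] := by
  set s₀ := s.recv src 0 15 ω with hs₀
  -- Positions are treated from the top down. For each `v ≥ m` the number `v` already stands at
  -- place `ω v` of row `k + i`; this row differs from the row `i` being read because `i < k`.
  let I : ℕ → State (Perm (Fin n)) → Prop := fun m s' => s'.var 17 = m ∧ m ≤ n ∧
    s'.var 16 = k + i ∧ (∀ x, x < 16 → s'.var x = s.var x) ∧ s'.samples = s.samples ++ [ω] ∧
    (∀ p v, p ≠ k + i → s'.arr 0 p v = if p = i then oneLine ω v else s.arr 0 p v) ∧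
    ∀ v : Fin n, m ≤ v → s'.arr 0 (k + i) (ω v) = v
  have hloop : ∀ s', I n s' → Reaches src s' (.loop 17 (block [.sub 17 17 5, .load 18 0 15 17,
      .store 0 16 18 17])) (n * (7 + 1) + 1) (I 0) := by
    refine Reaches.loop I (fun s' h => h.1) ?_ _
    rintro m s' ⟨h17, hm, h16, hvar, hsam, hoth, hrw⟩
    have h5 : s'.var 5 = 1 := (hvar 5 (by norm_num)).trans hs.v5
    have h15 : s'.var 15 = i := (hvar 15 (by norm_num)).trans hs.v15
    have hload : s'.arr 0 i m = ω ⟨m, by omega⟩ := by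
      rw [hoth i m (by omega), if_pos rfl, oneLine, dif_pos (show m < n by omega)]
    refine ⟨by omega, reaches_block (by simp [Prog.IsBasic]) ⟨?_, by omega, ?_, ?_, ?_, ?_, ?_⟩⟩
    · simp [State.effect, h17, h5]
    · simp [State.effect, h16]
    · intro x hx
      simp [State.effect, hvar x hx, show x ≠ 17 by omega, show x ≠ 18 by omega]
    · simp [State.effect, hsam]
    · intro p v hp
      simp [State.effect, h17, h5, h15, h16, hload, hp, hoth p v hp]
    · intro v hv
      simp only [List.foldl, State.effect, State.setArr_arr, State.setVar_var, State.setVar_arr]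
      simp only [h17, h5, h15, h16, Nat.reduceEqDiff, if_true, if_false,
        true_and, Nat.add_sub_cancel, hload, Fin.val_inj, EmbeddingLike.apply_eq_iff_eq]
      by_cases hvm : v = ⟨m, by omega⟩
      · simp [hvm]
      · rw [if_neg hvm]
        refine hrw v ?_
        have : (v : ℕ) ≠ m := fun h => hvm (Fin.ext h)
        omega
  have hstart : Reaches src s₀ (block [.add 16 13 15, .add 17 0 6]) 5 (I n) := by
    refine reaches_block (by simp [Prog.IsBasic]) ⟨?_, le_rfl, ?_, ?_, ?_, ?_, ?_⟩
    · simp [State.effect, hs₀, hs.v0, hs.v6]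
    · simp [State.effect, hs₀, hs.v13, hs.v15]
    · intro x hx
      simp [State.effect, hs₀, show x ≠ 17 by omega, show x ≠ 16 by omega]
    · simp [State.effect, hs₀]
    · intro p v hp
      simp [State.effect, hs₀, hs.v15, hrow]
    · intro v hv
      omega
  refine (hstart.seq fun s₁ h₁ => (hloop s₁ h₁).seq (t' := 5) fun s₂ h₂ =>
    reaches_block (by simp [Prog.IsBasic]) ?_).mono (by omega) fun _ h => h
  obtain ⟨-, -, -, hvar, hsam, hoth, hrw⟩ := h₂
  have h5 : s₂.var 5 = 1 := (hvar 5 (by norm_num)).trans hs.v5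
  refine ⟨⟨?_, ?_, ?_, ?_, ?_, ?_, ?_, ?_, by omega, ?_⟩, ?_⟩
  · simp [State.effect, hvar, hs.v0]
  · simp [State.effect, hvar, hs.v1]
  · simp [State.effect, hvar, hs.v5]
  · simp [State.effect, hvar, hs.v6]
  · simp [State.effect, hvar, hs.v13]
  · simp [State.effect, h5, hvar 14 (by norm_num), hs.v14]; omega
  · simp [State.effect, h5, hvar 15 (by norm_num), hs.v15]
  · simp [State.effect, hsam, hs.len]
  · have harr : ([Prog.sub 14 14 5, Prog.add 15 15 5].foldl State.effect s₂).arr = s₂.arr := by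
      simp [State.effect]
    have hsam' : ([Prog.sub 14 14 5, Prog.add 15 15 5].foldl State.effect s₂).samples =
        s.samples ++ [ω] := by simp [State.effect, hsam]
    rw [harr]
    simp only [hsam']
    intro p hp v
    rw [List.length_append, List.length_singleton, hs.len] at hp
    rcases Nat.lt_succ_iff_lt_or_eq.1 hp with hlt | rfl
    · have hlt' : p < s.samples.length := by rw [hs.len]; exact hlt
      rw [List.getElem_append_left hlt', hoth p v (by omega), hoth (k + p) v (by omega),
        if_neg hlt.ne, if_neg (by omega)]
      exact hs.rows p hlt' v
    · have : (s.samples ++ [ω])[p]'(by simp [hs.len]) = ω := by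
        rw [List.getElem_append_right (by rw [hs.len])]
        simp
      rw [this, hoth p v (by omega), if_pos rfl]
      refine ⟨by simp [oneLine], ?_⟩
      have := hrw (ω⁻¹ v) (Nat.zero_le _)
      rwa [← Perm.mul_apply, mul_inv_cancel, Perm.one_apply] at this
  · simp [State.effect, hsam]

/-- Induction on the number `r` of samples still to be drawn. The first draw comes in front of the
remaining ones, which matches the recursion of `iid`. -/
theorem exec_collect {n k T : ℕ} {src : Source (Perm (Fin n))} (hrow : src.row = oneLine)
    (r i : ℕ) (hr : i + r = k) (s : State (Perm (Fin n))) (hs : Collected k T i s) :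
    ∃ μ, Exec src [collect] s (r * (8 * n + 16) + 1) μ ∧
      (∀ s' ∈ μ.support, Collected k T k s') ∧
      μ.map State.samples = (iid src.law r).map (s.samples ++ ·) := by
  induction r generalizing i s with
  | zero =>
    have hik : i = k := by omega
    subst hik
    refine ⟨PMF.pure s, (exec_loop_zero (by rw [hs.v14]; omega)).mono (by omega), ?_, ?_⟩
    · intro s' hs'
      rw [PMF.mem_support_pure_iff] at hs'
      exact hs' ▸ hs
    · simp [iid, PMF.pure_map]
  | succ r ih =>
    choose s₁ h₁ hc₁ hsam₁ using reaches_invertRow hrow hs (by omega)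
    choose μ₁ hμ₁ hsup₁ hmap₁ using fun ω => ih (i + 1) (by omega) (s₁ ω) (hc₁ ω)
    have hbody : Exec src [.seq (.draw 0 15) invertRow] s (8 * n + 15)
        (src.law.bind fun ω => PMF.pure (s₁ ω)) := exec_draw_seq h₁
    have hmem : ∀ s' ∈ (src.law.bind fun ω => PMF.pure (s₁ ω)).support, ∃ ω, s' = s₁ ω :=
      fun s' hs' => by
        rw [PMF.mem_support_bind_iff] at hs'
        obtain ⟨ω, -, h⟩ := hs'
        exact ⟨ω, (PMF.mem_support_pure_iff _ _).1 h⟩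
    classical
    -- The loop rule wants the law of the remaining rounds as a function of the memory. The newest
    -- sample is recorded in the memory, so it can be recovered from it.
    let κ : State (Perm (Fin n)) → PMF (State (Perm (Fin n))) := fun s' =>
      if h : ∃ ω, s' = s₁ ω then μ₁ h.choose else PMF.pure s'
    have hinj : Function.Injective s₁ := fun ω ω' h => by
      have := hsam₁ ω
      rw [h, hsam₁ ω'] at this
      simpa using this.symm
    have hκ : ∀ ω, κ (s₁ ω) = μ₁ ω := fun ω => by
      have h : ∃ ω', s₁ ω = s₁ ω' := ⟨ω, rfl⟩
      simp only [κ, dif_pos h]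
      rw [← hinj h.choose_spec]
    have hlaw : (src.law.bind fun ω => PMF.pure (s₁ ω)).bind κ = src.law.bind μ₁ := by
      rw [PMF.bind_bind]
      simp only [PMF.pure_bind, hκ]
    refine ⟨src.law.bind μ₁, ?_, ?_, ?_⟩
    · rw [← hlaw]
      refine (exec_loop_succ (t' := r * (8 * n + 16) + 1) (by rw [hs.v14]; omega) hbody
        fun s' hs' => ?_).mono (by ring_nf; omega)
      obtain ⟨ω, rfl⟩ := hmem s' hs'
      rw [hκ]
      exact hμ₁ ω
    · intro s' hs'
      rw [PMF.mem_support_bind_iff] at hs'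
      obtain ⟨ω, -, h⟩ := hs'
      exact hsup₁ ω s' h
    · rw [PMF.map_bind, iid, PMF.map_bind]
      refine congrArg _ (funext fun ω => ?_)
      rw [hmap₁, hsam₁, PMF.map_comp]
      congr 1
      funext l
      simp

/-- The learning program. -/
def learner : Prog := .seq setup (.seq collect (.add 0 13 13))

/-- The time that the learning program needs. -/
noncomputable def learnerTime (n : ℕ) (ε δ : ℚ) : ℕ :=
  14 * doublings 1 n + 8 * doublings ε.num.toNat ε.den + 8 * doublings δ.num.toNat δ.den +
    numSamples n δ * (8 * n + 16) + 61

theorem withInverses_rows {n : ℕ} {l : List (Perm (Fin n))} {r : ℕ → ℕ → ℕ}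
    (h : ∀ (p : ℕ) (hp : p < l.length) (v : Fin n),
      r p v = (l[p] v : ℕ) ∧ r (l.length + p) v = ((l[p])⁻¹ v : Fin n))
    (i : ℕ) (hi : i < (withInverses l).length) (v : Fin n) :
    r i v = ((withInverses l)[i] v : ℕ) := by
  have hlen : (withInverses l).length = l.length + l.length := by simp [withInverses]
  unfold withInverses at hi ⊢
  by_cases hil : i < l.length
  · rw [List.getElem_append_left hil]
    exact (h i hil v).1
  · rw [List.getElem_append_right (by omega), List.getElem_map]
    have := (h (i - l.length) (by unfold withInverses at hlen; omega) v).2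
    rwa [show l.length + (i - l.length) = i by omega] at this

theorem exec_learner {n : ℕ} {src : Source (Perm (Fin n))} (hrow : src.row = oneLine)
    {ε δ : ℚ} (hε : 0 < ε) (hδ : 0 < δ) :
    ∃ μ, Exec src [learner] (inverseInput n ε δ) (learnerTime n ε δ) μ ∧
      (∀ s ∈ μ.support, s.samples.length = numSamples n δ ∧
        Describes s (⟨withInverses s.samples, numSteps n ε⟩ : CayleySampler n)) ∧
      μ.map State.samples = iid src.law (numSamples n δ) := by
  obtain ⟨s₀, h₀, hv0, hv1, hv5, hv6, hv13, hv14, hv15, hs⟩ := reaches_setup (src := src)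
    (n := n) hε hδ
  have hrun := learnerTime.eq_1 n ε δ
  generalize hD : 14 * doublings 1 n + 8 * doublings ε.num.toNat ε.den +
    8 * doublings δ.num.toNat δ.den = D at h₀ hrun
  generalize numSamples n δ = k at *
  generalize numSteps n ε = T at *
  have hc : Collected k T 0 s₀ :=
    ⟨hv0, hv1, hv5, hv6, hv13, by simpa using hv14, hv15, by simp [hs], Nat.zero_le _,
      by simp [hs]⟩
  obtain ⟨μ, hμ, hsup, hmap⟩ := exec_collect hrow k 0 (by omega) s₀ hc
  -- `var 0` holds `n` while the rows are inverted and is overwritten by the number 2k of generators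
  -- only at the end.
  let fin : State (Perm (Fin n)) → State (Perm (Fin n)) := fun s =>
    s.setVar 0 (s.var 13 + s.var 13)
  have hfin : Exec src [.seq collect (.add 0 13 13)] s₀ (k * (8 * n + 16) + 1 + 1 + 1)
      (μ.bind fun s => PMF.pure (fin s)) :=
    exec_seq (t := k * (8 * n + 16) + 1) (t' := 1) hμ fun s _ => exec_basic fun _ => rfl
  have hall := exec_seq (κ := fun _ => μ.bind fun s => PMF.pure (fin s)) h₀ fun s hs => by
    rw [PMF.mem_support_pure_iff] at hs
    rw [hs]
    exact hfin
  rw [PMF.pure_bind] at hall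
  refine ⟨_, hall.mono (by omega), ?_, ?_⟩
  · intro s hsupp
    rw [PMF.mem_support_bind_iff] at hsupp
    obtain ⟨s', hs', h⟩ := hsupp
    rw [PMF.mem_support_pure_iff] at h
    subst h
    have hc := hsup s' hs'
    refine ⟨hc.len, ?_, ?_, ?_⟩
    · simp [fin, withInverses, hc.len, hc.v13]
    · simp [fin, hc.v1]
    · intro i v
      refine withInverses_rows (fun p hp v => ?_) i i.2 v
      rw [show (fin s').samples.length = k from hc.len]
      exact hc.rows p hp v
  · rw [PMF.map_bind]
    simp only [PMF.pure_map, fin, State.setVar_samples]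
    have : (μ.bind fun s => PMF.pure s.samples) = μ.map State.samples := by
      rw [← PMF.bind_pure_comp]; rfl
    rw [this, hmap, hs]
    simp only [List.nil_append]
    exact PMF.map_id _

end InvGen

namespace InvGen

open Equiv

/-! ### Inverse generation -/

/-- By minimality, one doubling fewer stays below `b`. -/
theorem doublings_le_log {a b : ℕ} (ha : 0 < a) (hab : a ≤ b) :
    (doublings a b : ℝ) ≤ Real.log (b / a) / Real.log 2 + 1 := by
  have hlog : 0 < Real.log 2 := Real.log_pos one_lt_two
  have ha' : (0 : ℝ) < a := by exact_mod_cast ha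
  have hb' : (0 : ℝ) < b := by exact_mod_cast ha.trans_le hab
  rcases Nat.eq_zero_or_pos (doublings a b) with h | h
  · rw [h]
    have : 0 ≤ Real.log (b / a) :=
      Real.log_nonneg ((one_le_div ha').2 (by exact_mod_cast hab))
    push_cast
    positivity
  · obtain ⟨j, hj⟩ : ∃ j, doublings a b = j + 1 := ⟨doublings a b - 1, by omega⟩
    have hlt : (2 : ℝ) ^ j * a < b := by
      exact_mod_cast lt_of_lt_doublings (a := a) (b := b) (j := j) (by omega)
    rw [hj]
    push_cast
    have : j * Real.log 2 ≤ Real.log (b / a) := by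
      rw [← Real.log_pow]
      refine Real.log_le_log (by positivity) ?_
      rw [le_div_iff₀ ha']
      exact hlt.le
    have := (le_div_iff₀ hlog).2 this
    linarith

/-- There is no additive constant, as a multiple of n would not fit into the error terms below. For
n < 2 nothing is doubled, and for n ≥ 2 both 1 and log n / log 2 are at most (3/2) log n. -/
theorem doublings_one_le (n : ℕ) : (doublings 1 n : ℝ) ≤ 3 * Real.log n := by
  have hl := Real.log_two_gt_d9
  rcases Nat.lt_or_ge n 2 with hn | hn
  · have : doublings 1 n = 0 := by
      by_contra h
      have := lt_of_lt_doublings (a := 1) (b := n) (j := 0) (by omega)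
      omega
    rw [this]
    interval_cases n <;> simp
  · have h := doublings_le_log one_pos (show 1 ≤ n by omega)
    have hn2 : Real.log 2 ≤ Real.log n := Real.log_le_log two_pos (by exact_mod_cast hn)
    rw [Nat.cast_one, div_one] at h
    have h1 : Real.log n / Real.log 2 ≤ 3 / 2 * Real.log n := by
      rw [div_le_iff₀ (by linarith)]
      nlinarith
    linarith

theorem doublings_rat_le {q : ℚ} (h0 : 0 < q) (h1 : q ≤ 1) :
    (doublings q.num.toNat q.den : ℝ) ≤ 2 * Real.log (1 / q) + 1 := by
  have hl := Real.log_two_gt_d9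
  have hn : 0 < q.num := Rat.num_pos.2 h0
  have hcast : ((q.num.toNat : ℕ) : ℤ) = q.num := Int.toNat_of_nonneg hn.le
  have hle : q.num.toNat ≤ q.den := by
    have := Rat.num_le_denom_iff.2 h1
    omega
  have h := doublings_le_log (show 0 < q.num.toNat by omega) hle
  have hq : (q.den : ℝ) / (q.num.toNat : ℕ) = 1 / q := by
    have : ((q.num.toNat : ℕ) : ℝ) = (q.num : ℝ) := by exact_mod_cast hcast
    rw [this, Rat.cast_def, one_div_div]
  rw [hq] at h
  have hq1 : (1 : ℝ) ≤ 1 / q := by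
    rw [one_le_div (by exact_mod_cast h0)]
    exact_mod_cast h1
  have hnn := Real.log_nonneg hq1
  have h1 : Real.log (1 / q) / Real.log 2 ≤ 2 * Real.log (1 / q) := by
    rw [div_le_iff₀ (by linarith)]
    nlinarith
  linarith

theorem one_le_mul_two_pow_doublings {q : ℚ} (h0 : 0 < q) :
    (1 : ℝ) ≤ q * 2 ^ doublings q.num.toNat q.den := by
  have hn : 0 < q.num := Rat.num_pos.2 h0
  have hcast : ((q.num.toNat : ℕ) : ℤ) = q.num := Int.toNat_of_nonneg hn.le
  have h := le_doublings (a := q.num.toNat) (b := q.den) (by omega)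
  have h' : (q.den : ℝ) ≤ 2 ^ doublings q.num.toNat q.den * (q.num.toNat : ℕ) := by
    exact_mod_cast h
  have hc : ((q.num.toNat : ℕ) : ℝ) = (q.num : ℝ) := by exact_mod_cast hcast
  have hd : (0 : ℝ) < q.den := by exact_mod_cast q.den_pos
  rw [hc] at h'
  rw [Rat.cast_def, div_mul_eq_mul_div, le_div_iff₀ hd]
  linarith

/-- Rounded logarithms suffice: n! ≤ n^n is at most 2 to the first summand, and 1 ≤ q·2^d for the
second summand d. -/
theorem factorial_le_mul_two_pow {n m : ℕ} {q : ℚ} (h0 : 0 < q)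
    (hm : n * doublings 1 n + doublings q.num.toNat q.den ≤ m) :
    (n.factorial : ℝ) ≤ q * 2 ^ m := by
  have h1 : n.factorial ≤ 2 ^ (n * doublings 1 n) := by
    refine n.factorial_le_pow.trans ?_
    rw [mul_comm, pow_mul]
    exact Nat.pow_le_pow_left (by simpa using le_doublings (a := 1) (b := n) one_pos) n
  have h1' : (n.factorial : ℝ) ≤ 2 ^ (n * doublings 1 n) := by exact_mod_cast h1
  have h2 := one_le_mul_two_pow_doublings h0
  have hq : (0 : ℝ) < q := by exact_mod_cast h0
  calc (n.factorial : ℝ) ≤ 2 ^ (n * doublings 1 n) * 1 := by rw [mul_one]; exact h1'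
    _ ≤ 2 ^ (n * doublings 1 n) * (q * 2 ^ doublings q.num.toNat q.den) := by gcongr
    _ = q * 2 ^ (n * doublings 1 n + doublings q.num.toNat q.den) := by rw [pow_add]; ring
    _ ≤ q * 2 ^ m := by gcongr; norm_num

theorem numSamples_le {n : ℕ} {δ : ℚ} (h0 : 0 < δ) (h1 : δ ≤ 1) :
    (numSamples n δ : ℝ) ≤ 192 * (n * Real.log n + Real.log (1 / δ) + 1) := by
  have hn := mul_le_mul_of_nonneg_left (doublings_one_le n) (Nat.cast_nonneg (α := ℝ) n)
  have hδ := doublings_rat_le h0 h1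
  have hnn : 0 ≤ Real.log (1 / δ) :=
    Real.log_nonneg (by rw [one_le_div (by exact_mod_cast h0)]; exact_mod_cast h1)
  rw [numSamples]
  push_cast
  nlinarith

theorem numSteps_le {n : ℕ} {ε : ℚ} (h0 : 0 < ε) (h1 : ε ≤ 1) :
    2 * (numSteps n ε : ℝ) ≤ 6 * (n * Real.log n + Real.log (1 / ε) + 1) := by
  have hn := mul_le_mul_of_nonneg_left (doublings_one_le n) (Nat.cast_nonneg (α := ℝ) n)
  have hε := doublings_rat_le h0 h1
  have hnn : 0 ≤ Real.log (1 / ε) :=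
    Real.log_nonneg (by rw [one_le_div (by exact_mod_cast h0)]; exact_mod_cast h1)
  rw [numSteps]
  push_cast
  nlinarith

/-- The dominant term is cubic: a quadratic number of samples, each inverted in linear time. -/
theorem learnerTime_le {n : ℕ} {ε δ : ℚ} (hε : 0 < ε) (hε1 : ε ≤ 1) (hδ : 0 < δ) (hδ1 : δ ≤ 1) :
    (learnerTime n ε δ : ℝ) ≤ 10000 * (n + Real.log (1 / ε) + Real.log (1 / δ) + 1) ^ 3 := by
  have h1 := doublings_one_le n
  have h2 := doublings_rat_le hε hε1
  have h3 := doublings_rat_le hδ hδ1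
  have hlε : 0 ≤ Real.log (1 / ε) :=
    Real.log_nonneg (by rw [one_le_div (by exact_mod_cast hε)]; exact_mod_cast hε1)
  have hlδ : 0 ≤ Real.log (1 / δ) :=
    Real.log_nonneg (by rw [one_le_div (by exact_mod_cast hδ)]; exact_mod_cast hδ1)
  have hn : (0 : ℝ) ≤ n := Nat.cast_nonneg n
  have hlog : Real.log n ≤ n := Real.log_le_self hn
  set X : ℝ := n + Real.log (1 / ε) + Real.log (1 / δ) + 1 with hX
  have hX1 : 1 ≤ X := by linarith
  have hnX : (n : ℝ) ≤ X := by linarith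
  have hD : (doublings 1 n : ℝ) ≤ 3 * X := by linarith
  have hDε : (doublings ε.num.toNat ε.den : ℝ) ≤ 2 * X := by linarith
  have hDδ : (doublings δ.num.toNat δ.den : ℝ) ≤ 2 * X := by linarith
  have hXX : X ≤ X ^ 2 := by nlinarith
  have hXXX : X ^ 2 ≤ X ^ 3 := pow_le_pow_right₀ hX1 (by norm_num)
  have hnD : (n : ℝ) * doublings 1 n ≤ 3 * X ^ 2 := by
    calc (n : ℝ) * doublings 1 n ≤ X * (3 * X) := by gcongr
      _ = 3 * X ^ 2 := by ring
  have hk : (numSamples n δ : ℝ) ≤ 384 * X ^ 2 := by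
    rw [numSamples]
    push_cast
    linarith
  have hprod : (numSamples n δ : ℝ) * (8 * n + 16) ≤ 9216 * X ^ 3 := by
    calc (numSamples n δ : ℝ) * (8 * n + 16) ≤ (384 * X ^ 2) * (24 * X) := by
          gcongr
          linarith
      _ = 9216 * X ^ 3 := by ring
  rw [learnerTime]
  push_cast
  linarith

theorem inverse_generation :
    ∃ (A : Prog) (C : ℕ) (k T : ℕ → ℚ → ℕ),
      ∀ (n : ℕ) (G : SimpleGraph (Fin n)) (ε δ : ℚ), 0 < ε → ε ≤ 1 → 0 < δ → δ ≤ 1 →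
        (k n δ : ℝ) ≤ C * (n * Real.log n + Real.log (1 / δ) + 1) ∧
        ∃ t : ℕ, (t : ℝ) ≤ C * (n + Real.log (1 / ε) + Real.log (1 / δ) + 1) ^ C ∧
          (∀ c ∈ (run (autSource G) A (inverseInput n ε δ) t).support,
            c.Halted ∧ c.state.samples.length = k n δ ∧
            ∃ W : CayleySampler n, Describes c.state W ∧
              W.gens = c.state.samples ++ c.state.samples.map (fun g => g⁻¹) ∧
              W.steps = T n ε ∧
              W.TimeAtMost (C * (n * Real.log n + Real.log (1 / ε) + 1))) ∧
          1 - (δ : ℝ) ≤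
            prob (run (autSource G) A (inverseInput n ε δ) t)
              {c | ∃ W : CayleySampler n, Describes c.state W ∧
                tvDist W.law (uniformAut G) ≤ ε} := by
  -- The constant is also an exponent, so it is kept opaque to avoid evaluating huge powers.
  obtain ⟨C, hC⟩ : ∃ C : ℕ, C = 10000 := ⟨_, rfl⟩
  have hC' : (C : ℝ) = 10000 := by rw [hC]; norm_num
  refine ⟨learner, C, numSamples, numSteps, fun n G ε δ hε hε1 hδ hδ1 => ?_⟩
  have hlε : 0 ≤ Real.log (1 / ε) :=
    Real.log_nonneg (by rw [one_le_div (by exact_mod_cast hε)]; exact_mod_cast hε1)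
  have hlδ : 0 ≤ Real.log (1 / δ) :=
    Real.log_nonneg (by rw [one_le_div (by exact_mod_cast hδ)]; exact_mod_cast hδ1)
  have hnl : 0 ≤ (n : ℝ) * Real.log n := mul_nonneg (Nat.cast_nonneg n) (Real.log_natCast_nonneg n)
  obtain ⟨μ, hμ, hsup, hmap⟩ := exec_learner (src := autSource G) rfl (n := n) hε hδ
  refine ⟨(numSamples_le hδ hδ1).trans ?_, learnerTime n ε δ,
    (learnerTime_le hε hε1 hδ hδ1).trans ?_, ?_, ?_⟩
  · rw [hC']
    exact mul_le_mul_of_nonneg_right (by norm_num) (by linarith)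
  · rw [hC']
    refine mul_le_mul_of_nonneg_left (pow_le_pow_right₀ ?_ (by omega)) (by norm_num)
    have : (0 : ℝ) ≤ n := Nat.cast_nonneg n
    linarith
  · rw [hμ.run_eq]
    intro c hc
    rw [PMF.support_map] at hc
    obtain ⟨s, hs, rfl⟩ := hc
    obtain ⟨hlen, hdes⟩ := hsup s hs
    refine ⟨rfl, hlen, ⟨withInverses s.samples, numSteps n ε⟩, hdes, rfl, rfl, fun z hz => ?_⟩
    rw [walk_support_snd _ _ _ _ z hz]
    push_cast
    rw [zero_add, hC']
    exact (numSteps_le hε hε1).trans (mul_le_mul_of_nonneg_right (by norm_num) (by linarith))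
  · rw [hμ.run_eq, prob_map]
    -- The expansion theorem needs a power of two: the least one that is at least `L` is at most `2
    -- * L`, and 24·2 ≤ 64.
    set L := n * doublings 1 n + doublings δ.num.toNat δ.den + 1 with hL
    have hLe : L ≤ 2 ^ Nat.clog 2 L := Nat.le_pow_clog one_lt_two L
    have hLlt : 2 ^ Nat.clog 2 L ≤ 2 * L := by
      rcases Nat.lt_or_ge 1 L with h | h
      · have h1 := Nat.pow_pred_clog_lt_self one_lt_two h
        have h2 := Nat.clog_pos one_lt_two h
        obtain ⟨e, he⟩ : ∃ e, Nat.clog 2 L = e + 1 := ⟨Nat.clog 2 L - 1, by omega⟩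
        rw [he] at h1 ⊢
        rw [Nat.pred_succ] at h1
        rw [pow_succ]
        omega
      · have : L = 1 := by omega
        rw [this]
        simp
    refine (prob_iid_good G (e := Nat.clog 2 L) (k := numSamples n δ) (T := numSteps n ε)
      (ε := ε) (δ := δ) ?_ (by simp [numSteps]) (factorial_le_mul_two_pow hδ (by omega))
      (factorial_le_mul_two_pow hε (by simp only [numSteps]; omega))).trans ?_
    · rw [numSamples, ← hL]
      omega
    · rw [show iid (uniformAut G) (numSamples n δ) = _ from hmap.symm, prob_map]
      refine prob_mono_support fun s hs hgood => ?_
      exact ⟨_, (hsup s hs).2, hgood⟩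

end InvGen

namespace InvGen

variable {Ω : Type} {src : Source Ω}

/-! ### Renaming the memory of a program -/

theorem Exec.eq_map_state {l : List Prog} {s : State Ω} {t : ℕ} {μ : PMF (State Ω)}
    (h : Exec src l s t μ) : μ = (runFrom src t ⟨l, s⟩).map Config.state := by
  rw [h.runFrom_eq, PMF.map_comp]
  exact (PMF.map_id μ).symm

/-- Outcomes `a` with the same memory `f a` have the same continuation law, because `Exec`
determines the law. So no injectivity of `f` is needed. -/
theorem exec_seq_map {α : Type} {p q : Prog} {s : State Ω} {t t' : ℕ} {μ : PMF α}
    {f : α → State Ω} {κ : α → PMF (State Ω)} (h : Exec src [p] s t (μ.map f))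
    (h' : ∀ a ∈ μ.support, Exec src [q] (f a) t' (κ a)) :
    Exec src [.seq p q] s (t + t' + 1) (μ.bind κ) := by
  have hκ : μ.bind κ =
      (μ.map f).bind fun s' => (runFrom src t' ⟨[q], s'⟩).map Config.state := by
    rw [PMF.bind_map]
    exact bind_congr_support fun a ha => (h' a ha).eq_map_state
  rw [hκ]
  refine exec_seq h fun s' hs' => ?_
  rw [PMF.support_map] at hs'
  obtain ⟨a, ha, rfl⟩ := hs'
  rw [← (h' a ha).eq_map_state]
  exact h' a ha

/-- The program with variables and arrays renamed by `f`. -/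
def Prog.rename (f : ℕ → ℕ) : Prog → Prog
  | .skip => .skip
  | .const x c => .const (f x) c
  | .add x y z => .add (f x) (f y) (f z)
  | .sub x y z => .sub (f x) (f y) (f z)
  | .load x a i j => .load (f x) (f a) (f i) (f j)
  | .store a i j x => .store (f a) (f i) (f j) (f x)
  | .flip x => .flip (f x)
  | .draw a i => .draw (f a) (f i)
  | .seq p q => .seq (p.rename f) (q.rename f)
  | .ite x p q => .ite (f x) (p.rename f) (q.rename f)
  | .loop x p => .loop (f x) (p.rename f)

theorem Prog.DrawFree.rename {f : ℕ → ℕ} {p : Prog} (h : p.DrawFree) :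
    (p.rename f).DrawFree := by
  induction p with
  | draw => exact h
  | seq p q ihp ihq => exact ⟨ihp h.1, ihq h.2⟩
  | ite x p q ihp ihq => exact ⟨ihp h.1, ihq h.2⟩
  | loop x p ih => exact ih h
  | _ => trivial

/-- The memory `s₀`, with the memory `s` written to the places `f x`. -/
noncomputable def State.embed (f : ℕ → ℕ) (s₀ s : State Ω) : State Ω :=
  ⟨Function.extend f s.var s₀.var, Function.extend f s.arr s₀.arr, s.samples⟩

theorem extend_update {β : Type} {f : ℕ → ℕ} (hf : f.Injective) (v e : ℕ → β) (x : ℕ) (c : β) :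
    Function.extend f (Function.update v x c) e =
      Function.update (Function.extend f v e) (f x) c := by
  funext y
  by_cases hy : ∃ a, f a = y
  · obtain ⟨a, rfl⟩ := hy
    simp [hf.extend_apply, Function.update_apply, hf.eq_iff]
  · have hne : y ≠ f x := fun h => hy ⟨x, h.symm⟩
    rw [Function.update_of_ne hne, Function.extend_apply' _ _ _ hy,
      Function.extend_apply' _ _ _ hy]

theorem State.embed_var {f : ℕ → ℕ} (hf : f.Injective) (s₀ s : State Ω)
    (x : ℕ) : (State.embed f s₀ s).var (f x) = s.var x :=
  hf.extend_apply _ _ _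

theorem State.embed_arr {f : ℕ → ℕ} (hf : f.Injective) (s₀ s : State Ω)
    (a : ℕ) : (State.embed f s₀ s).arr (f a) = s.arr a :=
  hf.extend_apply _ _ _

theorem State.embed_setVar {f : ℕ → ℕ} (hf : f.Injective) (s₀ s : State Ω) (x v : ℕ) :
    State.embed f s₀ (s.setVar x v) = (State.embed f s₀ s).setVar (f x) v := by
  simp only [State.embed, State.setVar, extend_update hf]

theorem State.embed_setRow {f : ℕ → ℕ} (hf : f.Injective) (s₀ s : State Ω) (a i : ℕ) (r : ℕ → ℕ) :
    State.embed f s₀ (s.setRow a i r) = (State.embed f s₀ s).setRow (f a) i r := by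
  have := State.embed_arr hf s₀ s a
  simp only [State.embed] at this
  simp only [State.embed, State.setRow, extend_update hf, this]

theorem State.embed_setArr {f : ℕ → ℕ} (hf : f.Injective) (s₀ s : State Ω) (a i j v : ℕ) :
    State.embed f s₀ (s.setArr a i j v) = (State.embed f s₀ s).setArr (f a) i j v := by
  rw [State.setArr, State.setArr, State.embed_setRow hf, State.embed_arr hf]

/-- Renaming simulates the machine step by step; injectivity keeps different places from being
identified. -/
theorem step_rename {f : ℕ → ℕ} (hf : f.Injective) (s₀ s : State Ω) (l : List Prog) :
    step src ⟨l.map (Prog.rename f), State.embed f s₀ s⟩ =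
      (step src ⟨l, s⟩).map fun c =>
        ⟨c.todo.map (Prog.rename f), State.embed f s₀ c.state⟩ := by
  cases l with
  | nil => simp [step, PMF.pure_map]
  | cons p l =>
    cases p
    case draw a i =>
      simp only [List.map_cons, Prog.rename, step, PMF.map_comp, Function.comp_def,
        State.embed_var hf]
      congr 1
      funext ω
      rw [← State.embed_setRow hf]
      rfl
    case ite x p q =>
      simp only [List.map_cons, Prog.rename, step, PMF.pure_map, State.embed_var hf]
      split_ifs <;> rfl
    case loop x p =>
      simp only [List.map_cons, Prog.rename, step, PMF.pure_map, State.embed_var hf]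
      split_ifs <;> rfl
    all_goals simp [Prog.rename, step, PMF.pure_map, PMF.map_comp, Function.comp_def,
      State.embed_var hf, State.embed_arr hf, State.embed_setVar hf, State.embed_setArr hf]

theorem runFrom_rename {f : ℕ → ℕ} (hf : f.Injective) (s₀ s : State Ω) (t : ℕ) (l : List Prog) :
    runFrom src t ⟨l.map (Prog.rename f), State.embed f s₀ s⟩ =
      (runFrom src t ⟨l, s⟩).map fun c =>
        ⟨c.todo.map (Prog.rename f), State.embed f s₀ c.state⟩ := by
  induction t generalizing l s with
  | zero => simp [runFrom, PMF.pure_map]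
  | succ t ih =>
    rw [runFrom, runFrom, step_rename hf, PMF.bind_map, PMF.map_bind]
    exact congrArg _ (funext fun c => ih c.state c.todo)

/-- A renamed program works on its part of the memory as the original one does. -/
theorem exec_rename {f : ℕ → ℕ} (hf : f.Injective) (s₀ s : State Ω)
    {p : Prog} {t : ℕ} (h : ∀ c ∈ (run src p s t).support, c.Halted) :
    Exec src [p.rename f] (State.embed f s₀ s) t
      ((run src p s t).map fun c => State.embed f s₀ c.state) := by
  have hrun := runFrom_rename (src := src) hf s₀ s t [p]
  obtain ⟨μ, hμ⟩ := exec_of_halts (src := src) t [p.rename f] (State.embed f s₀ s) (by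
    intro c hc
    rw [show [p.rename f] = [p].map (Prog.rename f) from rfl, hrun, PMF.support_map] at hc
    obtain ⟨c', hc', rfl⟩ := hc
    have := h c' hc'
    simp only [Config.Halted] at this ⊢
    simp [this])
  have heq := hμ.eq_map_state
  rw [show [p.rename f] = [p].map (Prog.rename f) from rfl, hrun, PMF.map_comp] at heq
  rw [heq] at hμ
  exact hμ

/-! ### Writing a permutation takes time -/

/-- Only a `store` can create a nonzero array entry, and just one at a time: the trivial source
delivers rows of zeros. -/
theorem step_noSource_nonzero (c c' : Config Unit) (h : c' ∈ (step noSource c).support) :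
    ∃ j, ∀ v, v ≠ j → c'.state.arr 1 0 v ≠ 0 → c.state.arr 1 0 v ≠ 0 := by
  obtain ⟨l, s⟩ := c
  cases l with
  | nil =>
    rw [step, PMF.mem_support_pure_iff] at h
    exact ⟨0, fun v _ hv => h ▸ hv⟩
  | cons p l =>
    cases p
    case store a i j x =>
      rw [step, PMF.mem_support_pure_iff] at h
      subst h
      refine ⟨s.var j, fun v hv => ?_⟩
      simp [hv]
    case flip x =>
      rw [step, PMF.support_map] at h
      obtain ⟨b, -, rfl⟩ := h
      exact ⟨0, fun v _ hv => hv⟩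
    case draw a i =>
      rw [step, PMF.support_map] at h
      obtain ⟨ω, -, rfl⟩ := h
      refine ⟨0, fun v _ hv => ?_⟩
      have := State.recv_arr (src := noSource) s a i ω 1 0 v
      simp only [State.recv] at this
      rw [this] at hv
      split_ifs at hv
      · exact absurd rfl hv
      · exact hv
    all_goals
      rw [step, PMF.mem_support_pure_iff] at h
      subst h
      exact ⟨0, fun v _ hv => hv⟩

theorem exists_nonzero_finset (t : ℕ) (c c' : Config Unit)
    (h : c' ∈ (runFrom noSource t c).support) :
    ∃ J : Finset ℕ, J.card ≤ t ∧
      ∀ v, v ∉ J → c'.state.arr 1 0 v ≠ 0 → c.state.arr 1 0 v ≠ 0 := by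
  induction t generalizing c with
  | zero =>
    rw [runFrom, PMF.mem_support_pure_iff] at h
    exact ⟨∅, by simp, fun v _ hv => h ▸ hv⟩
  | succ t ih =>
    rw [runFrom, PMF.mem_support_bind_iff] at h
    obtain ⟨c₁, h₁, h₂⟩ := h
    obtain ⟨j, hj⟩ := step_noSource_nonzero c c₁ h₁
    obtain ⟨J, hJ, hJ'⟩ := ih c₁ h₂
    refine ⟨insert j J, (Finset.card_insert_le j J).trans (by omega), fun v hv h0 => ?_⟩
    rw [Finset.mem_insert, not_or] at hv
    exact hj v hv.1 (hJ' v hv.2 h0)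

theorem readPerm_eq_some {n : ℕ} {r : ℕ → ℕ} {σ : Equiv.Perm (Fin n)}
    (h : readPerm n r = some σ) (v : Fin n) : r v = σ v := by
  unfold readPerm at h
  split_ifs at h with hex
  rw [Option.some.injEq] at h
  rw [← h]
  exact hex.choose_spec v

end InvGen

namespace InvGen

open Equiv

/-! ### A graph whose automorphisms reveal isomorphisms -/

section Gadget

variable {n N : ℕ}

/-- The graph with an additional vertex `none`, adjacent to all others. -/
def cone (G : SimpleGraph (Fin n)) : SimpleGraph (Option (Fin n)) :=
  -- With `none` on one side the condition is vacuous, which makes the apex adjacent to everything;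
  -- `fromRel` removes its loop.
  SimpleGraph.fromRel fun a b => ∀ u v, a = some u → b = some v → G.Adj u v

@[simp] theorem cone_adj_some (G : SimpleGraph (Fin n)) (u v : Fin n) :
    (cone G).Adj (some u) (some v) ↔ G.Adj u v := by
  simp only [cone, SimpleGraph.fromRel_adj, ne_eq, Option.some.injEq]
  constructor
  · rintro ⟨-, h | h⟩
    · exact h u v rfl rfl
    · exact (h v u rfl rfl).symm
  · exact fun h => ⟨h.ne, Or.inl fun _ _ hu hv => hu ▸ hv ▸ h⟩

@[simp] theorem cone_adj_none_some (G : SimpleGraph (Fin n)) (u : Fin n) :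
    (cone G).Adj none (some u) := by
  simp [cone, SimpleGraph.fromRel_adj]

@[simp] theorem cone_adj_some_none (G : SimpleGraph (Fin n)) (u : Fin n) :
    (cone G).Adj (some u) none := (cone_adj_none_some G u).symm

theorem cone_adj_none {G : SimpleGraph (Fin n)} {o : Option (Fin n)} (h : o ≠ none) :
    (cone G).Adj none o := by
  obtain ⟨u, rfl⟩ := Option.ne_none_iff_exists'.1 h
  exact cone_adj_none_some G u

/-- Isomorphic cones have isomorphic bases. -/
theorem nonempty_iso_of_cone {G₁ G₂ : SimpleGraph (Fin n)} (e : Option (Fin n) ≃ Option (Fin n))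
    (he : ∀ a b, (cone G₁).Adj a b ↔ (cone G₂).Adj (e a) (e b)) : Nonempty (G₁ ≃g G₂) := by
  have hsome : ∀ u, e (some u) ≠ none → some (e.removeNone u) = e (some u) := fun u h =>
    Equiv.removeNone_some e (Option.ne_none_iff_exists'.1 h)
  have hnone : ∀ u, e (some u) = none → some (e.removeNone u) = e none := fun u h =>
    Equiv.removeNone_none e h
  refine ⟨⟨e.removeNone, fun {u v} => ?_⟩⟩
  rw [← cone_adj_some G₂, ← cone_adj_some G₁]
  by_cases huv : u = v
  · subst huv; simp
  -- `removeNone` sends a vertex that `e` maps to the apex to the image of the apex instead. Both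
  -- the old and the new image are adjacent to all other vertices of the image of `e`, so this
  -- rerouting does not change adjacency.
  by_cases hu : e (some u) = none
  · have hv : e (some v) ≠ none := fun hv => huv (by
      have := e.injective (hu.trans hv.symm)
      simpa using this)
    rw [hnone u hu, hsome v hv, ← he, he (some u), hu]
    exact iff_of_true (cone_adj_none_some _ _) (cone_adj_none hv)
  by_cases hv : e (some v) = none
  · rw [hnone v hv, hsome u hu, ← he, he (some u) (some v), hv]
    exact iff_of_true (cone_adj_some_none _ _) (cone_adj_none hu).symm
  · rw [hsome u hu, hsome v hv, ← he]

/-- The position of a vertex of the cone. -/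
def optCode (o : Option (Fin n)) : ℕ := o.elim n Fin.val

theorem optCode_lt (o : Option (Fin n)) : optCode o < n + 1 := by
  cases o with
  | none => exact Nat.lt_succ_self n
  | some u => exact u.2.trans (Nat.lt_succ_self n)

theorem optCode_injective : Function.Injective (optCode (n := n)) := by
  intro a b h
  cases a with
  | none =>
    cases b with
    | none => rfl
    | some v => exact absurd h.symm v.2.ne
  | some u =>
    cases b with
    | none => exact absurd h u.2.ne
    | some v => exact congrArg some (Fin.ext h)

theorem exists_optCode {u : ℕ} (hu : u < n + 1) : ∃ o : Option (Fin n), optCode o = u := by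
  rcases Nat.lt_succ_iff_lt_or_eq.1 hu with h | rfl
  · exact ⟨some ⟨u, h⟩, rfl⟩
  · exact ⟨none, rfl⟩

theorem mul_add_inj {S i j u v : ℕ} (hu : u < S) (hv : v < S) (h : i * S + u = j * S + v) :
    i = j ∧ u = v := by
  have hS : 0 < S := by omega
  have h1 : (i * S + u) / S = i := by
    rw [Nat.add_comm, Nat.add_mul_div_right _ _ hS, Nat.div_eq_of_lt hu, zero_add]
  have h2 : (j * S + v) / S = j := by
    rw [Nat.add_comm, Nat.add_mul_div_right _ _ hS, Nat.div_eq_of_lt hv, zero_add]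
  have hij : i = j := by rw [← h1, h, h2]
  subst hij
  exact ⟨rfl, by omega⟩

/-- The vertices of thirteen disjoint cones as numbers. -/
def place (hN : 13 * (n + 1) ≤ N) : Fin 13 × Option (Fin n) ↪ Fin N where
  toFun z := ⟨z.1 * (n + 1) + optCode z.2, by
    have h1 := optCode_lt z.2
    have h2 : (z.1 + 1 : ℕ) * (n + 1) ≤ 13 * (n + 1) := Nat.mul_le_mul_right _ z.1.2
    rw [Nat.succ_mul] at h2
    omega⟩
  inj' := by
    rintro ⟨i, a⟩ ⟨j, b⟩ h
    obtain ⟨hij, hab⟩ := mul_add_inj (optCode_lt a) (optCode_lt b) (Fin.mk.inj h)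
    exact Prod.ext (Fin.ext hij) (optCode_injective hab)

theorem place_val (hN : 13 * (n + 1) ≤ N) (j : Fin 13) (o : Option (Fin n)) :
    (place hN (j, o) : ℕ) = j * (n + 1) + optCode o := rfl

/-- The disjoint union of the cones over thirteen graphs. -/
def coneSum (F : Fin 13 → SimpleGraph (Fin n)) : SimpleGraph (Fin 13 × Option (Fin n)) where
  Adj x y := x.1 = y.1 ∧ (cone (F x.1)).Adj x.2 y.2
  symm := ⟨fun _ _ h => ⟨h.1.symm, h.1 ▸ h.2.symm⟩⟩
  loopless := ⟨fun _ h => h.2.ne rfl⟩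

/-- The disjoint union of the cones, and isolated vertices. -/
def gadget (hN : 13 * (n + 1) ≤ N) (F : Fin 13 → SimpleGraph (Fin n)) : SimpleGraph (Fin N) :=
  (coneSum F).map (place hN)

/-- The graph `G₁` once and the graph `G₂` twelve times. -/
def pairFamily (G₁ G₂ : SimpleGraph (Fin n)) (j : Fin 13) : SimpleGraph (Fin n) :=
  if j = 0 then G₁ else G₂

theorem adjArray_eq_one_iff {m : ℕ} {G : SimpleGraph (Fin m)} {u v : ℕ} :
    adjArray G u v = 1 ↔ ∃ (hu : u < m) (hv : v < m), G.Adj ⟨u, hu⟩ ⟨v, hv⟩ := by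
  unfold adjArray
  split_ifs with h
  · exact iff_of_true rfl h
  · exact iff_of_false (by simp) h

theorem adjArray_eq_zero_or_one {m : ℕ} (G : SimpleGraph (Fin m)) (u v : ℕ) :
    adjArray G u v = 0 ∨ adjArray G u v = 1 := by
  unfold adjArray
  split_ifs <;> simp

theorem adjArray_eq_iff {m m' : ℕ} {G : SimpleGraph (Fin m)} {G' : SimpleGraph (Fin m')}
    {u v u' v' : ℕ} : adjArray G u v = adjArray G' u' v' ↔
      (adjArray G u v = 1 ↔ adjArray G' u' v' = 1) := by
  rcases adjArray_eq_zero_or_one G u v with h | h <;>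
    rcases adjArray_eq_zero_or_one G' u' v' with h' | h' <;> simp [h, h']

variable {hN : 13 * (n + 1) ≤ N} {F : Fin 13 → SimpleGraph (Fin n)}

theorem adjArray_gadget_eq_one_iff {x y : ℕ} :
    adjArray (gadget hN F) x y = 1 ↔ ∃ (j : Fin 13) (a b : Option (Fin n)),
      (cone (F j)).Adj a b ∧ x = j * (n + 1) + optCode a ∧ y = j * (n + 1) + optCode b := by
  rw [adjArray_eq_one_iff]
  constructor
  · rintro ⟨hx, hy, h⟩
    rw [gadget, SimpleGraph.map_adj] at h
    obtain ⟨⟨i, a⟩, ⟨j, b⟩, ⟨hij, hab⟩, h1, h2⟩ := h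
    obtain rfl : i = j := hij
    exact ⟨i, a, b, hab, (Fin.mk.inj h1).symm, (Fin.mk.inj h2).symm⟩
  · rintro ⟨j, a, b, hab, rfl, rfl⟩
    refine ⟨(place hN (j, a)).2, (place hN (j, b)).2, ?_⟩
    rw [gadget, SimpleGraph.map_adj]
    exact ⟨(j, a), (j, b), ⟨rfl, hab⟩, rfl, rfl⟩

theorem adjArray_gadget_place (j : Fin 13) (a b : Option (Fin n)) :
    adjArray (gadget hN F) (j * (n + 1) + optCode a) (j * (n + 1) + optCode b) = 1 ↔
      (cone (F j)).Adj a b := by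
  rw [adjArray_gadget_eq_one_iff]
  constructor
  · rintro ⟨i, a', b', h, h1, h2⟩
    obtain ⟨hij, ha⟩ := mul_add_inj (optCode_lt a) (optCode_lt a') h1
    obtain ⟨-, hb⟩ := mul_add_inj (optCode_lt b) (optCode_lt b') h2
    obtain rfl : j = i := Fin.ext hij
    rw [optCode_injective ha, optCode_injective hb]
    exact h
  · exact fun h => ⟨j, a, b, h, rfl, rfl⟩

/-! ### Embeddings of the first cone -/

/-- The row `r` maps the first cone into the union of the others, as an induced subgraph. -/
def EmbedsFirst (n : ℕ) (Γ : ℕ → ℕ → ℕ) (r : ℕ → ℕ) : Prop :=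
  ∀ u v, u < n + 1 → v < n + 1 → Γ u v = Γ (r u) (r v) ∧ n + 1 ≤ r u ∧ (u ≠ v → r u ≠ r v)

/-- Each vertex of the first cone is joined to the apex, so its image lies in the same cone as the
image of the apex. That cone is not the first, hence lies over `G₂`, and an injection between cones
of equal size is bijective. Nothing requires `r` to come from a permutation, which makes the test
sound for arbitrary output; `hn` supplies a vertex that shows the apex to land in some cone. -/
theorem nonempty_iso_of_embedsFirst {G₁ G₂ : SimpleGraph (Fin n)} (hn : 0 < n) {r : ℕ → ℕ}
    (h : EmbedsFirst n (adjArray (gadget hN (pairFamily G₁ G₂))) r) : Nonempty (G₁ ≃g G₂) := by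
  have h0 : ∀ a b : Option (Fin n), adjArray (gadget hN (pairFamily G₁ G₂)) (optCode a)
      (optCode b) = 1 ↔ (cone G₁).Adj a b := fun a b => by
    have := adjArray_gadget_place (hN := hN) (F := pairFamily G₁ G₂) 0 a b
    simpa [pairFamily] using this
  have hadj : ∀ u : Fin n, ∃ (j : Fin 13) (a b : Option (Fin n)),
      r (optCode (some u)) = j * (n + 1) + optCode a ∧
      r (optCode (none : Option (Fin n))) = j * (n + 1) + optCode b := fun u => by
    have h1 := (h _ _ (optCode_lt (some u)) (optCode_lt (none : Option (Fin n)))).1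
    rw [(h0 _ _).2 (cone_adj_some_none _ _), eq_comm, adjArray_gadget_eq_one_iff] at h1
    obtain ⟨j, a, b, -, ha, hb⟩ := h1
    exact ⟨j, a, b, ha, hb⟩
  obtain ⟨j, a₀, b₀, -, hb₀⟩ := hadj ⟨0, hn⟩
  have hφ : ∀ o : Option (Fin n), ∃ o' : Option (Fin n),
      r (optCode o) = j * (n + 1) + optCode o' := fun o => by
    cases o with
    | none => exact ⟨b₀, hb₀⟩
    | some u =>
      obtain ⟨i, a, b, ha, hb⟩ := hadj u
      obtain ⟨hij, -⟩ := mul_add_inj (optCode_lt b) (optCode_lt b₀) (hb.symm.trans hb₀)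
      exact ⟨a, by rw [ha, hij]⟩
  choose φ hφ using hφ
  have hinj : Function.Injective φ := fun a b hab => by
    by_contra hne
    refine (h _ _ (optCode_lt a) (optCode_lt b)).2.2 (fun hc => hne (optCode_injective hc)) ?_
    rw [hφ a, hφ b, hab]
  have hj : pairFamily G₁ G₂ j = G₂ := by
    refine if_neg fun hj => ?_
    have h1 := (h _ _ (optCode_lt (none : Option (Fin n)))
      (optCode_lt (none : Option (Fin n)))).2.1
    rw [hφ, hj] at h1
    have h2 := optCode_lt (φ none)
    simp at h1
    omega
  refine nonempty_iso_of_cone (Equiv.ofBijective φ (Finite.injective_iff_bijective.1 hinj))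
    fun a b => ?_
  rw [← h0, (h _ _ (optCode_lt a) (optCode_lt b)).1, hφ, hφ, adjArray_gadget_place, hj]
  rfl

/-- The apex of the first cone. -/
def apex (hN : 13 * (n + 1) ≤ N) : Fin N := place hN (0, none)

/-- The first cone occupies exactly the numbers below n + 1, and no edge leaves a cone. -/
theorem lt_iff_of_gadget_adj {x y : Fin N} (h : (gadget hN F).Adj x y) :
    (x : ℕ) < n + 1 ↔ (y : ℕ) < n + 1 := by
  rw [gadget, SimpleGraph.map_adj] at h
  obtain ⟨⟨i, a⟩, ⟨j, b⟩, ⟨hij, -⟩, rfl, rfl⟩ := h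
  obtain rfl : i = j := hij
  change (i : ℕ) * (n + 1) + optCode a < n + 1 ↔ (i : ℕ) * (n + 1) + optCode b < n + 1
  have ha := optCode_lt a
  have hb := optCode_lt b
  rcases Nat.eq_zero_or_pos (i : ℕ) with hi | hi
  · rw [hi]; omega
  · have : n + 1 ≤ (i : ℕ) * (n + 1) := Nat.le_mul_of_pos_left _ hi
    omega

/-- Once the apex leaves the first cone, all its neighbours, that is the whole cone, must leave with
it. -/
theorem embedsFirst_of_aut {σ : Perm (Fin N)} (hσ : σ ∈ Aut (gadget hN F))
    (ha : ¬ (σ (apex hN) : ℕ) < n + 1) {r : ℕ → ℕ} (hr : ∀ v : Fin N, r v = σ v) :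
    EmbedsFirst n (adjArray (gadget hN F)) r := by
  have hplace : ∀ o : Option (Fin n), r (optCode o) = σ (place hN (0, o)) := fun o => by
    rw [← hr]
    simp [place_val]
  intro u v hu hv
  obtain ⟨a, rfl⟩ := exists_optCode hu
  obtain ⟨b, rfl⟩ := exists_optCode hv
  have hval : ∀ o : Option (Fin n), optCode o = (place hN (0, o) : ℕ) := fun o => by simp [place_val]
  refine ⟨?_, ?_, fun hne heq => hne ?_⟩
  · rw [adjArray_eq_iff, hplace, hplace, hval a, hval b, adjArray_eq_one_iff, adjArray_eq_one_iff]
    simpa using hσ (place hN (0, a)) (place hN (0, b))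
  · rw [hplace]
    cases a with
    | none => exact not_lt.1 ha
    | some w =>
      refine not_lt.1 fun hlt => ha ?_
      refine (lt_iff_of_gadget_adj (hN := hN) (F := F) ((hσ _ _).1 ?_)).1 hlt
      rw [gadget, SimpleGraph.map_adj]
      exact ⟨(0, some w), (0, none), ⟨rfl, cone_adj_some_none _ _⟩, rfl, rfl⟩
  · rw [hplace, hplace, Fin.val_inj, EmbeddingLike.apply_eq_iff_eq] at heq
    rw [hval, hval, heq]

/-! #### Exchanging two cones -/

/-- The identification of the members of the family with the second graph. -/
def toSecond {G₁ G₂ : SimpleGraph (Fin n)} (e : G₁ ≃g G₂) (j : Fin 13) : Perm (Option (Fin n)) :=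
  if j = 0 then e.toEquiv.optionCongr else 1

theorem cone_adj_toSecond {G₁ G₂ : SimpleGraph (Fin n)} (e : G₁ ≃g G₂) (j : Fin 13)
    (a b : Option (Fin n)) : (cone G₂).Adj (toSecond e j a) (toSecond e j b) ↔
      (cone (pairFamily G₁ G₂ j)).Adj a b := by
  unfold toSecond pairFamily
  split_ifs
  · cases a <;> cases b <;> simp [e.map_adj_iff]
  · rfl

/-- Exchange the cone `j` with the first one. -/
def exchange {G₁ G₂ : SimpleGraph (Fin n)} (e : G₁ ≃g G₂) (j : Fin 13) :
    Perm (Fin 13 × Option (Fin n)) :=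
  Function.Involutive.toPerm
    -- Every cone is identified with the cone over `G₂`; routing through it makes the exchange an
    -- involution.
    (fun z => (swap 0 j z.1, (toSecond e (swap 0 j z.1)).symm (toSecond e z.1 z.2)))
    (fun z => by simp)

theorem coneSum_adj_exchange {G₁ G₂ : SimpleGraph (Fin n)} (e : G₁ ≃g G₂) (j : Fin 13)
    (x y : Fin 13 × Option (Fin n)) :
    (coneSum (pairFamily G₁ G₂)).Adj x y ↔
      (coneSum (pairFamily G₁ G₂)).Adj (exchange e j x) (exchange e j y) := by
  obtain ⟨i, a⟩ := x
  obtain ⟨i', b⟩ := y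
  change i = i' ∧ _ ↔ swap 0 j i = swap 0 j i' ∧ _
  rw [EmbeddingLike.apply_eq_iff_eq]
  refine and_congr_right fun hi => ?_
  subst hi
  change _ ↔ (cone (pairFamily G₁ G₂ (swap 0 j i))).Adj
    ((toSecond e (swap 0 j i)).symm (toSecond e i a))
    ((toSecond e (swap 0 j i)).symm (toSecond e i b))
  rw [← cone_adj_toSecond e (swap 0 j i), Equiv.apply_symm_apply, Equiv.apply_symm_apply,
    cone_adj_toSecond]

theorem viaEmbedding_mem_aut {G₁ G₂ : SimpleGraph (Fin n)} (e : G₁ ≃g G₂) (j : Fin 13) :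
    (exchange e j).viaEmbedding (place hN) ∈ Aut (gadget hN (pairFamily G₁ G₂)) := by
  intro x y
  rw [gadget, SimpleGraph.map_adj, SimpleGraph.map_adj]
  constructor
  · rintro ⟨a, b, hab, rfl, rfl⟩
    refine ⟨_, _, (coneSum_adj_exchange e j a b).1 hab, ?_, ?_⟩ <;>
      rw [Perm.viaEmbedding_apply]
  · rintro ⟨a, b, hab, ha, hb⟩
    refine ⟨(exchange e j).symm a, (exchange e j).symm b, ?_, ?_, ?_⟩
    · rw [coneSum_adj_exchange e j, Equiv.apply_symm_apply, Equiv.apply_symm_apply]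
      exact hab
    · refine ((exchange e j).viaEmbedding (place hN)).injective ?_
      rw [Perm.viaEmbedding_apply, Equiv.apply_symm_apply, ha]
    · refine ((exchange e j).viaEmbedding (place hN)).injective ?_
      rw [Perm.viaEmbedding_apply, Equiv.apply_symm_apply, hb]

/-- Division by n + 1 reads off the cone of a vertex, so the translates of the automorphisms fixing
the first cone can be told apart. -/
theorem viaEmbedding_exchange_div {G₁ G₂ : SimpleGraph (Fin n)} (e : G₁ ≃g G₂) (j : Fin 13)
    {x : Fin N} (hx : (x : ℕ) < n + 1) :
    ((exchange e j).viaEmbedding (place hN) x : ℕ) / (n + 1) = j := by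
  obtain ⟨o, ho⟩ := exists_optCode hx
  have : x = place hN (0, o) := Fin.ext (by simp [place_val, ho])
  rw [this, Perm.viaEmbedding_apply]
  change ((swap 0 j 0 : Fin 13) * (n + 1) + optCode _ : ℕ) / (n + 1) = j
  rw [swap_apply_left, Nat.add_comm, Nat.add_mul_div_right _ _ (Nat.succ_pos n),
    Nat.div_eq_of_lt (optCode_lt _), zero_add]

open Classical in
/-- Few automorphisms preserve the first cone. -/
theorem card_fixing_le {G₁ G₂ : SimpleGraph (Fin n)} (e : G₁ ≃g G₂) :
    13 * (Finset.univ.filter fun σ : Aut (gadget hN (pairFamily G₁ G₂)) =>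
      ((σ : Perm (Fin N)) (apex hN) : ℕ) < n + 1).card ≤
        Fintype.card (Aut (gadget hN (pairFamily G₁ G₂))) := by
  rw [← Finset.card_univ, show (13 : ℕ) = (Finset.univ : Finset (Fin 13)).card by simp,
    ← Finset.card_product]
  -- Compose each such automorphism with each of the thirteen exchanges. The cone containing the
  -- image of the apex reveals which exchange was applied.
  refine Finset.card_le_card_of_injOn
    (fun z => (⟨_, viaEmbedding_mem_aut e z.1⟩ : Aut (gadget hN (pairFamily G₁ G₂))) * z.2)
    (fun _ _ => Finset.mem_univ _) ?_
  rintro ⟨i, σ⟩ hi ⟨j, τ⟩ hj h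
  simp only [Finset.coe_product, Set.mem_prod, Finset.mem_coe, Finset.mem_filter,
    Finset.mem_univ, true_and] at hi hj
  have h1 := viaEmbedding_exchange_div (hN := hN) e i hi
  have h2 := viaEmbedding_exchange_div (hN := hN) e j hj
  have h3 := congrArg (fun ρ : Aut (gadget hN (pairFamily G₁ G₂)) =>
    ((ρ : Perm (Fin N)) (apex hN) : ℕ)) h
  simp only [Subgroup.coe_mul, Perm.mul_apply] at h3
  rw [h3, h2] at h1
  obtain rfl : j = i := Fin.ext h1
  exact Prod.ext rfl (mul_left_cancel h)

end Gadget

end InvGen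

namespace InvGen

variable {Ω : Type} {src : Source Ω}

/-! ### Computing the size of the gadget -/

/-- Execute `p` a fixed number of times. -/
def repeatProg (p : Prog) : ℕ → Prog
  | 0 => .skip
  | k + 1 => .seq p (repeatProg p k)

/-- `var 4 := var 0 * var 4`; `var 1` holds `1` and `var 2` holds `0`. -/
def mulStep : Prog :=
  .seq (block [.const 5 0, .add 6 0 2])
    (.seq (.loop 6 (block [.sub 6 6 1, .add 5 5 4])) (block [.add 4 5 2]))

theorem reaches_mulStep {s : State Ω} (h1 : s.var 1 = 1) (h2 : s.var 2 = 0) :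
    Reaches src s mulStep (6 * s.var 0 + 11)
      fun s' => s'.var 4 = s.var 0 * s.var 4 ∧ SameExcept [4, 5, 6] s s' := by
  let I : ℕ → State Ω → Prop := fun m s' => s'.var 6 = m ∧ m ≤ s.var 0 ∧
    s'.var 5 = (s.var 0 - m) * s.var 4 ∧ s'.var 4 = s.var 4 ∧ SameExcept [4, 5, 6] s s'
  have hloop : ∀ s', I (s.var 0) s' → Reaches src s' (.loop 6 (block [.sub 6 6 1, .add 5 5 4]))
      (s.var 0 * (5 + 1) + 1) (I 0) := by
    refine Reaches.loop I (fun s' h => h.1) ?_ _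
    rintro m s' ⟨h6, hm, h5, h4, harr, hsam, hvar⟩
    refine ⟨by omega, reaches_block (by simp [Prog.IsBasic]) ⟨?_, by omega, ?_, ?_, ?_, ?_, ?_⟩⟩
    · simp [State.effect, h6, hvar 1 (by simp), h1]
    · simp only [State.effect, List.foldl, State.setVar_var, if_true, if_false, Nat.reduceEqDiff,
        h5, h4]
      rw [show s.var 0 - m = s.var 0 - (m + 1) + 1 by omega, Nat.succ_mul]
    · simp [State.effect, h4]
    · simp [State.effect, harr]
    · simp [State.effect, hsam]
    · intro x hx
      have := hvar x hx
      simp only [List.mem_cons, List.not_mem_nil, or_false, not_or] at hx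
      simp [State.effect, hx, this]
  refine ((reaches_block (Q := I (s.var 0)) (by simp [Prog.IsBasic]) ?_).seq
    fun s₁ h₁ => (hloop s₁ h₁).seq fun s₂ h₂ =>
      reaches_block (by simp [Prog.IsBasic]) ?_).mono ?_ fun _ h => h
  · refine ⟨by simp [State.effect, h2], le_rfl, by simp [State.effect], by simp [State.effect],
      by simp [State.effect], by simp [State.effect], fun x hx => ?_⟩
    simp only [List.mem_cons, List.not_mem_nil, or_false, not_or] at hx
    simp [State.effect, hx]
  · obtain ⟨-, -, h5, -, harr, hsam, hvar⟩ := h₂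
    refine ⟨?_, by simp [State.effect, harr], by simp [State.effect, hsam], fun x hx => ?_⟩
    · simp [State.effect, h5, hvar 2 (by simp), h2]
    · have := hvar x hx
      simp only [List.mem_cons, List.not_mem_nil, or_false, not_or] at hx
      simp [State.effect, hx, this]
  · simp only [List.length_cons, List.length_nil]; omega

theorem reaches_repeat_mulStep (k : ℕ) {s : State Ω} (h1 : s.var 1 = 1) (h2 : s.var 2 = 0) :
    Reaches src s (repeatProg mulStep k) (k * (6 * s.var 0 + 12) + 1)
      fun s' => s'.var 4 = s.var 0 ^ k * s.var 4 ∧ SameExcept [4, 5, 6] s s' := by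
  induction k generalizing s with
  | zero =>
    exact ⟨s, (exec_basic fun _ => rfl).mono (by omega), by simp, rfl, rfl, fun _ _ => rfl⟩
  | succ k ih =>
    refine ((reaches_mulStep h1 h2).seq (t' := k * (6 * s.var 0 + 12) + 1)
      fun s' ⟨h4, harr, hsam, hvar⟩ => ?_).mono (by rw [Nat.add_mul]; omega) fun _ h => h
    have h0 := hvar 0 (by simp)
    refine (ih ((hvar 1 (by simp)).trans h1) ((hvar 2 (by simp)).trans h2)).mono (by rw [h0])
      fun s'' ⟨h4', harr', hsam', hvar'⟩ => ⟨?_, harr'.trans harr, hsam'.trans hsam,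
        fun x hx => (hvar' x hx).trans (hvar x hx)⟩
    rw [h4', h4, h0]
    ring

/-! ### Writing the gadget -/

/-- The entry of the three copies of the graph is the wanted one. -/
def Correct (tgt : ℕ → ℕ → ℕ) (s : State Ω) (x y : ℕ) : Prop :=
  s.arr 2 x y = tgt x y ∧ s.arr 100 x y = tgt x y ∧ s.arr 101 x y = tgt x y

/-- From `s` to `s'` only the variables in `X` and the three copies of the graph have changed,
and no correct entry was spoilt. -/
structure Fills (tgt : ℕ → ℕ → ℕ) (X : List ℕ) (s s' : State Ω) : Prop where
  var : ∀ x, x ∉ X → s'.var x = s.var x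
  arr : ∀ b, b ∉ [2, 100, 101] → s'.arr b = s.arr b
  samples : s'.samples = s.samples
  correct : ∀ x y, Correct tgt s x y → Correct tgt s' x y

theorem Fills.refl {tgt : ℕ → ℕ → ℕ} {X : List ℕ} (s : State Ω) : Fills tgt X s s :=
  ⟨fun _ _ => rfl, fun _ _ => rfl, rfl, fun _ _ h => h⟩

theorem Fills.trans {tgt : ℕ → ℕ → ℕ} {X Y : List ℕ} {s s' s'' : State Ω} (h : Fills tgt X s s')
    (h' : Fills tgt Y s' s'') (hXY : X ⊆ Y) : Fills tgt Y s s'' :=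
  ⟨fun x hx => (h'.var x hx).trans (h.var x fun hc => hx (hXY hc)),
    fun b hb => (h'.arr b hb).trans (h.arr b hb), h'.samples.trans h.samples,
    fun x y hc => h'.correct x y (h.correct x y hc)⟩

theorem Fills.setVar {tgt : ℕ → ℕ → ℕ} {X : List ℕ} {s s' : State Ω} (h : Fills tgt X s s')
    {x : ℕ} (hx : x ∈ X) (v : ℕ) : Fills tgt X s (s'.setVar x v) := by
  refine ⟨fun y hy => ?_, h.arr, h.samples, h.correct⟩
  have hne : y ≠ x := fun hc => hy (hc ▸ hx)
  rw [State.setVar_var, if_neg hne]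
  exact h.var y hy

/-- Store in the three copies. -/
def storeAll (i j x : ℕ) : List Prog := [.store 2 i j x, .store 100 i j x, .store 101 i j x]

theorem storeAll_var (s : State Ω) (i j x : ℕ) :
    ((storeAll i j x).foldl State.effect s).var = s.var := rfl

/-- Writing a target value cannot spoil a correct entry, so the order of the writes is irrelevant.
Array 2 serves the verification; arrays 100 and 101 are the inputs of the two copies of the
generator. -/
theorem fills_storeAll {tgt : ℕ → ℕ → ℕ} {X : List ℕ} {s s' : State Ω} (h : Fills tgt X s s')
    {i j x : ℕ} (hv : s'.var x = tgt (s'.var i) (s'.var j)) :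
    Fills tgt X s ((storeAll i j x).foldl State.effect s') ∧
      Correct tgt ((storeAll i j x).foldl State.effect s') (s'.var i) (s'.var j) := by
  have harr : ∀ b p q, ((storeAll i j x).foldl State.effect s').arr b p q =
      if b ∈ [2, 100, 101] ∧ p = s'.var i ∧ q = s'.var j then tgt p q else s'.arr b p q := by
    intro b p q
    simp only [storeAll, List.foldl, State.effect, State.setArr_arr, State.setArr_var]
    by_cases hpq : p = s'.var i ∧ q = s'.var j
    · obtain ⟨rfl, rfl⟩ := hpq
      by_cases h1 : b = 101
      · simp [h1, hv]
      by_cases h2 : b = 100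
      · simp [h2, hv]
      by_cases h3 : b = 2
      · simp [h3, hv]
      · simp [h1, h2, h3]
    · simp [hpq]
  refine ⟨⟨h.var, fun b hb => ?_, h.samples, fun p q hc => ?_⟩, ?_⟩
  · rw [← h.arr b hb]
    funext p q
    rw [harr, if_neg fun hc => hb hc.1]
  · obtain ⟨h1, h2, h3⟩ := h.correct p q hc
    refine ⟨?_, ?_, ?_⟩ <;> rw [harr] <;> split_ifs <;> first | rfl | assumption
  · refine ⟨?_, ?_, ?_⟩ <;> rw [harr] <;> simp

/-- Write the cone over the graph in `arr a` to the places that start at `var 7`. -/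
def fillCone (a : ℕ) : Prog :=
  .seq (block [.add 8 0 2, .add 13 7 0])
    (.loop 8
      (.seq (block ([.sub 8 8 1, .add 10 7 8] ++ storeAll 10 13 1 ++ storeAll 13 10 1 ++
          [.add 9 0 2]))
        (.loop 9 (block ([.sub 9 9 1, .add 11 7 9, .load 12 a 8 9] ++ storeAll 10 11 12)))))

/-- The variables used by `fillCone`. -/
def fillVars : List ℕ := [8, 9, 10, 11, 12, 13]

theorem reaches_fillRow {tgt : ℕ → ℕ → ℕ} {a n u : ℕ} {s₀ : State Ω} (ha : a ∉ [2, 100, 101])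
    (h1 : s₀.var 1 = 1) (hrow : ∀ v < n, tgt (s₀.var 7 + u) (s₀.var 7 + v) = s₀.arr a u v)
    {s : State Ω} (hs : Fills tgt fillVars s₀ s) (h8 : s.var 8 = u) (h9 : s.var 9 = n)
    (h10 : s.var 10 = s₀.var 7 + u) :
    Reaches src s (.loop 9 (block ([.sub 9 9 1, .add 11 7 9, .load 12 a 8 9] ++
        storeAll 10 11 12))) (n * 14 + 1) fun s' => Fills tgt fillVars s s' ∧ s'.var 8 = u ∧
      s'.var 13 = s.var 13 ∧ ∀ v < n, Correct tgt s' (s₀.var 7 + u) (s₀.var 7 + v) := by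
  let I : ℕ → State Ω → Prop := fun m s' => s'.var 9 = m ∧ m ≤ n ∧ Fills tgt fillVars s s' ∧
    s'.var 8 = u ∧ s'.var 13 = s.var 13 ∧ s'.var 10 = s₀.var 7 + u ∧
    ∀ v, m ≤ v → v < n → Correct tgt s' (s₀.var 7 + u) (s₀.var 7 + v)
  have hloop := Reaches.loop (src := src) (x := 9) (t := 13) I (fun s' h => h.1)
    (p := block ([.sub 9 9 1, .add 11 7 9, .load 12 a 8 9] ++ storeAll 10 11 12)) ?_ n s
    ⟨h9, le_rfl, Fills.refl s, h8, rfl, h10, fun v hv hv' => absurd hv' (by omega)⟩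
  · exact hloop.mono (by omega) fun s' h => ⟨h.2.2.1, h.2.2.2.1, h.2.2.2.2.1,
      fun v hv => h.2.2.2.2.2.2 v (Nat.zero_le v) hv⟩
  rintro m s' ⟨h9, hm, hf, h8, h13, h10, hdone⟩
  have hf0 := hs.trans hf (List.Subset.refl _)
  have e1 : s'.var 1 = 1 := (hf0.var 1 (by decide)).trans h1
  have e7 : s'.var 7 = s₀.var 7 := hf0.var 7 (by decide)
  refine ⟨by omega, reaches_block ?_ ?_⟩
  · simp [Prog.IsBasic, storeAll]
  rw [List.foldl_append]
  set s₁ := [Prog.sub 9 9 1, .add 11 7 9, .load 12 a 8 9].foldl State.effect s' with hs₁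
  have hfs₁ : Fills tgt fillVars s s₁ :=
    ((hf.setVar (x := 9) (by decide) _).setVar (x := 11) (by decide) _).setVar (x := 12)
      (by decide) _
  have v9 : s₁.var 9 = m := by simp [hs₁, State.effect, h9, e1]
  have v8 : s₁.var 8 = u := by simp [hs₁, State.effect, h8]
  have v13 : s₁.var 13 = s.var 13 := by simp [hs₁, State.effect, h13]
  have v10 : s₁.var 10 = s₀.var 7 + u := by simp [hs₁, State.effect, h10]
  have v11 : s₁.var 11 = s₀.var 7 + m := by simp [hs₁, State.effect, h9, e1, e7]
  have v12 : s₁.var 12 = s₀.arr a u m := by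
    simp [hs₁, State.effect, h9, h8, e1, hf0.arr a ha]
  obtain ⟨hfin, hc⟩ := fills_storeAll hfs₁ (i := 10) (j := 11) (x := 12)
    (by rw [v12, v10, v11, hrow m (by omega)])
  rw [v10, v11] at hc
  refine ⟨by rw [storeAll_var, v9], by omega, hfin, by rw [storeAll_var, v8],
    by rw [storeAll_var, v13], by rw [storeAll_var, v10], fun v hv hvn => ?_⟩
  by_cases hvm : v = m
  · rw [hvm]; exact hc
  · exact (fills_storeAll (Fills.refl (X := fillVars) s₁) (i := 10) (j := 11) (x := 12)
      (by rw [v12, v10, v11, hrow m (by omega)])).1.correct _ _ (hdone v (by omega) hvn)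

/-- The target enters only through its values on one cone, so the same code serves all thirteen
offsets. -/
theorem reaches_fillCone {tgt : ℕ → ℕ → ℕ} {a n : ℕ} {s : State Ω} (ha : a ∉ [2, 100, 101])
    (h0 : s.var 0 = n) (h1 : s.var 1 = 1) (h2 : s.var 2 = 0)
    (hrow : ∀ u < n, ∀ v < n, tgt (s.var 7 + u) (s.var 7 + v) = s.arr a u v)
    (hapex : ∀ u < n, tgt (s.var 7 + u) (s.var 7 + n) = 1 ∧ tgt (s.var 7 + n) (s.var 7 + u) = 1) :
    Reaches src s (fillCone a) (n * (14 * n + 22) + 7) fun s' => Fills tgt fillVars s s' ∧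
      ∀ u < n, Correct tgt s' (s.var 7 + u) (s.var 7 + n) ∧
        Correct tgt s' (s.var 7 + n) (s.var 7 + u) ∧
        ∀ v < n, Correct tgt s' (s.var 7 + u) (s.var 7 + v) := by
  let I : ℕ → State Ω → Prop := fun m s' => s'.var 8 = m ∧ m ≤ n ∧ Fills tgt fillVars s s' ∧
    s'.var 13 = s.var 7 + n ∧ ∀ u, m ≤ u → u < n →
      Correct tgt s' (s.var 7 + u) (s.var 7 + n) ∧
        Correct tgt s' (s.var 7 + n) (s.var 7 + u) ∧
        ∀ v < n, Correct tgt s' (s.var 7 + u) (s.var 7 + v)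
  have hstart : Reaches src s (block [.add 8 0 2, .add 13 7 0]) 5 (I n) := by
    refine reaches_block (by simp [Prog.IsBasic]) ⟨?_, le_rfl, ?_, ?_, ?_⟩
    · simp [State.effect, h0, h2]
    · exact ((Fills.refl s).setVar (x := 8) (by decide) _).setVar (x := 13) (by decide) _
    · simp [State.effect, h0]
    · exact fun u hu hu' => absurd hu' (by omega)
  refine (hstart.seq (Reaches.loop (src := src) (t := 14 * n + 21) I (fun s' h => h.1) ?_ n)).mono
    (by rw [show 14 * n + 21 + 1 = 14 * n + 22 by omega]; omega)
    fun s' h => ⟨h.2.2.1, fun u hu => h.2.2.2.2 u (Nat.zero_le u) hu⟩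
  rintro m s' ⟨h8, hm, hf, h13, hdone⟩
  refine ⟨by omega, ?_⟩
  have e0 : s'.var 0 = n := (hf.var 0 (by decide)).trans h0
  have e1 : s'.var 1 = 1 := (hf.var 1 (by decide)).trans h1
  have e2 : s'.var 2 = 0 := (hf.var 2 (by decide)).trans h2
  have e7 : s'.var 7 = s.var 7 := hf.var 7 (by decide)
  have hblock : Reaches src s' (block ([.sub 8 8 1, .add 10 7 8] ++ storeAll 10 13 1 ++
      storeAll 13 10 1 ++ [.add 9 0 2])) 19 fun s'' => Fills tgt fillVars s' s'' ∧
        s''.var 8 = m ∧ s''.var 9 = n ∧ s''.var 10 = s.var 7 + m ∧ s''.var 13 = s.var 7 + n ∧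
        Correct tgt s'' (s.var 7 + m) (s.var 7 + n) ∧
        Correct tgt s'' (s.var 7 + n) (s.var 7 + m) := by
    refine reaches_block ?_ ?_
    · simp [Prog.IsBasic, storeAll]
    rw [List.foldl_append, List.foldl_append, List.foldl_append]
    set s₁ := [Prog.sub 8 8 1, .add 10 7 8].foldl State.effect s' with hs₁
    have hfs₁ : Fills tgt fillVars s' s₁ :=
      ((Fills.refl s').setVar (x := 8) (by decide) _).setVar (x := 10) (by decide) _
    have v8 : s₁.var 8 = m := by simp [hs₁, State.effect, h8, e1]
    have v10 : s₁.var 10 = s.var 7 + m := by simp [hs₁, State.effect, h8, e1, e7]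
    have v13 : s₁.var 13 = s.var 7 + n := by simp [hs₁, State.effect, h13]
    have v1 : s₁.var 1 = 1 := by simp [hs₁, State.effect, e1]
    have v0 : s₁.var 0 = n := by simp [hs₁, State.effect, e0]
    have v2 : s₁.var 2 = 0 := by simp [hs₁, State.effect, e2]
    obtain ⟨hf₂, hc₂⟩ := fills_storeAll hfs₁ (i := 10) (j := 13) (x := 1)
      (by rw [v1, v10, v13, (hapex m (by omega)).1])
    have hv₂ := storeAll_var s₁ 10 13 1
    set s₂ := (storeAll 10 13 1).foldl State.effect s₁
    have hval₃ : s₂.var 1 = tgt (s₂.var 13) (s₂.var 10) := by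
      rw [hv₂, v1, v10, v13, (hapex m (by omega)).2]
    obtain ⟨hf₃, hc₃⟩ := fills_storeAll hf₂ hval₃
    have hc₂' := (fills_storeAll (Fills.refl (X := fillVars) s₂) hval₃).1.correct _ _ hc₂
    have hv₃ := storeAll_var s₂ 13 10 1
    set s₃ := (storeAll 13 10 1).foldl State.effect s₂
    rw [hv₂, v10, v13] at hc₃
    rw [v10, v13] at hc₂'
    refine ⟨hf₃.setVar (x := 9) (by decide) _, ?_, ?_, ?_, ?_, hc₂', hc₃⟩
    · simp [State.effect, hv₃, hv₂, v8]
    · simp [State.effect, hv₃, hv₂, v0, v2]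
    · simp [State.effect, hv₃, hv₂, v10]
    · simp [State.effect, hv₃, hv₂, v13]
  refine (hblock.seq (t' := n * 14 + 1) fun s'' ⟨hf', k8, k9, k10, k13, hc, hc'⟩ => ?_).mono
    (by omega) fun _ h => h
  have hf'' := hf.trans hf' (List.Subset.refl _)
  refine (reaches_fillRow (src := src) (n := n) (u := m) ha h1 (hrow m (by omega)) hf'' k8 k9
    k10).mono le_rfl fun s₃ ⟨g, g8, g13, gc⟩ => ⟨g8, by omega,
      hf''.trans g (List.Subset.refl _), by rw [g13, k13], fun u hu hun => ?_⟩
  by_cases hum : u = m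
  · subst hum
    exact ⟨g.correct _ _ hc, g.correct _ _ hc', gc⟩
  · obtain ⟨d1, d2, d3⟩ := hdone u (by omega) hun
    exact ⟨g.correct _ _ (hf'.correct _ _ d1), g.correct _ _ (hf'.correct _ _ d2),
      fun v hv => g.correct _ _ (hf'.correct _ _ (d3 v hv))⟩

/-- Write the gadget; `var 3` holds the size of a cone. -/
def fillGadget : Prog :=
  .seq (block [.const 7 0, .const 14 12])
    (.seq (fillCone 0)
      (.loop 14 (.seq (block [.sub 14 14 1, .add 7 7 3]) (fillCone 1))))

/-- The variables used by `fillGadget`. -/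
def gadgetVars : List ℕ := 7 :: 14 :: fillVars

theorem reaches_fillGadget {n N : ℕ} (hN : 13 * (n + 1) ≤ N) {G₁ G₂ : SimpleGraph (Fin n)}
    {s : State Ω} (h0 : s.var 0 = n) (h1 : s.var 1 = 1) (h2 : s.var 2 = 0) (h3 : s.var 3 = n + 1)
    (ha0 : s.arr 0 = adjArray G₁) (ha1 : s.arr 1 = adjArray G₂)
    (hz : ∀ b ∈ [2, 100, 101], s.arr b = 0) :
    Reaches src s fillGadget (13 * (n * (14 * n + 22)) + 200) fun s' =>
      Fills (adjArray (gadget hN (pairFamily G₁ G₂))) gadgetVars s s' ∧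
        ∀ b ∈ [2, 100, 101], s'.arr b = adjArray (gadget hN (pairFamily G₁ G₂)) := by
  set tgt := adjArray (gadget hN (pairFamily G₁ G₂)) with htgt
  have hrow : ∀ (j : Fin 13), ∀ u < n, ∀ v < n, tgt (j * (n + 1) + u) (j * (n + 1) + v) =
      adjArray (pairFamily G₁ G₂ j) u v := fun j u hu v hv => by
    have := adjArray_gadget_place (hN := hN) (F := pairFamily G₁ G₂) j (some ⟨u, hu⟩)
      (some ⟨v, hv⟩)
    rw [htgt, adjArray_eq_iff, adjArray_eq_one_iff (G := pairFamily G₁ G₂ j)]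
    rw [cone_adj_some] at this
    exact this.trans ⟨fun h => ⟨hu, hv, h⟩, fun ⟨_, _, h⟩ => h⟩
  have hapex : ∀ (j : Fin 13), ∀ u < n, tgt (j * (n + 1) + u) (j * (n + 1) + n) = 1 ∧
      tgt (j * (n + 1) + n) (j * (n + 1) + u) = 1 := fun j u hu =>
    ⟨(adjArray_gadget_place (hN := hN) (F := pairFamily G₁ G₂) j (some ⟨u, hu⟩) none).2
        (cone_adj_some_none _ _),
      (adjArray_gadget_place (hN := hN) (F := pairFamily G₁ G₂) j none (some ⟨u, hu⟩)).2
        (cone_adj_none_some _ _)⟩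
  let B : ℕ → State Ω → Prop := fun j s' => ∀ u < n,
    Correct tgt s' (j * (n + 1) + u) (j * (n + 1) + n) ∧
      Correct tgt s' (j * (n + 1) + n) (j * (n + 1) + u) ∧
      ∀ v < n, Correct tgt s' (j * (n + 1) + u) (j * (n + 1) + v)
  have hBmono : ∀ {X j s' s''}, Fills tgt X s' s'' → B j s' → B j s'' := fun hf hb u hu =>
    ⟨hf.correct _ _ (hb u hu).1, hf.correct _ _ (hb u hu).2.1,
      fun v hv => hf.correct _ _ ((hb u hu).2.2 v hv)⟩
  let I : ℕ → State Ω → Prop := fun m s' => s'.var 14 = m ∧ m ≤ 12 ∧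
    s'.var 7 = (12 - m) * (n + 1) ∧ Fills tgt gadgetVars s s' ∧ ∀ j, j ≤ 12 - m → B j s'
  have hstart : Reaches src s (block [.const 7 0, .const 14 12]) 5 fun s' =>
      Fills tgt gadgetVars s s' ∧ s'.var 7 = 0 ∧ s'.var 14 = 12 := by
    refine reaches_block (by simp [Prog.IsBasic]) ⟨?_, by simp [State.effect], by simp [State.effect]⟩
    exact ((Fills.refl s).setVar (x := 7) (by decide) _).setVar (x := 14) (by decide) _
  have hsub : fillVars ⊆ gadgetVars := by decide
  have hfirst : ∀ s', Fills tgt gadgetVars s s' ∧ s'.var 7 = 0 ∧ s'.var 14 = 12 →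
      Reaches src s' (fillCone 0) (n * (14 * n + 22) + 7) (I 12) := by
    rintro s' ⟨hf, h7, h14⟩
    have e0 : s'.var 0 = n := (hf.var 0 (by decide)).trans h0
    have e1 : s'.var 1 = 1 := (hf.var 1 (by decide)).trans h1
    have e2 : s'.var 2 = 0 := (hf.var 2 (by decide)).trans h2
    have ea : s'.arr 0 = adjArray G₁ := (hf.arr 0 (by decide)).trans ha0
    refine (reaches_fillCone (src := src) (tgt := tgt) (a := 0) (by decide) e0 e1 e2 ?_ ?_).mono
      le_rfl fun s'' ⟨hf', hc⟩ => ⟨?_, le_rfl, ?_, hf.trans ?_ (List.Subset.refl _), ?_⟩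
    · intro u hu v hv
      rw [h7, ea]
      simpa [pairFamily] using hrow 0 u hu v hv
    · intro u hu
      rw [h7]
      simpa using hapex 0 u hu
    · rw [hf'.var 14 (by decide), h14]
    · rw [hf'.var 7 (by decide), h7]; simp
    · exact ⟨fun x hx => hf'.var x fun hc => hx (hsub hc), hf'.arr, hf'.samples, hf'.correct⟩
    · intro j hj
      obtain rfl : j = 0 := by omega
      rw [h7] at hc
      intro u hu
      simpa using hc u hu
  have hrest : ∀ s', I 12 s' → Reaches src s' (.loop 14 (.seq (block [.sub 14 14 1, .add 7 7 3])
      (fillCone 1))) (12 * (n * (14 * n + 22) + 13 + 1) + 1) (I 0) := by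
    refine Reaches.loop I (fun s' h => h.1) ?_ 12
    rintro m s' ⟨h14, hm, h7, hf, hB⟩
    refine ⟨by omega, ?_⟩
    have e1 : s'.var 1 = 1 := (hf.var 1 (by decide)).trans h1
    have e3 : s'.var 3 = n + 1 := (hf.var 3 (by decide)).trans h3
    have hblock : Reaches src s' (block [.sub 14 14 1, .add 7 7 3]) 5 fun s'' =>
        Fills tgt gadgetVars s' s'' ∧ s''.var 14 = m ∧ s''.var 7 = (12 - m) * (n + 1) := by
      refine reaches_block (by simp [Prog.IsBasic]) ⟨?_, by simp [State.effect, h14, e1], ?_⟩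
      · exact ((Fills.refl s').setVar (x := 14) (by decide) _).setVar (x := 7) (by decide) _
      · simp only [List.foldl, State.effect, State.setVar_var, if_true, if_false, Nat.reduceEqDiff,
          h7, e3]
        rw [show 12 - m = 12 - (m + 1) + 1 by omega, Nat.succ_mul]
    refine (hblock.seq (t' := n * (14 * n + 22) + 7) fun s'' ⟨hf', k14, k7⟩ => ?_).mono
      (by omega) fun _ h => h
    have hf'' := hf.trans hf' (List.Subset.refl _)
    have k0 : s''.var 0 = n := (hf''.var 0 (by decide)).trans h0
    have k1 : s''.var 1 = 1 := (hf''.var 1 (by decide)).trans h1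
    have k2 : s''.var 2 = 0 := (hf''.var 2 (by decide)).trans h2
    have ka : s''.arr 1 = adjArray G₂ := (hf''.arr 1 (by decide)).trans ha1
    have hj13 : 12 - m < 13 := by omega
    have hjne : (⟨12 - m, hj13⟩ : Fin 13) ≠ 0 := fun h => by
      have := congrArg Fin.val h
      simp only [Fin.val_zero] at this
      omega
    refine (reaches_fillCone (src := src) (tgt := tgt) (a := 1) (by decide) k0 k1 k2 ?_ ?_).mono
      le_rfl fun s₃ ⟨g, hc⟩ => ⟨?_, by omega, ?_, hf''.trans ?_ (List.Subset.refl _), ?_⟩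
    · intro u hu v hv
      rw [k7, ka]
      have := hrow ⟨12 - m, hj13⟩ u hu v hv
      rwa [pairFamily, if_neg hjne] at this
    · intro u hu
      rw [k7]
      exact hapex ⟨12 - m, hj13⟩ u hu
    · rw [g.var 14 (by decide), k14]
    · rw [g.var 7 (by decide), k7]
    · exact ⟨fun x hx => g.var x fun hc => hx (hsub hc), g.arr, g.samples, g.correct⟩
    · intro j hj
      by_cases hjm : j = 12 - m
      · subst hjm
        rw [k7] at hc
        exact hc
      · exact hBmono g (hBmono hf' (hB j (by omega)))
  refine (hstart.seq fun s₁ hs₁ => (hfirst s₁ hs₁).seq hrest).mono (by omega) ?_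
  rintro s' ⟨-, -, -, hf, hB⟩
  -- Zero entries of the target were correct in the empty arrays and stay so; entries equal to 1 lie
  -- inside some cone and have been written.
  have hall : ∀ x y, Correct tgt s' x y := by
    intro x y
    rcases adjArray_eq_zero_or_one (gadget hN (pairFamily G₁ G₂)) x y with h | h
    · refine hf.correct x y ?_
      rw [← htgt] at h
      refine ⟨?_, ?_, ?_⟩ <;> rw [hz _ (by decide), h] <;> rfl
    · obtain ⟨j, a, b, hab, rfl, rfl⟩ := adjArray_gadget_eq_one_iff.1 h
      have hj : (j : ℕ) ≤ 12 - 0 := by have := j.2; omega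
      cases a with
      | none =>
        cases b with
        | none => exact absurd rfl hab.ne
        | some v => exact ((hB j hj) v v.2).2.1
      | some u =>
        cases b with
        | none => exact ((hB j hj) u u.2).1
        | some v => exact ((hB j hj) u u.2).2.2 v v.2
  refine ⟨hf, ?_⟩
  intro b hb
  simp only [List.mem_cons, List.not_mem_nil, or_false] at hb
  rcases hb with rfl | rfl | rfl <;> funext x y
  · exact (hall x y).1
  · exact (hall x y).2.1
  · exact (hall x y).2.2

/-! ### Verifying an isomorphism -/

/-- One comparison. -/
def compareStep (a : ℕ) : List Prog :=
  [.sub 9 9 1, .load 10 a 2 8, .load 11 a 2 9, .load 12 2 8 9, .load 13 2 10 11,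
    .sub 22 12 13, .add 21 21 22, .sub 22 13 12, .add 21 21 22, .sub 22 3 10, .add 21 21 22,
    .sub 22 8 9, .sub 23 9 8, .add 22 22 23, .sub 22 1 22, .sub 22 1 22,
    .sub 23 10 11, .sub 24 11 10, .add 23 23 24, .sub 22 22 23, .add 21 21 22]

/-- Set `var 20` to `1` if row `0` of `arr a` maps the first cone as it should. -/
def verify (a : ℕ) : Prog :=
  .seq (block [.const 21 0, .add 8 3 2])
    (.seq (.loop 8 (.seq (block [.sub 8 8 1, .add 9 3 2]) (.loop 9 (block (compareStep a)))))
      (.ite 21 .skip (.const 20 1)))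

/-- The variables used by `verify`. -/
def verifyVars : List ℕ := [8, 9, 10, 11, 12, 13, 20, 21, 22, 23, 24]

/-- `var 21` accumulates violations as truncated differences. The last summand is positive exactly
if `u ≠ v` while their images agree: 1 - (1 - |u - v|) is the indicator of `u ≠ v`, from which the
distance of the images is subtracted. -/
theorem compareStep_eval (a : ℕ) (s : State Ω) (h2 : s.var 2 = 0) :
    ∀ s', (compareStep a).foldl State.effect s = s' → SameExcept verifyVars s s' ∧
      s'.var 8 = s.var 8 ∧ s'.var 9 = s.var 9 - s.var 1 ∧ s'.var 20 = s.var 20 ∧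
      ∀ u v, s.var 8 = u → s.var 9 - s.var 1 = v → s.var 1 = 1 →
        s'.var 21 = s.var 21 + (s.arr 2 u v - s.arr 2 (s.arr a 0 u) (s.arr a 0 v)) +
          (s.arr 2 (s.arr a 0 u) (s.arr a 0 v) - s.arr 2 u v) + (s.var 3 - s.arr a 0 u) +
          (1 - (1 - ((u - v) + (v - u))) -
            ((s.arr a 0 u - s.arr a 0 v) + (s.arr a 0 v - s.arr a 0 u))) := by
  rintro s' rfl
  refine ⟨⟨?_, ?_, fun x hx => ?_⟩, ?_, ?_, ?_, ?_⟩
  · simp [compareStep, State.effect]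
  · simp [compareStep, State.effect]
  · simp only [verifyVars, List.mem_cons, List.not_mem_nil, or_false, not_or] at hx
    simp [compareStep, State.effect, hx]
  · simp [compareStep, State.effect]
  · simp [compareStep, State.effect]
  · simp [compareStep, State.effect]
  · rintro u v rfl rfl h1
    simp [compareStep, State.effect, h1, h2]

/-- The condition that is verified for a pair of vertices. -/
def PairOk (n : ℕ) (Γ : ℕ → ℕ → ℕ) (r : ℕ → ℕ) (u v : ℕ) : Prop :=
  Γ u v = Γ (r u) (r v) ∧ n + 1 ≤ r u ∧ (u ≠ v → r u ≠ r v)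

theorem reaches_compareLoop {a n : ℕ} {s₀ : State Ω} (h1 : s₀.var 1 = 1) (h2 : s₀.var 2 = 0)
    (h3 : s₀.var 3 = n + 1) {s : State Ω} (hs : SameExcept verifyVars s₀ s)
    (h9 : s.var 9 = n + 1) :
    Reaches src s (.loop 9 (block (compareStep a))) ((n + 1) * (43 + 1) + 1) fun s' =>
      s'.var 8 = s.var 8 ∧ s'.var 20 = s.var 20 ∧ SameExcept verifyVars s₀ s' ∧
      (s'.var 21 = 0 ↔
        s.var 21 = 0 ∧ ∀ v < n + 1, PairOk n (s₀.arr 2) (s₀.arr a 0) (s.var 8) v) := by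
  let K : ℕ → State Ω → Prop := fun m s' => s'.var 9 = m ∧ m ≤ n + 1 ∧ s'.var 8 = s.var 8 ∧
    s'.var 20 = s.var 20 ∧ SameExcept verifyVars s₀ s' ∧ (s'.var 21 = 0 ↔
      s.var 21 = 0 ∧ ∀ v, m ≤ v → v < n + 1 → PairOk n (s₀.arr 2) (s₀.arr a 0) (s.var 8) v)
  refine (Reaches.loop (src := src) (t := 43) K (fun s h => h.1) ?_ (n + 1) s
    ⟨h9, le_rfl, rfl, rfl, hs, ?_⟩).mono le_rfl fun s' ⟨_, _, k8, k20, kJ, k⟩ =>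
      ⟨k8, k20, kJ, ?_⟩
  · rintro m s' ⟨k9, hm, k8, k20, ⟨karr, ksam, kvar⟩, k21⟩
    have e1 : s'.var 1 = 1 := (kvar 1 (by decide)).trans h1
    have e2 : s'.var 2 = 0 := (kvar 2 (by decide)).trans h2
    have e3 : s'.var 3 = n + 1 := (kvar 3 (by decide)).trans h3
    refine ⟨by omega, reaches_block (by simp [compareStep, Prog.IsBasic]) ?_⟩
    have heval := compareStep_eval a s' e2 _ rfl
    generalize (compareStep a).foldl State.effect s' = s'' at heval ⊢
    obtain ⟨⟨harr, hsam, hvar⟩, g8, g9, g20, g21⟩ := heval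
    refine ⟨by omega, by omega, g8.trans k8, g20.trans k20,
      ⟨harr.trans karr, hsam.trans ksam, fun x hx => (hvar x hx).trans (kvar x hx)⟩, ?_⟩
    rw [g21 _ m k8 (by omega) e1, karr, e3]
    have hsplit : (∀ v, m ≤ v → v < n + 1 → PairOk n (s₀.arr 2) (s₀.arr a 0) (s.var 8) v) ↔
        PairOk n (s₀.arr 2) (s₀.arr a 0) (s.var 8) m ∧
          ∀ v, m + 1 ≤ v → v < n + 1 → PairOk n (s₀.arr 2) (s₀.arr a 0) (s.var 8) v := by
      constructor
      · exact fun h => ⟨h m le_rfl (by omega), fun v hv => h v (by omega)⟩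
      · rintro ⟨h, h'⟩ v hv hv'
        by_cases hvm : v = m
        · exact hvm ▸ h
        · exact h' v (by omega) hv'
    rw [hsplit, and_left_comm, ← k21]
    simp only [PairOk]
    -- Only linear arithmetic with truncated subtraction remains once the array entries are
    -- abstracted.
    generalize s₀.arr 2 (s.var 8) m = p
    generalize s₀.arr 2 (s₀.arr a 0 (s.var 8)) (s₀.arr a 0 m) = q
    generalize s₀.arr a 0 (s.var 8) = r₁
    generalize s₀.arr a 0 m = r₂
    generalize s.var 8 = u
    generalize s'.var 21 = b
    omega
  · exact ⟨fun h => ⟨h, fun v hv hv' => absurd hv' (by omega)⟩, fun h => h.1⟩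
  · rw [k]
    exact and_congr_right fun _ => ⟨fun h v hv => h v (Nat.zero_le v) hv, fun h v _ hv => h v hv⟩

/-- The flag in `var 20` is set but never cleared, so consecutive verifications compute a
disjunction. -/
theorem reaches_verify {a n : ℕ} {s : State Ω} (h1 : s.var 1 = 1) (h2 : s.var 2 = 0)
    (h3 : s.var 3 = n + 1) :
    Reaches src s (verify a) ((n + 1) * (44 * (n + 1) + 8) + 11) fun s' =>
      SameExcept verifyVars s s' ∧
      (EmbedsFirst n (s.arr 2) (s.arr a 0) → s'.var 20 = 1) ∧
      (¬ EmbedsFirst n (s.arr 2) (s.arr a 0) → s'.var 20 = s.var 20) := by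
  set Γ := s.arr 2 with hΓ
  set r := s.arr a 0 with hr
  let J : State Ω → Prop := fun s' => SameExcept verifyVars s s' ∧ s'.var 20 = s.var 20
  let I : ℕ → State Ω → Prop := fun m s' => s'.var 8 = m ∧ m ≤ n + 1 ∧ J s' ∧
    (s'.var 21 = 0 ↔ ∀ u v, m ≤ u → u < n + 1 → v < n + 1 → PairOk n Γ r u v)
  have hstart : Reaches src s (block [.const 21 0, .add 8 3 2]) 5 (I (n + 1)) := by
    refine reaches_block (by simp [Prog.IsBasic])
      ⟨by simp [State.effect, h3, h2], le_rfl, ⟨⟨?_, ?_, fun x hx => ?_⟩, ?_⟩, ?_⟩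
    · simp [State.effect]
    · simp [State.effect]
    · simp only [verifyVars, List.mem_cons, List.not_mem_nil, or_false, not_or] at hx
      simp [State.effect, hx]
    · simp [State.effect]
    · simp only [State.effect, List.foldl, State.setVar_var, if_true, if_false, Nat.reduceEqDiff,
        true_iff]
      exact fun u v hu hu' => absurd hu' (by omega)
  have hloop : ∀ s', I (n + 1) s' → Reaches src s' (.loop 8 (.seq (block [.sub 8 8 1, .add 9 3 2])
      (.loop 9 (block (compareStep a))))) ((n + 1) * (44 * (n + 1) + 7 + 1) + 1) (I 0) := by
    refine Reaches.loop I (fun s' h => h.1) ?_ _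
    rintro m s' ⟨h8, hm, ⟨⟨harr, hsam, hvar⟩, h20⟩, h21⟩
    have e1 : s'.var 1 = 1 := (hvar 1 (by decide)).trans h1
    have e2 : s'.var 2 = 0 := (hvar 2 (by decide)).trans h2
    have e3 : s'.var 3 = n + 1 := (hvar 3 (by decide)).trans h3
    have hblock : Reaches src s' (block [.sub 8 8 1, .add 9 3 2]) 5 fun s'' =>
        s''.var 8 = m ∧ s''.var 9 = n + 1 ∧ J s'' ∧ s''.var 21 = s'.var 21 := by
      refine reaches_block (by simp [Prog.IsBasic]) ⟨?_, ?_, ⟨⟨?_, ?_, fun x hx => ?_⟩, ?_⟩, ?_⟩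
      · simp [State.effect, h8, e1]
      · simp [State.effect, e3, e2]
      · simp [State.effect, harr]
      · simp [State.effect, hsam]
      · have := hvar x hx
        simp only [verifyVars, List.mem_cons, List.not_mem_nil, or_false, not_or] at hx
        simp [State.effect, hx, this]
      · simp [State.effect, h20]
      · simp [State.effect]
    refine ⟨by omega, (hblock.seq (t' := (n + 1) * (43 + 1) + 1) (R := I m)
      fun s'' ⟨k8, k9, kJ, k21⟩ => ?_).mono (by omega) fun _ h => h⟩
    refine (reaches_compareLoop (src := src) (a := a) h1 h2 h3 kJ.1 k9).mono le_rfl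
      fun s₃ ⟨g8, g20, gJ, g21⟩ => ⟨g8.trans k8, by omega, ⟨gJ, g20.trans kJ.2⟩, ?_⟩
    rw [g21, k21, h21, k8]
    constructor
    · rintro ⟨h, h'⟩ u v hu hu' hv
      by_cases hum : u = m
      · exact hum ▸ h' v hv
      · exact h u v (by omega) hu' hv
    · exact fun h => ⟨fun u v hu => h u v (by omega), fun v hv => h m v le_rfl (by omega) hv⟩
  refine (hstart.seq fun s₁ hs₁ => (hloop s₁ hs₁).seq (t' := 2) fun s₂ hs₂ => ?_).mono ?_
    fun _ h => h
  · obtain ⟨-, -, ⟨⟨harr, hsam, hvar⟩, h20⟩, h21⟩ := hs₂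
    have hiff : s₂.var 21 = 0 ↔ EmbedsFirst n Γ r := h21.trans
      ⟨fun h u v hu hv => h u v (Nat.zero_le u) hu hv, fun h u v _ hu hv => h u v hu hv⟩
    refine Reaches.ite (t := 1) (fun hne => ?_) fun heq => ?_
    · exact ⟨s₂, exec_basic fun _ => rfl, ⟨harr, hsam, hvar⟩,
        fun h => absurd (hiff.2 h) hne, fun _ => h20⟩
    · refine ⟨s₂.setVar 20 1, exec_basic fun _ => rfl, ⟨harr, hsam, fun x hx => ?_⟩,
        fun _ => by simp, fun h => absurd (hiff.1 heq) h⟩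
      have hne : x ≠ 20 := fun hc => hx (hc ▸ by decide)
      rw [State.setVar_var, if_neg hne]
      exact hvar x hx
  · rw [show 44 * (n + 1) + 7 + 1 = 44 * (n + 1) + 8 by omega]
    omega

end InvGen

namespace InvGen

open Equiv

/-! ### The program for graph isomorphism -/

/-- Embedding a memory also carries over its sample record; the second copy of the generator needs
this record to be still empty. -/
theorem samples_eq_of_drawFree {Ω : Type} {src : Source Ω} (t : ℕ) (c c' : Config Ω)
    (hc : ∀ p ∈ c.todo, p.DrawFree) (h : c' ∈ (runFrom src t c).support) :
    c'.state.samples = c.state.samples := by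
  induction t generalizing c with
  | zero =>
    rw [runFrom, PMF.mem_support_pure_iff] at h
    rw [h]
  | succ t ih =>
    rw [runFrom, PMF.mem_support_bind_iff] at h
    obtain ⟨c₁, h₁, h₂⟩ := h
    suffices hstep : c₁.state.samples = c.state.samples ∧ ∀ p ∈ c₁.todo, p.DrawFree from
      (ih c₁ hstep.2 h₂).trans hstep.1
    obtain ⟨l, s⟩ := c
    cases l with
    | nil =>
      rw [step, PMF.mem_support_pure_iff] at h₁
      rw [h₁]
      exact ⟨rfl, hc⟩
    | cons p l =>
      have hp : p.DrawFree := hc p (by simp)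
      have hl : ∀ q ∈ l, q.DrawFree := fun q hq => hc q (by simp [hq])
      cases p
      case draw => exact hp.elim
      case flip x =>
        rw [step, PMF.support_map] at h₁
        obtain ⟨b, -, rfl⟩ := h₁
        exact ⟨rfl, hl⟩
      case seq p q =>
        rw [step, PMF.mem_support_pure_iff] at h₁
        subst h₁
        exact ⟨rfl, by simpa using ⟨hp.1, hp.2, hl⟩⟩
      case ite x p q =>
        rw [step, PMF.mem_support_pure_iff] at h₁
        subst h₁
        refine ⟨rfl, ?_⟩
        split_ifs
        · simpa using ⟨hp.1, hl⟩
        · simpa using ⟨hp.2, hl⟩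
      case loop x p =>
        rw [step, PMF.mem_support_pure_iff] at h₁
        subst h₁
        refine ⟨rfl, ?_⟩
        split_ifs
        · simpa using ⟨hp, hp, hl⟩
        · exact hl
      all_goals
        rw [step, PMF.mem_support_pure_iff] at h₁
        subst h₁
        exact ⟨rfl, hl⟩

/-- The places of the memory of the copy `i` of a program. -/
def copyPlace (i x : ℕ) : ℕ := 100 + 2 * x + i

theorem copyPlace_injective (i : ℕ) : Function.Injective (copyPlace i) := fun x y h => by
  simp only [copyPlace] at h
  omega

/-- Write the gadget and its size. -/
def prepare : Prog :=
  .seq (repeatProg mulStep 6) (.seq fillGadget (block [.add 100 4 2, .add 101 4 2]))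

/-- Generate two automorphisms and look whether one of them proves an isomorphism. -/
def attempts (A : Prog) : Prog :=
  .seq (A.rename (copyPlace 0))
    (.seq (verify 102) (.seq (A.rename (copyPlace 1)) (.seq (verify 103) (.add 0 20 2))))

/-- Decide graph isomorphism by means of the program `A`, which generates automorphisms. -/
def isoProg (A : Prog) : Prog :=
  .seq (block [.const 1 1, .sub 5 0 1, .add 3 0 1, .const 4 1])
    (.ite 5 (.seq prepare (attempts A)) (.const 0 1))

theorem drawFree_isoProg {A : Prog} (hA : A.DrawFree) : (isoProg A).DrawFree := by
  simp [isoProg, prepare, attempts, Prog.DrawFree, block, repeatProg, mulStep, fillGadget, fillCone, storeAll,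
    verify, compareStep, hA.rename]

theorem State.embed_eq_self {f : ℕ → ℕ} (hf : f.Injective) {s s' : State Unit}
    (hv : ∀ x, s.var (f x) = s'.var x) (ha : ∀ a, s.arr (f a) = s'.arr a)
    (hs : s.samples = s'.samples) : State.embed f s s' = s := by
  have h1 : Function.extend f s'.var s.var = s.var := by
    funext y
    by_cases hy : ∃ x, f x = y
    · obtain ⟨x, rfl⟩ := hy
      rw [hf.extend_apply, hv]
    · rw [Function.extend_apply' _ _ _ hy]
  have h2 : Function.extend f s'.arr s.arr = s.arr := by
    funext y
    by_cases hy : ∃ x, f x = y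
    · obtain ⟨x, rfl⟩ := hy
      rw [hf.extend_apply, ha]
    · rw [Function.extend_apply' _ _ _ hy]
  rw [State.embed, h1, h2, ← hs]

theorem State.embed_var_of_ne {f : ℕ → ℕ} {s s' : State Unit} {y : ℕ} (hy : ∀ x, f x ≠ y) :
    (State.embed f s s').var y = s.var y :=
  Function.extend_apply' _ _ _ fun ⟨x, hx⟩ => hy x hx

theorem State.embed_arr_of_ne {f : ℕ → ℕ} {s s' : State Unit} {y : ℕ} (hy : ∀ x, f x ≠ y) :
    (State.embed f s s').arr y = s.arr y :=
  Function.extend_apply' _ _ _ fun ⟨x, hx⟩ => hy x hx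

/-- The copy `i` finds the graph `Γ` as its input. -/
structure CopyReady {N : ℕ} (Γ : SimpleGraph (Fin N)) (i : ℕ) (s : State Unit) : Prop where
  var : ∀ x, s.var (copyPlace i x) = (graphInput Γ).var x
  arr : ∀ a, s.arr (copyPlace i a) = (graphInput Γ).arr a

/-- The constants and the graph that the verification needs. -/
structure VerifyReady (n : ℕ) {N : ℕ} (Γ : SimpleGraph (Fin N)) (s : State Unit) : Prop where
  v1 : s.var 1 = 1
  v2 : s.var 2 = 0
  v3 : s.var 3 = n + 1
  a2 : s.arr 2 = adjArray Γ

/-- The memory already contains the input at the places of the copy, so embedding the input changes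
nothing and the renaming theorem applies. -/
theorem exec_copy {N : ℕ} {Γ : SimpleGraph (Fin N)} {i t : ℕ} {A : Prog} {s : State Unit}
    (hA : ∀ c ∈ (run noSource A (graphInput Γ) t).support, c.Halted)
    (hs : CopyReady Γ i s) (hsam : s.samples = []) :
    Exec noSource [A.rename (copyPlace i)] s t
      ((run noSource A (graphInput Γ) t).map fun c => State.embed (copyPlace i) s c.state) := by
  have h := exec_rename (src := noSource) (copyPlace_injective i) s (graphInput Γ) hA
  rwa [State.embed_eq_self (copyPlace_injective i) hs.var hs.arr hsam] at h

/-- The copies work only at places from 100 on, above everything that the verification relies on. -/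
theorem VerifyReady.embed {n N : ℕ} {Γ : SimpleGraph (Fin N)} {s : State Unit}
    (h : VerifyReady n Γ s) (i : ℕ) (s' : State Unit) :
    VerifyReady n Γ (State.embed (copyPlace i) s s') := by
  have hne : ∀ y < 100, ∀ x, copyPlace i x ≠ y := fun y hy x => by
    simp only [copyPlace]; omega
  exact ⟨by rw [State.embed_var_of_ne (hne 1 (by norm_num)), h.v1],
    by rw [State.embed_var_of_ne (hne 2 (by norm_num)), h.v2],
    by rw [State.embed_var_of_ne (hne 3 (by norm_num)), h.v3],
    by rw [State.embed_arr_of_ne (hne 2 (by norm_num)), h.a2]⟩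

theorem reaches_verify_copy {n N : ℕ} {Γ : SimpleGraph (Fin N)} {s : State Unit}
    (h : VerifyReady n Γ s) (i : ℕ) (c : State Unit) :
    Reaches noSource (State.embed (copyPlace i) s c) (verify (102 + i))
      ((n + 1) * (44 * (n + 1) + 8) + 11) fun s' =>
      SameExcept verifyVars (State.embed (copyPlace i) s c) s' ∧
      (EmbedsFirst n (adjArray Γ) (c.arr 1 0) → s'.var 20 = 1) ∧
      (¬ EmbedsFirst n (adjArray Γ) (c.arr 1 0) → s'.var 20 = s.var 20) := by
  have he := h.embed i c
  have harr : (State.embed (copyPlace i) s c).arr (102 + i) = c.arr 1 := by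
    have := State.embed_arr (copyPlace_injective i) s c 1
    rwa [copyPlace, show 100 + 2 * 1 + i = 102 + i by omega] at this
  have h20 : (State.embed (copyPlace i) s c).var 20 = s.var 20 :=
    State.embed_var_of_ne fun x => by simp only [copyPlace]; omega
  have := reaches_verify (src := noSource) (a := 102 + i) he.v1 he.v2 he.v3
  rwa [he.a2, harr, h20] at this

/-- Six is the least exponent that works at n = 2, where 39 vertices are needed. -/
theorem le_pow_six {n : ℕ} (hn : 2 ≤ n) : 13 * (n + 1) ≤ n ^ 6 := by
  have : 2 ^ 5 ≤ n ^ 5 := Nat.pow_le_pow_left hn 5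
  have h : 2 ^ 5 * n ≤ n ^ 5 * n := Nat.mul_le_mul_right n this
  rw [← pow_succ] at h
  change 2 ^ 5 * n ≤ n ^ 6 at h
  omega

theorem reaches_prepare {n : ℕ} (hn : 2 ≤ n) (G₁ G₂ : SimpleGraph (Fin n)) {s : State Unit}
    (h0 : s.var 0 = n) (h1 : s.var 1 = 1) (h3 : s.var 3 = n + 1) (h4 : s.var 4 = 1)
    (hz : ∀ x, x ∉ [0, 1, 3, 4, 5] → s.var x = 0) (ha : s.arr = (graphPairInput G₁ G₂).arr)
    (hs : s.samples = []) :
    Reaches noSource s prepare (13 * (n * (14 * n + 22)) + 36 * n + 280) fun s' =>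
      VerifyReady n (gadget (le_pow_six hn) (pairFamily G₁ G₂)) s' ∧
      CopyReady (gadget (le_pow_six hn) (pairFamily G₁ G₂)) 0 s' ∧
      CopyReady (gadget (le_pow_six hn) (pairFamily G₁ G₂)) 1 s' ∧ s'.var 20 = 0 ∧
      s'.samples = [] := by
  have h2 : s.var 2 = 0 := hz 2 (by decide)
  refine ((reaches_repeat_mulStep 6 h1 h2).seq
    (t' := 13 * (n * (14 * n + 22)) + 200 + 5 + 1) fun s₁ ⟨k4, karr, ksam, kvar⟩ => ?_).mono
    (by rw [h0]; omega) fun _ h => h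
  have e0 : s₁.var 0 = n := (kvar 0 (by decide)).trans h0
  have e1 : s₁.var 1 = 1 := (kvar 1 (by decide)).trans h1
  have e2 : s₁.var 2 = 0 := (kvar 2 (by decide)).trans h2
  have e3 : s₁.var 3 = n + 1 := (kvar 3 (by decide)).trans h3
  have harr : s₁.arr = (graphPairInput G₁ G₂).arr := karr.trans ha
  rw [h0, h4, mul_one] at k4
  refine Reaches.seq (t := 13 * (n * (14 * n + 22)) + 200) (t' := 5)
    (reaches_fillGadget (src := noSource) (le_pow_six hn) (G₁ := G₁) (G₂ := G₂) e0 e1 e2 e3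
      (by rw [harr]; rfl) (by rw [harr]; rfl) ?_) fun s₂ ⟨hf, hb⟩ => ?_
  · intro b hb
    rw [harr]
    simp only [List.mem_cons, List.not_mem_nil, or_false] at hb
    rcases hb with rfl | rfl | rfl <;> rfl
  refine reaches_block (by simp [Prog.IsBasic]) ?_
  have g4 : s₂.var 4 = n ^ 6 := (hf.var 4 (by decide)).trans k4
  have g2 : s₂.var 2 = 0 := (hf.var 2 (by decide)).trans e2
  -- The preparation touches only small variables, so the copies find zeros wherever their input
  -- prescribes them.
  have hbig : ∀ x, 20 ≤ x → s₂.var x = 0 := fun x hx => by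
    rw [hf.var x (by simp [gadgetVars, fillVars]; omega), kvar x (by simp; omega),
      hz x (by simp; omega)]
  have hcopy : ∀ i, i = 0 ∨ i = 1 → CopyReady (gadget (le_pow_six hn) (pairFamily G₁ G₂)) i
      ([Prog.add 100 4 2, .add 101 4 2].foldl State.effect s₂) := by
    intro i hi
    refine ⟨fun x => ?_, fun a => ?_⟩
    · rcases Nat.eq_zero_or_pos x with rfl | hx
      · rcases hi with rfl | rfl <;>
          simp [copyPlace, State.effect, g4, g2, graphInput, State.init]
      · have hx1 : copyPlace i x ≠ 100 := by simp only [copyPlace]; omega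
        have hx2 : copyPlace i x ≠ 101 := by simp only [copyPlace]; omega
        have hx3 := hbig (copyPlace i x) (by simp only [copyPlace]; omega)
        simp [State.effect, hx1, hx2, hx3, graphInput, State.init, hx.ne']
    · change s₂.arr (copyPlace i a) = _
      rcases Nat.eq_zero_or_pos a with rfl | hpos
      · rw [hb (copyPlace i 0) (by rcases hi with rfl | rfl <;> decide)]
        rfl
      · have hne : copyPlace i a ∉ [2, 100, 101] := by
          simp only [copyPlace, List.mem_cons, List.not_mem_nil, or_false, not_or]
          omega
        have hne0 : copyPlace i a ≠ 0 := by simp only [copyPlace]; omega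
        have hne1 : copyPlace i a ≠ 1 := by simp only [copyPlace]; omega
        rw [hf.arr _ hne, harr]
        simp [graphPairInput, graphInput, State.init, hne0, hne1, hpos.ne']
  refine ⟨⟨?_, ?_, ?_, ?_⟩, hcopy 0 (Or.inl rfl), hcopy 1 (Or.inr rfl), ?_, ?_⟩
  · simp [State.effect, hf.var 1 (by decide), e1]
  · simp [State.effect, g2]
  · simp [State.effect, hf.var 3 (by decide), e3]
  · exact hb 2 (by decide)
  · simp [State.effect, hbig 20 le_rfl]
  · simp [State.effect, hf.samples, ksam, hs]

theorem exec_pure_seq {Ω : Type} {src : Source Ω} {p q : Prog} {s s' : State Ω} {t t' : ℕ}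
    {μ : PMF (State Ω)} (h : Exec src [p] s t (PMF.pure s')) (h' : Exec src [q] s' t' μ) :
    Exec src [.seq p q] s (t + t' + 1) μ := by
  have := exec_seq (κ := fun _ => μ) h fun s₁ hs₁ => by
    rw [PMF.mem_support_pure_iff] at hs₁
    rw [hs₁]
    exact h'
  rwa [PMF.pure_bind] at this

/-- All randomness is in the two runs of `A`, whose outcomes `c` and `d` are independent; everything
else is a function `F` of them. -/
theorem exec_attempts {n N : ℕ} {Γ : SimpleGraph (Fin N)} {t : ℕ} {A : Prog} {s : State Unit}
    (hdf : A.DrawFree) (hA : ∀ c ∈ (run noSource A (graphInput Γ) t).support, c.Halted)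
    (hv : VerifyReady n Γ s) (h0 : CopyReady Γ 0 s) (h1 : CopyReady Γ 1 s) (h20 : s.var 20 = 0)
    (hsam : s.samples = []) :
    ∃ F : Config Unit → Config Unit → State Unit,
      Exec noSource [attempts A] s (2 * t + 2 * ((n + 1) * (44 * (n + 1) + 8)) + 30)
        ((run noSource A (graphInput Γ) t).bind fun c =>
          (run noSource A (graphInput Γ) t).bind fun d => PMF.pure (F c d)) ∧
      ∀ c d, (EmbedsFirst n (adjArray Γ) (c.state.arr 1 0) ∨
          EmbedsFirst n (adjArray Γ) (d.state.arr 1 0) → (F c d).var 0 = 1) ∧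
        (¬ (EmbedsFirst n (adjArray Γ) (c.state.arr 1 0) ∨
          EmbedsFirst n (adjArray Γ) (d.state.arr 1 0)) → (F c d).var 0 = 0) := by
  set μ := run noSource A (graphInput Γ) t with hμ
  set V := (n + 1) * (44 * (n + 1) + 8) with hV
  choose s₂ hs₂ hsame₂ hpos₂ hneg₂ using fun c : Config Unit =>
    reaches_verify_copy hv 0 c.state
  have hready : ∀ c, VerifyReady n Γ (s₂ c) := fun c => by
    have he := hv.embed 0 c.state
    obtain ⟨harr, -, hvar⟩ := hsame₂ c
    exact ⟨(hvar 1 (by decide)).trans he.v1, (hvar 2 (by decide)).trans he.v2,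
      (hvar 3 (by decide)).trans he.v3, by rw [harr]; exact he.a2⟩
  -- One copy uses even places, the other odd ones, so the first run leaves the input of the second
  -- intact.
  have hne : ∀ x y, copyPlace 0 x ≠ copyPlace 1 y := fun x y => by
    simp only [copyPlace]; omega
  have hcopy : ∀ c, CopyReady Γ 1 (s₂ c) := fun c => by
    obtain ⟨harr, -, hvar⟩ := hsame₂ c
    refine ⟨fun x => ?_, fun a => ?_⟩
    · rw [hvar _ (by simp [copyPlace, verifyVars]; omega), State.embed_var_of_ne
        fun y => hne y x, h1.var]
    · rw [harr, State.embed_arr_of_ne fun y => hne y a, h1.arr]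
  have hlast : ∀ c d : Config Unit, Reaches noSource (State.embed (copyPlace 1) (s₂ c) d.state)
      (.seq (verify 103) (.add 0 20 2)) (V + 11 + 1 + 1) fun s' =>
        (EmbedsFirst n (adjArray Γ) (d.state.arr 1 0) → s'.var 0 = 1) ∧
        (¬ EmbedsFirst n (adjArray Γ) (d.state.arr 1 0) → s'.var 0 = (s₂ c).var 20) := by
    intro c d
    refine Reaches.seq (t := V + 11) (t' := 1) (reaches_verify_copy (hready c) 1 d.state) ?_
    rintro s' ⟨⟨-, -, hvar⟩, hp, hn⟩
    have e2 : s'.var 2 = 0 := (hvar 2 (by decide)).trans ((hready c).embed 1 d.state).v2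
    refine ⟨_, exec_basic fun _ => rfl, fun h => ?_, fun h => ?_⟩
    · simp [e2, hp h]
    · simp [e2, hn h]
  choose F hF hFpos hFneg using hlast
  refine ⟨F, ?_, fun c d => ⟨?_, ?_⟩⟩
  · have hsecond : ∀ c ∈ μ.support, Exec noSource [.seq (A.rename (copyPlace 1))
        (.seq (verify 103) (.add 0 20 2))] (s₂ c) (t + (V + 11 + 1 + 1) + 1)
        (μ.bind fun d => PMF.pure (F c d)) := fun c hc => by
      have hsc : (s₂ c).samples = [] := by
        rw [(hsame₂ c).2.1]
        exact samples_eq_of_drawFree t _ c (by simpa using hdf) hc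
      exact exec_seq_map (exec_copy hA (hcopy c) hsc) fun d _ => hF c d
    have hall := exec_seq_map (exec_copy hA h0 hsam) fun c hc =>
      exec_pure_seq (q := .seq (A.rename (copyPlace 1)) (.seq (verify 103) (.add 0 20 2)))
        (hs₂ c) (hsecond c hc)
    exact hall.mono (by omega)
  · by_cases hd : EmbedsFirst n (adjArray Γ) (d.state.arr 1 0)
    · exact fun _ => hFpos c d hd
    · rintro (hc | hd')
      · rw [hFneg c d hd, hpos₂ c hc]
      · exact absurd hd' hd
  · intro h
    rw [not_or] at h
    rw [hFneg c d h.2, hneg₂ c h.1, h20]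

theorem exec_isoProg {n : ℕ} (hn : 2 ≤ n) {G₁ G₂ : SimpleGraph (Fin n)}
    {Γ : SimpleGraph (Fin (n ^ 6))} (hΓ : Γ = gadget (le_pow_six hn) (pairFamily G₁ G₂)) {t : ℕ}
    {A : Prog} (hdf : A.DrawFree)
    (hA : ∀ c ∈ (run noSource A (graphInput Γ) t).support, c.Halted) :
    ∃ F : Config Unit → Config Unit → State Unit,
      Exec noSource [isoProg A] (graphPairInput G₁ G₂)
        (2 * t + 2 * ((n + 1) * (44 * (n + 1) + 8)) + 13 * (n * (14 * n + 22)) + 36 * n + 330)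
        ((run noSource A (graphInput Γ) t).bind fun c =>
          (run noSource A (graphInput Γ) t).bind fun d => PMF.pure (F c d)) ∧
      ∀ c d, (EmbedsFirst n (adjArray Γ) (c.state.arr 1 0) ∨
          EmbedsFirst n (adjArray Γ) (d.state.arr 1 0) → (F c d).var 0 = 1) ∧
        (¬ (EmbedsFirst n (adjArray Γ) (c.state.arr 1 0) ∨
          EmbedsFirst n (adjArray Γ) (d.state.arr 1 0)) → (F c d).var 0 = 0) := by
  subst hΓ
  obtain ⟨s₁, hs₁, h0, h1, h3, h4, h5, hz, ha, hs⟩ : Reaches noSource (graphPairInput G₁ G₂)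
      (block [.const 1 1, .sub 5 0 1, .add 3 0 1, .const 4 1]) 9 fun s =>
        s.var 0 = n ∧ s.var 1 = 1 ∧ s.var 3 = n + 1 ∧ s.var 4 = 1 ∧ s.var 5 = n - 1 ∧
        (∀ x, x ∉ [0, 1, 3, 4, 5] → s.var x = 0) ∧ s.arr = (graphPairInput G₁ G₂).arr ∧
        s.samples = [] := by
    refine reaches_block (by simp [Prog.IsBasic]) ⟨?_, ?_, ?_, ?_, ?_, fun x hx => ?_, ?_, ?_⟩
    · simp [State.effect, graphPairInput, State.init]
    · simp [State.effect]
    · simp [State.effect, graphPairInput, State.init]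
    · simp [State.effect]
    · simp [State.effect, graphPairInput, State.init]
    · simp only [List.mem_cons, List.not_mem_nil, or_false, not_or] at hx
      simp [State.effect, graphPairInput, State.init, hx]
    · simp [State.effect]
    · simp [State.effect, graphPairInput, State.init]
  obtain ⟨s₂, hs₂, hv, hc0, hc1, h20, hsam⟩ := reaches_prepare hn G₁ G₂ h0 h1 h3 h4 hz ha hs
  obtain ⟨F, hF, hval⟩ := exec_attempts hdf hA hv hc0 hc1 h20 hsam
  refine ⟨F, ?_, hval⟩
  have hmain := exec_pure_seq hs₂ hF
  have hite := exec_ite (x := 5) (q := .const 0 1) (by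
    rw [if_pos (show s₁.var 5 ≠ 0 by omega)]
    exact hmain)
  exact (exec_pure_seq hs₁ hite).mono (by omega)

/-- On fewer than two vertices any two graphs are isomorphic, and n^6 vertices would not hold the
gadget. -/
theorem exec_isoProg_small {n : ℕ} (hn : n < 2) (G₁ G₂ : SimpleGraph (Fin n)) (A : Prog) :
    ∃ s, Exec noSource [isoProg A] (graphPairInput G₁ G₂) 12 (PMF.pure s) ∧ s.var 0 = 1 := by
  have hstart : Reaches noSource (graphPairInput G₁ G₂)
      (block [.const 1 1, .sub 5 0 1, .add 3 0 1, .const 4 1]) 9 fun s => s.var 5 = 0 := by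
    refine reaches_block (by simp [Prog.IsBasic]) ?_
    simp [State.effect, graphPairInput, State.init]
    omega
  refine (hstart.seq (t' := 2) (q := .ite 5 (.seq prepare (attempts A)) (.const 0 1))
    (R := fun s => s.var 0 = 1) fun s hs => Reaches.ite (t := 1) (fun h => absurd hs h) fun _ =>
      ⟨_, exec_basic fun _ => rfl, by simp⟩)

end InvGen

namespace InvGen

open Equiv

/-! ### Forward generation -/

theorem prob_univ_eq_one {α : Type} (μ : PMF α) : prob μ Set.univ = 1 := by
  rw [prob, (PMF.toOuterMeasure_apply_eq_one_iff _ _).2 (Set.subset_univ _), ENNReal.toReal_one]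

theorem prob_compl {α : Type} (μ : PMF α) (E : Set α) : prob μ Eᶜ = 1 - prob μ E := by
  have h : μ.toOuterMeasure E + μ.toOuterMeasure Eᶜ = 1 := by
    rw [PMF.toOuterMeasure_apply, PMF.toOuterMeasure_apply, ← ENNReal.tsum_add, ← μ.tsum_coe]
    refine tsum_congr fun a => ?_
    by_cases ha : a ∈ E <;> simp [ha]
  rw [eq_sub_iff_add_eq, add_comm, prob, prob,
    ← ENNReal.toReal_add (toOuterMeasure_ne_top μ _) (toOuterMeasure_ne_top μ _), h,
    ENNReal.toReal_one]

/-- The total variation distance bounds the difference of the probabilities of an event. -/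
theorem prob_le_add_tvDist {α : Type} [Fintype α] (μ ν : PMF α) (E : Set α) :
    prob ν E ≤ prob μ E + tvDist μ ν := by
  classical
  rw [prob_eq_sum, prob_eq_sum, tvDist]
  have hμ := sum_toReal_eq_one μ
  have hν := sum_toReal_eq_one ν
  have h : ∀ a, 2 * ((if a ∈ E then (ν a).toReal else 0) - (if a ∈ E then (μ a).toReal else 0)) ≤
      |(μ a).toReal - (ν a).toReal| + ((ν a).toReal - (μ a).toReal) := fun a => by
    have h1 := le_abs_self ((μ a).toReal - (ν a).toReal)
    have h2 := neg_le_abs ((μ a).toReal - (ν a).toReal)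
    split_ifs <;> linarith
  have hsum := Finset.sum_le_sum fun a (_ : a ∈ (Finset.univ : Finset α)) => h a
  rw [← Finset.mul_sum, Finset.sum_sub_distrib, Finset.sum_add_distrib,
    Finset.sum_sub_distrib] at hsum
  linarith

theorem prob_sub_le_of_tvDist {α β : Type} [Fintype β] {μ : PMF α} {f : α → β} {ν : PMF β}
    {η : ℝ} (h : tvDist (μ.map f) ν ≤ η) (E : Set β) : prob ν E - η ≤ prob μ (f ⁻¹' E) := by
  have h' := prob_le_add_tvDist (μ.map f) ν E
  rw [prob_map] at h'
  linarith

/-- Two independent runs both avoid an event. -/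
theorem prob_bind_bind_le {α β : Type} {μ : PMF α} {F : α → α → β} {P : α → Prop} {E : Set β}
    (h : ∀ c d, F c d ∈ E → ¬ P c ∧ ¬ P d) :
    prob (μ.bind fun c => μ.bind fun d => PMF.pure (F c d)) E ≤ prob μ {c | ¬ P c} ^ 2 := by
  classical
  have hin : ∀ c, (μ.bind fun d => PMF.pure (F c d)).toOuterMeasure E ≤
      if P c then 0 else μ.toOuterMeasure {c | ¬ P c} := fun c => by
    have hmap : (μ.bind fun d => PMF.pure (F c d)) = μ.map (F c) := by
      rw [← PMF.bind_pure_comp]; rfl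
    rw [hmap, PMF.toOuterMeasure_map_apply]
    split_ifs with hc
    · rw [show F c ⁻¹' E = ∅ from Set.eq_empty_of_forall_notMem fun d hd => (h c d hd).1 hc]
      simp
    · exact μ.toOuterMeasure.mono fun d hd => (h c d hd).2
  have hle : (μ.bind fun c => μ.bind fun d => PMF.pure (F c d)).toOuterMeasure E ≤
      μ.toOuterMeasure {c | ¬ P c} * μ.toOuterMeasure {c | ¬ P c} := by
    rw [PMF.toOuterMeasure_bind_apply]
    nth_rewrite 1 [PMF.toOuterMeasure_apply]
    rw [← ENNReal.tsum_mul_right]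
    refine ENNReal.tsum_le_tsum fun c => ?_
    refine (mul_le_mul_right (hin c) _).trans ?_
    by_cases hc : P c <;> simp [hc]
  rw [sq, prob, prob, ← ENNReal.toReal_mul]
  exact ENNReal.toReal_mono (ENNReal.mul_ne_top (toOuterMeasure_ne_top _ _)
    (toOuterMeasure_ne_top _ _)) hle

open Classical in
/-- A uniform automorphism of the gadget is likely to prove an isomorphism. -/
theorem prob_uniformAut_moves {n N : ℕ} {hN : 13 * (n + 1) ≤ N} {G₁ G₂ : SimpleGraph (Fin n)}
    (e : G₁ ≃g G₂) :
    12 / 13 ≤ prob ((uniformAut (gadget hN (pairFamily G₁ G₂))).map some)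
      {o | ∃ σ, o = some σ ∧ σ ∈ Aut (gadget hN (pairFamily G₁ G₂)) ∧
        ¬ (σ (apex hN) : ℕ) < n + 1} := by
  have huni : uniformAut (gadget hN (pairFamily G₁ G₂)) =
      (PMF.uniformOfFintype (Aut (gadget hN (pairFamily G₁ G₂)))).map Subtype.val := by
    unfold uniformAut
    congr!
  rw [prob_map, huni, prob_map]
  have hset : (Subtype.val ⁻¹' (some ⁻¹' {o | ∃ σ, o = some σ ∧
      σ ∈ Aut (gadget hN (pairFamily G₁ G₂)) ∧ ¬ (σ (apex hN) : ℕ) < n + 1}) :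
      Set (Aut (gadget hN (pairFamily G₁ G₂)))) =
      {σ : Aut (gadget hN (pairFamily G₁ G₂)) |
        ((σ : Perm (Fin N)) (apex hN) : ℕ) < n + 1}ᶜ := by
    ext σ
    constructor
    · rintro ⟨τ, h, -, hτ⟩
      rw [Option.some.injEq] at h
      rw [← h] at hτ
      exact hτ
    · exact fun h => ⟨σ, rfl, σ.2, h⟩
  rw [hset, prob_compl, prob_uniformOfFintype]
  have h := card_fixing_le (hN := hN) e
  have hpos : (0 : ℝ) < Fintype.card (Aut (gadget hN (pairFamily G₁ G₂))) := by
    exact_mod_cast Fintype.card_pos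
  have h' : 13 * ((Finset.univ.filter fun σ : Aut (gadget hN (pairFamily G₁ G₂)) =>
      ((σ : Perm (Fin N)) (apex hN) : ℕ) < n + 1).card : ℝ) ≤
        Fintype.card (Aut (gadget hN (pairFamily G₁ G₂))) := by exact_mod_cast h
  have : ((Finset.univ.filter fun σ : Aut (gadget hN (pairFamily G₁ G₂)) =>
      σ ∈ {σ : Aut (gadget hN (pairFamily G₁ G₂)) |
        ((σ : Perm (Fin N)) (apex hN) : ℕ) < n + 1}).card : ℝ) /
        Fintype.card (Aut (gadget hN (pairFamily G₁ G₂))) ≤ 1 / 13 := by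
    rw [div_le_iff₀ hpos]
    simp only [Set.mem_ofPred_eq]
    linarith
  linarith

/-- A program that generates automorphisms needs time to write them. -/
theorem le_time_of_generatesAut {A : Prog} {t : ℕ → ℕ} (hA : GeneratesAut A t (1 / 2)) (N : ℕ) :
    N ≤ t N + 1 := by
  rcases Nat.eq_zero_or_pos N with rfl | hpos
  · exact Nat.zero_le _
  obtain ⟨-, htv⟩ := hA.2 N ⊥
  have h1 : prob ((uniformAut (⊥ : SimpleGraph (Fin N))).map some) {o | o ≠ none} = 1 := by
    rw [prob_map, ← prob_univ_eq_one (uniformAut (⊥ : SimpleGraph (Fin N)))]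
    congr 1
    ext σ
    simp
  have h2 := prob_sub_le_of_tvDist htv {o | o ≠ none}
  rw [h1] at h2
  have hex : ∃ c ∈ (run noSource A (graphInput (⊥ : SimpleGraph (Fin N))) (t N)).support,
      readPerm N (c.state.arr 1 0) ≠ none := by
    by_contra hno
    push Not at hno
    have hz : prob (run noSource A (graphInput (⊥ : SimpleGraph (Fin N))) (t N))
        ((fun c => readPerm N (c.state.arr 1 0)) ⁻¹' {o | o ≠ none}) = 0 := by
      rw [prob, (PMF.toOuterMeasure_apply_eq_zero_iff _ _).2, ENNReal.toReal_zero]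
      exact Set.disjoint_left.2 fun c hc hc' => hc' (hno c hc)
    rw [hz] at h2
    norm_num at h2
  obtain ⟨c, hc, hsome⟩ := hex
  obtain ⟨σ, hσ⟩ := Option.ne_none_iff_exists'.1 hsome
  obtain ⟨J, hJ, hJ'⟩ := exists_nonzero_finset (t N) _ c hc
  -- One-line notation has a single zero entry; the other N - 1 entries had to be written, starting
  -- from a row of zeros.
  have hsub : Finset.range N ⊆ insert (σ.symm ⟨0, hpos⟩ : ℕ) J := by
    intro v hv
    rw [Finset.mem_range] at hv
    rw [Finset.mem_insert, or_iff_not_imp_left]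
    intro hne
    by_contra hvJ
    refine hJ' v hvJ ?_ rfl
    rw [readPerm_eq_some hσ ⟨v, hv⟩]
    intro h0
    refine hne ?_
    have : σ ⟨v, hv⟩ = ⟨0, hpos⟩ := Fin.ext h0
    rw [← this, Equiv.symm_apply_apply]
  have := (Finset.card_le_card hsub).trans (Finset.card_insert_le _ _)
  rw [Finset.card_range] at this
  omega

/-- The overhead is quadratic in n, hence linear in n^6 ≤ t + 1. -/
theorem isoProg_time_le {n t C : ℕ} (hn : n ^ 6 ≤ t + 1) (hC : C = 1500) :
    2 * t + 2 * ((n + 1) * (44 * (n + 1) + 8)) + 13 * (n * (14 * n + 22)) + 36 * n + 330 ≤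
      C * (t + 1) ^ C := by
  have h1 : n ≤ n ^ 6 := Nat.le_self_pow (by norm_num) n
  have h2 : n * n ≤ n ^ 6 := by
    rcases Nat.eq_zero_or_pos n with rfl | h
    · simp
    · calc n * n = n ^ 2 := (sq n).symm
        _ ≤ n ^ 6 := Nat.pow_le_pow_right h (by norm_num)
  have h3 : t + 1 ≤ (t + 1) ^ C := Nat.le_self_pow (by omega) _
  have h4 : C * (t + 1) ≤ C * (t + 1) ^ C := Nat.mul_le_mul_left C h3
  refine le_trans ?_ h4
  rw [hC]
  nlinarith

theorem forward_generation :
    ∃ c C : ℕ, 0 < c ∧ ∀ (t : ℕ → ℕ) (A : Prog), GeneratesAut A t (1 / 2) →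
      ∃ B : Prog, DecidesGraphIso B (fun n => C * (t (n ^ c) + 1) ^ C) := by
  obtain ⟨C, hC⟩ : ∃ C : ℕ, C = 1500 := ⟨_, rfl⟩
  refine ⟨6, C, by norm_num, fun t A hA => ⟨isoProg A, drawFree_isoProg hA.1, ?_⟩⟩
  intro n G₁ G₂
  rcases Nat.lt_or_ge n 2 with hn | hn
  · obtain ⟨s, hs, hs1⟩ := exec_isoProg_small hn G₁ G₂ A
    have hs := hs.mono (t' := C * (t (n ^ 6) + 1) ^ C) (by
      have : 1 ≤ (t (n ^ 6) + 1) ^ C := Nat.one_le_pow _ _ (Nat.succ_pos _)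
      calc 12 ≤ C * 1 := by omega
        _ ≤ _ := Nat.mul_le_mul_left C this)
    have hiso : Nonempty (G₁ ≃g G₂) := by
      have : Subsingleton (Fin n) := Fin.subsingleton_iff_le_one.2 (by omega)
      refine ⟨⟨Equiv.refl _, fun {a b} => ?_⟩⟩
      obtain rfl := Subsingleton.elim a b
      simp
    simp only [hs.run_eq, PMF.pure_map]
    refine ⟨fun c hc => ?_, fun _ => ?_, fun h => (not_isEmpty_iff.2 hiso h).elim⟩
    · rw [PMF.mem_support_pure_iff] at hc
      rw [hc]
      rfl
    · rw [prob, (PMF.toOuterMeasure_apply_eq_one_iff _ _).2, ENNReal.toReal_one]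
      · norm_num
      · intro c hc
        rw [PMF.mem_support_pure_iff] at hc
        rw [hc]
        exact hs1
  · obtain ⟨Γ, hΓ⟩ : ∃ Γ, Γ = gadget (le_pow_six hn) (pairFamily G₁ G₂) := ⟨_, rfl⟩
    obtain ⟨hhalt, htv⟩ := hA.2 (n ^ 6) Γ
    obtain ⟨F, hF, hval⟩ := exec_isoProg hn hΓ hA.1 hhalt
    set μ := run noSource A (graphInput Γ) (t (n ^ 6)) with hμ
    have hF := hF.mono (isoProg_time_le (le_time_of_generatesAut hA (n ^ 6)) hC)
    simp only [hF.run_eq]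
    refine ⟨fun c hc => ?_, fun ⟨e⟩ => ?_, fun hempty => ?_⟩
    · rw [PMF.support_map] at hc
      obtain ⟨s, -, rfl⟩ := hc
      rfl
    -- The total variation bound costs 1/2 of the probability 12/13 that an exactly uniform
    -- automorphism passes the test.
    · have hpass : 12 / 13 - 1 / 2 ≤
          prob μ {c | EmbedsFirst n (adjArray Γ) (c.state.arr 1 0)} := by
        have h1 := prob_uniformAut_moves (hN := le_pow_six hn) e
        rw [← hΓ] at h1
        have h2 := prob_sub_le_of_tvDist htv {o | ∃ σ, o = some σ ∧ σ ∈ Aut Γ ∧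
          ¬ (σ (apex (le_pow_six hn)) : ℕ) < n + 1}
        have h3 := prob_mono_support (μ := μ)
          (E := (fun c => readPerm (n ^ 6) (c.state.arr 1 0)) ⁻¹'
            {o | ∃ σ, o = some σ ∧ σ ∈ Aut Γ ∧ ¬ (σ (apex (le_pow_six hn)) : ℕ) < n + 1})
          (F := {c | EmbedsFirst n (adjArray Γ) (c.state.arr 1 0)}) (by
            rintro c - ⟨σ, hσ, hmem, hmove⟩
            subst hΓ
            exact embedsFirst_of_aut hmem hmove (readPerm_eq_some hσ))
        linarith
      rw [prob_map]
      have hcompl := prob_compl (μ.bind fun c => μ.bind fun d => PMF.pure (F c d))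
        ((fun s' => (⟨[], s'⟩ : Config Unit)) ⁻¹' {c | c.state.var 0 = 1})
      have hle := prob_bind_bind_le (μ := μ) (F := F)
        (P := fun c => EmbedsFirst n (adjArray Γ) (c.state.arr 1 0))
        (E := ((fun s' => (⟨[], s'⟩ : Config Unit)) ⁻¹' {c | c.state.var 0 = 1})ᶜ)
        fun c d h => not_or.1 fun hcd => h ((hval c d).1 hcd)
      have hnot := prob_compl μ {c | EmbedsFirst n (adjArray Γ) (c.state.arr 1 0)}
      have hnn : 0 ≤ prob μ {c | ¬ EmbedsFirst n (adjArray Γ) (c.state.arr 1 0)} :=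
        ENNReal.toReal_nonneg
      have hq : prob μ {c | ¬ EmbedsFirst n (adjArray Γ) (c.state.arr 1 0)} ≤ 15 / 26 := by
        have : prob μ {c | ¬ EmbedsFirst n (adjArray Γ) (c.state.arr 1 0)} =
          1 - prob μ {c | EmbedsFirst n (adjArray Γ) (c.state.arr 1 0)} := hnot
        rw [this]
        linarith
      -- (15/26)^2 = 225/676 is just below 1/3. With twelve cones in all, the failure bound would be
      -- (7/12)^2 > 1/3.
      have hsq : prob μ {c | ¬ EmbedsFirst n (adjArray Γ) (c.state.arr 1 0)} ^ 2 ≤ 1 / 3 := by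
        nlinarith
      linarith
    -- The error is one-sided: without an isomorphism no output whatsoever passes the test.
    · rw [prob_map, prob, (PMF.toOuterMeasure_apply_eq_one_iff _ _).2, ENNReal.toReal_one]
      · norm_num
      · intro s hs
        rw [PMF.mem_support_bind_iff] at hs
        obtain ⟨c, -, hs⟩ := hs
        rw [PMF.mem_support_bind_iff] at hs
        obtain ⟨d, -, hs⟩ := hs
        rw [PMF.mem_support_pure_iff] at hs
        subst hs
        have hno : ∀ c : Config Unit, ¬ EmbedsFirst n (adjArray Γ) (c.state.arr 1 0) :=
          fun c h => by
            subst hΓ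
            exact hempty.elim (nonempty_iso_of_embedsFirst (by omega) h).some
        exact (hval c d).2 (not_or.2 ⟨hno c, hno d⟩)

end InvGen

/-- First part: one program learns, from uniform random automorphisms of an unknown graph, a
sampler for the automorphism group. Second part: forward generation is as hard as graph
isomorphism. -/
theorem mainTheorem12 :
    (∃ (A : InvGen.Prog) (C : ℕ) (k T : ℕ → ℚ → ℕ),
      ∀ (n : ℕ) (G : SimpleGraph (Fin n)) (ε δ : ℚ), 0 < ε → ε ≤ 1 → 0 < δ → δ ≤ 1 →
        (k n δ : ℝ) ≤ C * (n * Real.log n + Real.log (1 / δ) + 1) ∧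
        ∃ t : ℕ, (t : ℝ) ≤ C * (n + Real.log (1 / ε) + Real.log (1 / δ) + 1) ^ C ∧
          (∀ c ∈ (InvGen.run (InvGen.autSource G) A (InvGen.inverseInput n ε δ) t).support,
            c.Halted ∧ c.state.samples.length = k n δ ∧
            ∃ W : InvGen.CayleySampler n, InvGen.Describes c.state W ∧
              W.gens = c.state.samples ++ c.state.samples.map (fun g => g⁻¹) ∧
              W.steps = T n ε ∧
              W.TimeAtMost (C * (n * Real.log n + Real.log (1 / ε) + 1))) ∧
          1 - (δ : ℝ) ≤
            InvGen.prob (InvGen.run (InvGen.autSource G) A (InvGen.inverseInput n ε δ) t)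
              {c | ∃ W : InvGen.CayleySampler n, InvGen.Describes c.state W ∧
                InvGen.tvDist W.law (InvGen.uniformAut G) ≤ ε}) ∧
    (∃ c C : ℕ, 0 < c ∧
      ∀ (t : ℕ → ℕ) (A : InvGen.Prog), InvGen.GeneratesAut A t (1 / 2) →
        ∃ B : InvGen.Prog,
          InvGen.DecidesGraphIso B (fun n => C * (t (n ^ c) + 1) ^ C)) :=
  ⟨InvGen.inverse_generation, InvGen.forward_generation⟩
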